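/- Let $X$ be a real random variable with mean $\mu$ and variance $\sigma^2\in(0,\infty)$, and put $\zeta(X)=\inf\{a>0:\ \mathbb E(|X-\mu|^2\mathbf 1\{|X-\mu|\le\sigma a\})\ge\sigma^2/2\}$. Contamination model: a sample of $N=N'+\mathcal O=kn$ observations ($k\ge1$, $n\ge2$) consists of $N'$ independent copies of $X$ (inliers) and of $\mathcal O$ further random variables with arbitrary joint distribution (outliers). The combined sample is divided uniformly at random into $k$ disjoint blocks $G_1,\dots,G_k$ of size $n$; the outliers together with the random partition are independent of the inliers. Let $\bar\mu_j$ and $\widehat\sigma_j$, $\widehat\sigma_j^2=\frac1n\sum_{i\in G_j}(X_i-\bar\mu_j)^2$, be the sample mean and sample standard deviation of block $G_j$, and for real $p\ge1$ let $$\widehat\mu_{N,p}=\sum_{j=1}^k\alpha_j\bar\mu_j,\qquad \alpha_j=\frac{1/\widehat\sigma_j^p}{\sum_{l=1}^k1/\widehat\sigma_l^p}.$$ Let $W_j$ be the number of outliers in $G_j$, let $\bar\mu_j^I$ and $\bar\mu_j^C$ be the means of the inliers and of the outliers in $G_j$, and let $$\alpha(\mathcal O)=1+\min_{j:\,W_j\ne0}\frac{W_j(\bar\mu_j^I-\bar\mu_j^C)^2}{n\sigma^2},\qquad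 \mathcal E_p=\Big\{\Big(\frac1k\sum_{j=1}^k\frac1{\widehat\sigma_j^p}\Big)^{-1}\le\Big(\frac{4\sigma}{1-C}\Big)^p\Big\},$$ where $1/0=\infty$ and $1/\infty=0$ in the definition of $\mathcal E_p$; for $\mathcal O=0$ the term of the bound below that contains $\alpha(\mathcal O)$ is zero. Theorem. There are constants $C_p>0$ depending only on $p$ and $c>0$ depending only on $\zeta(X)$ such that the following holds. Suppose that $\mathbb E|X-\mu|^{1+\delta}<\infty$ for some $1\le\delta\le2$. Then there is a function $\phi(\delta,n)$, which depends only on $\delta$, $n$ and the distribution of $X$, with $\phi(\delta,n)=o(n^{-\delta/2})$ if $\delta<2$ and $\phi(\delta,n)=O(n^{-1})$ if $\delta=2$ as $n\to\infty$, such that for all real $p\ge1$, all $C<1$, all $k\ge1$, $n\ge2$ and $\mathcal O\le Ck$, every sample from the contamination model and every $s\ge0$, the following event has probability at least $1-2e^{-s}-ke^{-cn}$: either $\mathcal E_p$ does not hold, or all $\widehat\sigma_j$ are positive, every block contains an inlier (so that $\widehat\mu_{N,p}$ and $\alpha(\mathcal O)$ are well defined), and $$|\widehat\mu_{N,p}-\mu|\le\frac{C_p\sigma}{(1-C)^p}\left(\sqrt{\frac{s+1}N}+\phi(\delta,n)+\alpha(\mathcal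 O)^{-(p-1)/2}\,\frac{\mathcal O}{k\sqrt n}\right).$$ -/

import Mathlib

open MeasureTheory ProbabilityTheory Filter Asymptotics

noncomputable section

namespace RobustMean

/-! ### Quantities attached to the law of a real random variable -/

/-- The mean `μ` of the law `P`. -/
def mean (P : Measure ℝ) : ℝ := ∫ x, x ∂P

/-- The standard deviation `σ` of the law `P`. -/
def std (P : Measure ℝ) : ℝ := √(variance id P)

/-- `ζ(X) = inf {a > 0 : E(|X - μ|² 1{|X - μ| ≤ σ a}) ≥ σ² / 2}` for `X` with law `P`. -/
def zeta (P : Measure ℝ) : ℝ :=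
  sInf {a : ℝ | 0 < a ∧
    std P ^ 2 / 2 ≤ ∫ x in {x : ℝ | |x - mean P| ≤ std P * a}, |x - mean P| ^ 2 ∂P}

/-! ### Sample quantities -/

section Sample

variable {ι : Type*} [Fintype ι]

/-- The sample mean of the observations with index in `B`. -/
def sampleMean (x : ι → ℝ) (B : Finset ι) : ℝ := (∑ i ∈ B, x i) / (B.card : ℝ)

/-- The sample standard deviation of the observations with index in `B`. -/
def sampleStd (x : ι → ℝ) (B : Finset ι) : ℝ :=
  √((∑ i ∈ B, (x i - sampleMean x B) ^ 2) / (B.card : ℝ))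

/-- The block `G_j` of the partition of the index set given by the labelling `g`. -/
def block {k : ℕ} (g : ι → Fin k) (j : Fin k) : Finset ι :=
  Finset.univ.filter (fun i => g i = j)

/-- The labellings of the index set by `k` blocks, all of cardinality `n`. -/
def equipartitions (ι : Type*) [Fintype ι] (k n : ℕ) : Set (ι → Fin k) :=
  {g | ∀ j, (block g j).card = n}

/-- The weight of block `j`, proportional to `1 / σ̂_j ^ p`
(meaningful when all block standard deviations are positive). -/
def weight {k : ℕ} (p : ℝ) (x : ι → ℝ) (g : ι → Fin k) (j : Fin k) : ℝ :=
  (1 / sampleStd x (block g j) ^ p) / ∑ l, 1 / sampleStd x (block g l) ^ p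

/-- The estimator `μ̂_{N,p}`: the weighted average of the block means. -/
def estimator {k : ℕ} (p : ℝ) (x : ι → ℝ) (g : ι → Fin k) : ℝ :=
  ∑ j, weight p x g j * sampleMean x (block g j)

/-- The event `E_p`: the harmonic mean of the `σ̂_j ^ p` is at most `(4 σ / (1 - C)) ^ p`.
If some `σ̂_j` vanishes, then `1 / σ̂_j ^ p = ∞`, the harmonic mean is zero, and the inequality
holds. -/
def EventE {k : ℕ} (p C σ : ℝ) (x : ι → ℝ) (g : ι → Fin k) : Prop :=
  (∃ j, sampleStd x (block g j) = 0) ∨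
    ((1 / (k : ℝ)) * ∑ j, 1 / sampleStd x (block g j) ^ p)⁻¹ ≤ (4 * σ / (1 - C)) ^ p

end Sample

/-! ### Outliers: the index set is `Fin N' ⊕ Fin O`, first the inliers, then the outliers -/

section Outliers

variable {N' O k : ℕ}

/-- The indices of the inliers in block `j`. -/
def inlierBlock (g : Fin N' ⊕ Fin O → Fin k) (j : Fin k) : Finset (Fin N' ⊕ Fin O) :=
  (block g j).filter (fun i => i.isLeft = true)

/-- The indices of the outliers in block `j`. -/
def outlierBlock (g : Fin N' ⊕ Fin O → Fin k) (j : Fin k) : Finset (Fin N' ⊕ Fin O) :=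
  (block g j).filter (fun i => i.isRight = true)

/-- The number `W_j` of outliers in block `j`. -/
def outlierCount (g : Fin N' ⊕ Fin O → Fin k) (j : Fin k) : ℕ := (outlierBlock g j).card

/-- The magnitude of the outliers,
`α = 1 + min_{j : W_j ≠ 0} W_j (μ̄_j^I - μ̄_j^C)² / (n σ²)`.
(Without outliers the minimum is over the empty set, and `α = 1` here.) -/
def alpha (n : ℕ) (σ : ℝ) (x : Fin N' ⊕ Fin O → ℝ) (g : Fin N' ⊕ Fin O → Fin k) : ℝ :=
  1 + ⨅ j : {j : Fin k // outlierCount g j ≠ 0},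
    (outlierCount g j.1 : ℝ) *
      (sampleMean x (inlierBlock g j.1) - sampleMean x (outlierBlock g j.1)) ^ 2 /
        ((n : ℝ) * σ ^ 2)

/-- The contamination model. The inliers `X` are i.i.d. with law `P`; the outliers `Y` are
arbitrary random variables; the combined sample is divided uniformly at random into `k` blocks of
size `n`; outliers and partition are independent of the inliers. -/
structure IsContaminatedSample {Ω : Type*} [MeasurableSpace Ω] (Q : Measure Ω) (P : Measure ℝ)
    (n : ℕ) (X : Fin N' → Ω → ℝ) (Y : Fin O → Ω → ℝ)
    (G : Ω → (Fin N' ⊕ Fin O → Fin k)) : Prop where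
  measurable_inlier : ∀ i, Measurable (X i)
  measurable_outlier : ∀ i, Measurable (Y i)
  measurable_partition : Measurable G
  law_inlier : ∀ i, Q.map (X i) = P
  iIndep_inlier : iIndepFun X Q
  law_partition : Q.map G = uniformOn (equipartitions (Fin N' ⊕ Fin O) k n)
  indep : IndepFun (fun ω i => X i ω) (fun ω => ((fun i => Y i ω), G ω)) Q

/-- The combined sample. -/
def combined {Ω : Type*} (X : Fin N' → Ω → ℝ) (Y : Fin O → Ω → ℝ) (ω : Ω) :
    Fin N' ⊕ Fin O → ℝ :=
  Sum.elim (fun i => X i ω) (fun i => Y i ω)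

end Outliers

end RobustMean

end

namespace RobustMean

/-! ### Elementary exponential inequalities -/

/-! Standardize the inliers to mean zero and variance one. In each block let `m` and `v` be their
mean and second moment, so that their empirical variance is `v - m ^ 2`. Since the weights sum to
one, the error of the estimator is a quotient: the sum over blocks of (block mean minus μ) / σ̂_j^p,
divided by the sum of the 1 / σ̂_j^p. The event `EventE` is a lower bound for this denominator, so
only the numerator needs work (`abs_estimator_sub_le`).

Concentration. Self-normalization replaces higher moments: by the method of mixtures, `|m| / √(v +
1)` is sub-Gaussian at scale n^(-1/2) for every standardized law
(`lintegral_exp_selfNormalized_le`). The power of the empirical variance is harmless once that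
variance is at least `(v + 1) / 10`. This holds in all blocks outside an event of probability k
e^(-cn): truncated squares, whose mean is controlled by ζ, keep `v` away from zero, and the
self-normalized mean is small. Replacing the variance by `truncVar` gives a statistic that is always
dominated by the self-normalized mean, so its sum over independent clean blocks deviates from its
expectation by at most a multiple of √(k(s+1)/n).

Bias. The expectation of the truncated statistic is computed one observation at a time. If the
weight were built without `Z i`, independence would make the term vanish; what remains is the
sensitivity of the weight to a single observation, of order E|Z| min(1, Z²/n) + 1/n. Domination by
|Z|^(1+δ) gives the rate of φ.

Outliers. If at most half of a block is contaminated, a far outlier mean shifts the block mean but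
also inflates the block variance. One factor σ̂_j absorbs the shift, and the remaining p - 1 factors
give α^(-(p-1)/2). These blocks are summed in absolute value, which costs 𝒪/√n. A majority of
outliers in some block is excluded by counting equipartitions (`uniformOn_equipartitions_le`). The
outliers are treated pathwise: the exceptional event involves only inliers and partition, so their
joint law is irrelevant.

Small n. The crude constants in front of e^(-cn) are absorbed only for n above a threshold. Below
it, c is so small that the claim is vacuous for k ≥ 2. For k = 1 there are no outliers and the
estimator is a plain sample mean; φ is enlarged for these finitely many n, and it remains to bound
the probability that two inliers coincide (`measureReal_singleton_le`). -/

lemma exp_sub_sq_le (x : ℝ) : Real.exp (x - x ^ 2) ≤ 1 + x + x ^ 2 := by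
  have h1 : x ^ 2 - x + 1 ≤ Real.exp (x ^ 2 - x) := Real.add_one_le_exp _
  have h2 : 0 < x ^ 2 - x + 1 := by nlinarith [sq_nonneg (x - 1 / 2)]
  have h3 : 0 < 1 + x + x ^ 2 := by nlinarith [sq_nonneg (x + 1 / 2)]
  have h4 : Real.exp (x - x ^ 2) * Real.exp (x ^ 2 - x) = 1 := by
    rw [← Real.exp_add]; simp
  have h5 : 0 < Real.exp (x - x ^ 2) := Real.exp_pos _
  have h6 : Real.exp (x - x ^ 2) * (x ^ 2 - x + 1) ≤ 1 := by
    have := mul_le_mul_of_nonneg_left h1 h5.le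
    rwa [h4] at this
  -- The product equals 1 + x² + x⁴.
  have h7 : 1 ≤ (1 + x + x ^ 2) * (x ^ 2 - x + 1) := by nlinarith [sq_nonneg x, sq_nonneg (x ^ 2)]
  by_contra! h
  nlinarith

/-- For a centred variable the linear term integrates to zero, so a moment generating function is
controlled by the moment of exp(x²) alone. -/
lemma exp_le_add_exp_sq (x : ℝ) : Real.exp x ≤ x + Real.exp (x ^ 2) := by
  have hsq : x ^ 2 + 1 ≤ Real.exp (x ^ 2) := Real.add_one_le_exp _
  rcases le_total |x| 1 with h | h
  · have := (abs_le.1 (Real.abs_exp_sub_one_sub_id_le h)).2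
    linarith
  · rcases le_abs'.1 h with h | h
    · have : Real.exp x ≤ 1 := Real.exp_le_one_iff.2 (by linarith)
      nlinarith
    · have : Real.exp x ≤ Real.exp (x ^ 2) := Real.exp_le_exp.2 (by nlinarith)
      linarith

/-! ### Standardized samples -/

/-- A law with mean zero and variance one. -/
structure IsStandardized (ν : Measure ℝ) : Prop where
  prob : IsProbabilityMeasure ν
  integrable_sq : Integrable (fun x => x ^ 2) ν
  mean_zero : ∫ x, x ∂ν = 0
  var_one : ∫ x, x ^ 2 ∂ν = 1

/-- An i.i.d. sample with law `ν`. -/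
structure IsIIDSample {Ω ι : Type*} [MeasurableSpace Ω] (Q : Measure Ω) (ν : Measure ℝ)
    (Z : ι → Ω → ℝ) : Prop where
  meas : ∀ i, Measurable (Z i)
  law : ∀ i, Q.map (Z i) = ν
  iIndep : iIndepFun Z Q

section Sample

variable {Ω ι : Type*} [MeasurableSpace Ω] {Q : Measure Ω} {ν : Measure ℝ} {Z : ι → Ω → ℝ}

lemma IsIIDSample.integral_comp (h : IsIIDSample Q ν Z) (i : ι) {f : ℝ → ℝ} (hf : Measurable f) :
    ∫ ω, f (Z i ω) ∂Q = ∫ x, f x ∂ν := by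
  rw [← h.law i, integral_map (h.meas i).aemeasurable hf.aestronglyMeasurable]

lemma IsIIDSample.integrable_comp (h : IsIIDSample Q ν Z) (i : ι) {f : ℝ → ℝ}
    (hi : Integrable f ν) : Integrable (fun ω => f (Z i ω)) Q := by
  rw [← h.law i] at hi
  exact hi.comp_measurable (h.meas i)

lemma IsStandardized.integrable_id (h : IsStandardized ν) : Integrable (fun x : ℝ => x) ν := by
  have := h.prob
  refine (h.integrable_sq.add (integrable_const (1 : ℝ))).mono' (by fun_prop) ?_
  filter_upwards with x
  rw [Real.norm_eq_abs]
  simp only [Pi.add_apply]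
  nlinarith [sq_nonneg (|x| - 1), sq_abs x, abs_nonneg x]

/-- The compensator -t²x² bounds the exponent by 1/4 per observation, so no exponential moment of
the law is needed. By `exp_sub_sq_le` each factor has expectation at most 1 + t² ≤ exp(t²), and
independence multiplies the factors. -/
lemma integral_exp_sub_sq_le [IsProbabilityMeasure Q] (hν : IsStandardized ν)
    (h : IsIIDSample Q ν Z) (I : Finset ι) (t : ℝ) :
    ∫⁻ ω, ENNReal.ofReal (Real.exp (t * ∑ i ∈ I, Z i ω - t ^ 2 * ∑ i ∈ I, Z i ω ^ 2)) ∂Q ≤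
      ENNReal.ofReal (Real.exp (t ^ 2 * I.card)) := by
  have := hν.prob
  have hm : ∀ i, Measurable (Z i) := h.meas
  have hbd : ∀ x : ℝ, t * x - t ^ 2 * x ^ 2 ≤ 1 / 4 := fun x => by
    nlinarith [sq_nonneg (t * x - 1 / 2)]
  have hsum : ∀ ω, t * ∑ i ∈ I, Z i ω - t ^ 2 * ∑ i ∈ I, Z i ω ^ 2 =
      ∑ i ∈ I, (t * Z i ω - t ^ 2 * Z i ω ^ 2) := fun ω => by
    rw [Finset.mul_sum, Finset.mul_sum, Finset.sum_sub_distrib]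
  have hmeas : Measurable fun ω => ∑ i ∈ I, (t * Z i ω - t ^ 2 * Z i ω ^ 2) := by fun_prop
  have hint : Integrable (fun ω => Real.exp (∑ i ∈ I, (t * Z i ω - t ^ 2 * Z i ω ^ 2))) Q := by
    refine Integrable.of_bound (C := Real.exp (∑ i ∈ I, (1 / 4 : ℝ)))
      (by fun_prop) (Eventually.of_forall fun ω => ?_)
    rw [Real.norm_eq_abs, abs_of_pos (Real.exp_pos _), Real.exp_le_exp]
    exact Finset.sum_le_sum fun i _ => hbd _
  simp_rw [hsum]
  rw [← ofReal_integral_eq_lintegral_ofReal hint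
    (Eventually.of_forall fun _ => (Real.exp_pos _).le)]
  refine ENNReal.ofReal_le_ofReal ?_
  have hind : iIndepFun (fun i ω => t * Z i ω - t ^ 2 * Z i ω ^ 2) Q :=
    h.iIndep.comp (fun _ x => t * x - t ^ 2 * x ^ 2) (fun _ => by fun_prop)
  have key := hind.mgf_sum (t := 1) (fun i => by fun_prop) I
  have h1 : mgf (∑ i ∈ I, fun ω => t * Z i ω - t ^ 2 * Z i ω ^ 2) Q 1 =
      ∫ ω, Real.exp (∑ i ∈ I, (t * Z i ω - t ^ 2 * Z i ω ^ 2)) ∂Q := by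
    simp [mgf, Finset.sum_apply]
  rw [← h1, key]
  have h2 : ∀ i ∈ I, mgf (fun ω => t * Z i ω - t ^ 2 * Z i ω ^ 2) Q 1 ≤ Real.exp (t ^ 2) := by
    intro i _
    simp only [mgf, one_mul]
    rw [h.integral_comp i (f := fun x => Real.exp (t * x - t ^ 2 * x ^ 2)) (by fun_prop)]
    calc ∫ x, Real.exp (t * x - t ^ 2 * x ^ 2) ∂ν
        ≤ ∫ x, (1 + t * x + t ^ 2 * x ^ 2) ∂ν := by
          refine integral_mono ?_ ?_ fun x => ?_
          · refine Integrable.of_bound (C := Real.exp (1 / 4)) (by fun_prop)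
              (Eventually.of_forall fun x => ?_)
            rw [Real.norm_eq_abs, abs_of_pos (Real.exp_pos _), Real.exp_le_exp]
            exact hbd x
          · exact ((integrable_const _).add (hν.integrable_id.const_mul t)).add
              (hν.integrable_sq.const_mul _)
          · have := exp_sub_sq_le (t * x)
            simpa [mul_pow] using this
      _ = 1 + t ^ 2 := by
          have hi : Integrable (fun x => 1 + t * x) ν :=
            (integrable_const _).add (hν.integrable_id.const_mul t)
          rw [integral_add hi (hν.integrable_sq.const_mul _), integral_add (integrable_const _)
            (hν.integrable_id.const_mul t), integral_const_mul, integral_const_mul,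
            hν.mean_zero, hν.var_one]
          simp
      _ ≤ Real.exp (t ^ 2) := by linarith [Real.add_one_le_exp (t ^ 2)]
  calc ∏ i ∈ I, mgf (fun ω => t * Z i ω - t ^ 2 * Z i ω ^ 2) Q 1
      ≤ ∏ i ∈ I, Real.exp (t ^ 2) :=
        Finset.prod_le_prod (fun _ _ => mgf_nonneg) h2
    _ = Real.exp (t ^ 2 * I.card) := by
        rw [Finset.prod_const, ← Real.exp_nat_mul, mul_comm]

lemma lintegral_exp_quadratic {b : ℝ} (hb : 0 < b) (s : ℝ) :
    ∫⁻ t : ℝ, ENNReal.ofReal (Real.exp (t * s - t ^ 2 * b)) =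
      ENNReal.ofReal (√(Real.pi / b) * Real.exp (s ^ 2 / (4 * b))) := by
  have h1 : ∀ t : ℝ, Real.exp (t * s - t ^ 2 * b) =
      Real.exp (-b * (t - s / (2 * b)) ^ 2) * Real.exp (s ^ 2 / (4 * b)) := fun t => by
    rw [← Real.exp_add]; congr 1; field_simp; ring
  have hi : Integrable (fun t : ℝ => Real.exp (-b * (t - s / (2 * b)) ^ 2)) :=
    (integrable_exp_neg_mul_sq hb).comp_sub_right (s / (2 * b))
  simp_rw [h1]
  rw [← ofReal_integral_eq_lintegral_ofReal (hi.mul_const _)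
    (Eventually.of_forall fun _ => by positivity), integral_mul_const,
    integral_sub_right_eq_self (fun t : ℝ => Real.exp (-b * t ^ 2)), integral_gaussian]

/-- The square of the self-normalized sum has an exponential moment, uniformly in the law. -/
lemma lintegral_exp_selfNormalized_le [IsProbabilityMeasure Q] (hν : IsStandardized ν)
    (h : IsIIDSample Q ν Z) {I : Finset ι} (hI : I.Nonempty) :
    ∫⁻ ω, ENNReal.ofReal
      (Real.exp ((∑ i ∈ I, Z i ω) ^ 2 / (12 * (∑ i ∈ I, Z i ω ^ 2 + I.card)))) ∂Q ≤ 2 := by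
  have := hν.prob
  have hm : ∀ i, Measurable (Z i) := h.meas
  set m : ℝ := (I.card : ℝ) with hmdef
  have hm0 : 0 < m := by simpa [hmdef] using hI.card_pos
  set S : Ω → ℝ := fun ω => ∑ i ∈ I, Z i ω with hS
  set V : Ω → ℝ := fun ω => ∑ i ∈ I, Z i ω ^ 2 with hV
  have hSm : Measurable S := by fun_prop
  have hVm : Measurable V := by fun_prop
  have hV0 : ∀ ω, 0 ≤ V ω := fun ω => Finset.sum_nonneg fun i _ => sq_nonneg _
  -- Method of mixtures: integrate over t with the additional weight exp(-3mt²/2). The bound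
  -- exp(t²m) uses up part of it and leaves the Gaussian exp(-t²m/2).
  have hmix : ∫⁻ ω, ENNReal.ofReal (√(Real.pi / (V ω + 3 * m / 2)) *
      Real.exp (S ω ^ 2 / (4 * (V ω + 3 * m / 2)))) ∂Q ≤ ENNReal.ofReal √(Real.pi / (m / 2)) := by
    calc _ = ∫⁻ ω, (∫⁻ t : ℝ, ENNReal.ofReal
          (Real.exp (t * S ω - t ^ 2 * (V ω + 3 * m / 2)))) ∂Q := by
          refine lintegral_congr fun ω => ?_
          rw [lintegral_exp_quadratic (by linarith [hV0 ω])]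
      _ = ∫⁻ t : ℝ, ∫⁻ ω, ENNReal.ofReal
          (Real.exp (t * S ω - t ^ 2 * (V ω + 3 * m / 2))) ∂Q := by
          refine lintegral_lintegral_swap ?_
          refine Measurable.aemeasurable ?_
          unfold Function.uncurry
          fun_prop
      _ ≤ ∫⁻ t : ℝ, ENNReal.ofReal (Real.exp (t * 0 - t ^ 2 * (m / 2))) := by
          refine lintegral_mono fun t => ?_
          have e1 : ∀ ω, ENNReal.ofReal (Real.exp (t * S ω - t ^ 2 * (V ω + 3 * m / 2))) =
              ENNReal.ofReal (Real.exp (-(t ^ 2 * (3 * m / 2)))) *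
              ENNReal.ofReal (Real.exp (t * S ω - t ^ 2 * V ω)) := fun ω => by
            rw [← ENNReal.ofReal_mul (Real.exp_pos _).le, ← Real.exp_add]
            congr 2; ring
          simp_rw [e1]
          rw [lintegral_const_mul _ (by fun_prop)]
          calc _ ≤ ENNReal.ofReal (Real.exp (-(t ^ 2 * (3 * m / 2)))) *
                ENNReal.ofReal (Real.exp (t ^ 2 * m)) := by
                gcongr
                exact integral_exp_sub_sq_le hν h I t
            _ = _ := by
                rw [← ENNReal.ofReal_mul (Real.exp_pos _).le, ← Real.exp_add]
                congr 2; ring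
      _ = _ := by
          rw [lintegral_exp_quadratic (by positivity)]
          simp
  have hVint : ∫⁻ ω, ENNReal.ofReal (V ω) ∂Q = ENNReal.ofReal m := by
    have hi : ∀ i ∈ I, Integrable (fun ω => Z i ω ^ 2) Q := fun i _ =>
      h.integrable_comp i (f := fun x => x ^ 2) hν.integrable_sq
    rw [← ofReal_integral_eq_lintegral_ofReal (integrable_finsetSum _ hi)
      (Eventually.of_forall hV0), integral_finsetSum _ hi]
    congr 1
    rw [Finset.sum_congr rfl fun i _ => h.integral_comp i (f := fun x => x ^ 2) (by fun_prop)]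
    simp [hν.var_one, hmdef]
  set r : ℝ := √(Real.pi / (m / 2)) with hr
  have hr0 : 0 < r := Real.sqrt_pos.2 (by positivity)
  -- The mixture carries a random prefactor, which is w after division by r. It is removed by e ≤
  -- (e²w + 1/w)/2, where e² is the exponential in the mixture, and 1/w is at most an affine
  -- function of `V`, whose expectation is m. The total is 1/2 + 1 + 1/2 = 2.
  have hpt : ∀ ω, Real.exp (S ω ^ 2 / (12 * (V ω + m))) ≤
      1 / (2 * r) * (√(Real.pi / (V ω + 3 * m / 2)) *
        Real.exp (S ω ^ 2 / (4 * (V ω + 3 * m / 2)))) + (1 + 1 / (2 * m) * V ω) := by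
    intro ω
    have hv := hV0 ω
    set w : ℝ := √(Real.pi / (V ω + 3 * m / 2)) / r with hw
    have hw0 : 0 < w := by
      refine div_pos (Real.sqrt_pos.2 ?_) hr0
      have : 0 < V ω + 3 * m / 2 := by linarith
      positivity
    set e : ℝ := Real.exp (S ω ^ 2 / (8 * (V ω + 3 * m / 2))) with he
    have he0 : 0 < e := Real.exp_pos _
    have he2 : Real.exp (S ω ^ 2 / (4 * (V ω + 3 * m / 2))) = e ^ 2 := by
      rw [he, ← Real.exp_nat_mul]; congr 1
      have : V ω + 3 * m / 2 ≠ 0 := by positivity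
      field_simp; norm_num; ring
    have h1 : Real.exp (S ω ^ 2 / (12 * (V ω + m))) ≤ e := by
      rw [he, Real.exp_le_exp]
      exact div_le_div_of_nonneg_left (sq_nonneg _) (by linarith) (by linarith)
    have hwsq : w ^ 2 = m / (2 * V ω + 3 * m) := by
      have h3 : 0 < V ω + 3 * m / 2 := by linarith
      rw [hw, div_pow, hr, Real.sq_sqrt (by positivity), Real.sq_sqrt (by positivity)]
      have : 2 * V ω + 3 * m ≠ 0 := by positivity
      have : V ω + 3 * m / 2 ≠ 0 := by positivity
      field_simp
    have hinv : 1 / w ≤ (1 + (2 * V ω + 3 * m) / m) / 2 := by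
      have h3 : (1 / w) ^ 2 = (2 * V ω + 3 * m) / m := by
        rw [div_pow, hwsq]; simp
      rw [← h3]
      nlinarith [sq_nonneg (1 / w - 1)]
    have h4 : e ≤ (e ^ 2 * w + 1 / w) / 2 := by
      have h5 : 0 ≤ (e * w - 1) ^ 2 / w := by positivity
      have h6 : (e * w - 1) ^ 2 / w = e ^ 2 * w - 2 * e + 1 / w := by
        field_simp; ring
      linarith
    rw [he2]
    have h7 : 1 / (2 * r) * (√(Real.pi / (V ω + 3 * m / 2)) * e ^ 2) = e ^ 2 * w / 2 := by
      rw [hw]; field_simp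
    have h8 : (1 + (2 * V ω + 3 * m) / m) / 2 = 2 * (1 + 1 / (2 * m) * V ω) := by
      field_simp; ring
    rw [h7]
    linarith
  calc _ ≤ ∫⁻ ω, (ENNReal.ofReal (1 / (2 * r)) *
        ENNReal.ofReal (√(Real.pi / (V ω + 3 * m / 2)) *
          Real.exp (S ω ^ 2 / (4 * (V ω + 3 * m / 2)))) +
          (1 + ENNReal.ofReal (1 / (2 * m)) * ENNReal.ofReal (V ω))) ∂Q := by
        refine lintegral_mono fun ω => (ENNReal.ofReal_le_ofReal (hpt ω)).trans ?_
        have hv := hV0 ω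
        rw [ENNReal.ofReal_add (by positivity) (by positivity),
          ENNReal.ofReal_add (by positivity) (by positivity),
          ENNReal.ofReal_mul (by positivity : (0 : ℝ) ≤ 1 / (2 * r)),
          ENNReal.ofReal_mul (by positivity : (0 : ℝ) ≤ 1 / (2 * m)), ENNReal.ofReal_one]
    _ ≤ ENNReal.ofReal (1 / (2 * r)) * ENNReal.ofReal r +
        (1 + ENNReal.ofReal (1 / (2 * m)) * ENNReal.ofReal m) := by
        rw [lintegral_add_left (by fun_prop), lintegral_add_left (by fun_prop),
          lintegral_const_mul _ (by fun_prop), lintegral_const_mul _ (by fun_prop), hVint]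
        simp only [lintegral_const, measure_univ, mul_one]
        gcongr
    _ = 2 := by
        rw [← ENNReal.ofReal_mul (by positivity), ← ENNReal.ofReal_mul (by positivity),
          ← ENNReal.ofReal_one, ← ENNReal.ofReal_add (by positivity) (by positivity),
          ← ENNReal.ofReal_add (by positivity) (by positivity)]
        have : 1 / (2 * r) * r + (1 + 1 / (2 * m) * m) = 2 := by field_simp; norm_num
        rw [this]; simp

end Sample

end RobustMean

namespace RobustMean

/-! ### Sub-Gaussian variables from square-exponential moments -/

section SubGaussian

variable {Ω : Type*} [MeasurableSpace Ω] {Q : Measure Ω}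

lemma exp_mul_le_affine {θ : ℝ} (h0 : 0 ≤ θ) (h1 : θ ≤ 1) (y : ℝ) :
    Real.exp (θ * y) ≤ 1 - θ + θ * Real.exp y := by
  have := convexOn_exp.2 (Set.mem_univ (0 : ℝ)) (Set.mem_univ y) (sub_nonneg.2 h1) h0 (by ring)
  simpa using this

lemma integrable_exp_sq_of_lintegral_le {X : Ω → ℝ} (hX : Measurable X) {K : ℝ}
    (h : ∫⁻ ω, ENNReal.ofReal (Real.exp (X ω ^ 2 / K)) ∂Q ≤ 2) :
    Integrable (fun ω => Real.exp (X ω ^ 2 / K)) Q ∧ ∫ ω, Real.exp (X ω ^ 2 / K) ∂Q ≤ 2 := by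
  have hm : Measurable fun ω => Real.exp (X ω ^ 2 / K) := by fun_prop
  have hi : Integrable (fun ω => Real.exp (X ω ^ 2 / K)) Q := by
    refine ⟨hm.aestronglyMeasurable, ?_⟩
    rw [hasFiniteIntegral_iff_ofReal (Eventually.of_forall fun _ => (Real.exp_pos _).le)]
    exact h.trans_lt (by simp)
  refine ⟨hi, ?_⟩
  rw [← ofReal_integral_eq_lintegral_ofReal hi
    (Eventually.of_forall fun _ => (Real.exp_pos _).le)] at h
  have h2 : (2 : ENNReal) = ENNReal.ofReal 2 := by simp
  rw [h2] at h
  exact (ENNReal.ofReal_le_ofReal_iff (by norm_num)).1 h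

lemma integral_sq_le_of_exp_sq [IsProbabilityMeasure Q] {X : Ω → ℝ} (hX : Measurable X) {K : ℝ}
    (hK : 0 < K) (h : ∫⁻ ω, ENNReal.ofReal (Real.exp (X ω ^ 2 / K)) ∂Q ≤ 2) :
    Integrable (fun ω => X ω ^ 2) Q ∧ ∫ ω, X ω ^ 2 ∂Q ≤ K := by
  obtain ⟨hi, hle⟩ := integrable_exp_sq_of_lintegral_le hX h
  have hpt : ∀ ω, X ω ^ 2 ≤ K * (Real.exp (X ω ^ 2 / K) - 1) := fun ω => by
    have h1 := Real.add_one_le_exp (X ω ^ 2 / K)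
    calc X ω ^ 2 = K * (X ω ^ 2 / K) := by field_simp
      _ ≤ _ := by gcongr; linarith
  have hi2 : Integrable (fun ω => K * (Real.exp (X ω ^ 2 / K) - 1)) Q :=
    (hi.sub (integrable_const _)).const_mul _
  have hi1 : Integrable (fun ω => X ω ^ 2) Q := by
    refine hi2.mono' (by fun_prop) (Eventually.of_forall fun ω => ?_)
    rw [Real.norm_eq_abs, abs_of_nonneg (sq_nonneg _)]
    exact hpt ω
  refine ⟨hi1, (integral_mono hi1 hi2 hpt).trans ?_⟩
  rw [integral_const_mul, integral_sub hi (integrable_const _)]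
  simp
  nlinarith

lemma sq_integral_le_integral_sq [IsProbabilityMeasure Q] {X : Ω → ℝ} (hX : Integrable X Q)
    (hX2 : Integrable (fun ω => X ω ^ 2) Q) : (∫ ω, X ω ∂Q) ^ 2 ≤ ∫ ω, X ω ^ 2 ∂Q := by
  set b := ∫ ω, X ω ∂Q with hb
  have h : 0 ≤ ∫ ω, (X ω - b) ^ 2 ∂Q := integral_nonneg fun _ => sq_nonneg _
  have e : ∀ ω, (X ω - b) ^ 2 = X ω ^ 2 - 2 * b * X ω + b ^ 2 := fun ω => by ring
  simp_rw [e] at h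
  have hi : Integrable (fun ω => X ω ^ 2 - 2 * b * X ω) Q := hX2.sub (hX.const_mul _)
  rw [integral_add hi (integrable_const _), integral_sub hX2 (hX.const_mul _),
    integral_const_mul, ← hb] at h
  simp at h
  nlinarith

lemma integrable_of_integrable_sq [IsProbabilityMeasure Q] {X : Ω → ℝ} (hX : Measurable X)
    (hX2 : Integrable (fun ω => X ω ^ 2) Q) : Integrable X Q := by
  refine (hX2.add (integrable_const (1 : ℝ))).mono' (by fun_prop) (Eventually.of_forall fun x => ?_)
  rw [Real.norm_eq_abs]
  simp only [Pi.add_apply]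
  nlinarith [sq_nonneg (|X x| - 1), sq_abs (X x), abs_nonneg (X x)]

/-- Two ranges of t. For 2t²K ≤ 1, `exp_le_add_exp_sq` removes the linear term and convexity in the
exponent (`exp_mul_le_affine`) interpolates the given moment. For 2t²K ≥ 1, Young's inequality tX ≤
X²/K + Kt²/4 suffices, because the lost constants are then bounded by multiples of Kt². -/
lemma hasSubgaussianMGF_of_exp_sq [IsProbabilityMeasure Q] {X : Ω → ℝ} (hX : Measurable X)
    {K : NNReal} (hK : 0 < K)
    (h : ∫⁻ ω, ENNReal.ofReal (Real.exp (X ω ^ 2 / K)) ∂Q ≤ 2) :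
    HasSubgaussianMGF (fun ω => X ω - ∫ ω', X ω' ∂Q) (8 * K) Q := by
  have hK' : (0 : ℝ) < K := by exact_mod_cast hK
  obtain ⟨hi, hle⟩ := integrable_exp_sq_of_lintegral_le hX h
  obtain ⟨hi2, hle2⟩ := integral_sq_le_of_exp_sq hX hK' h
  have hi1 := integrable_of_integrable_sq hX hi2
  set b := ∫ ω', X ω' ∂Q with hb
  have hbK : b ^ 2 ≤ K := (sq_integral_le_integral_sq hi1 hi2).trans hle2
  have hpt : ∀ t ω, Real.exp (t * (X ω - b)) ≤
      Real.exp (K * t ^ 2 / 4 - t * b) * Real.exp (X ω ^ 2 / K) := fun t ω => by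
    rw [← Real.exp_add, Real.exp_le_exp]
    have : 0 ≤ (X ω - K * t / 2) ^ 2 / K := by positivity
    have e : (X ω - K * t / 2) ^ 2 / K = X ω ^ 2 / K - t * X ω + K * t ^ 2 / 4 := by
      field_simp; ring
    linarith
  have hint : ∀ t, Integrable (fun ω => Real.exp (t * (X ω - b))) Q := fun t =>
    (hi.const_mul (Real.exp (K * t ^ 2 / 4 - t * b))).mono' (by fun_prop)
      (Eventually.of_forall fun ω => by
        rw [Real.norm_eq_abs, abs_of_pos (Real.exp_pos _)]; exact hpt t ω)
  refine ⟨hint, fun t => ?_⟩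
  have hgoal : ((8 * K : NNReal) : ℝ) * t ^ 2 / 2 = 4 * K * t ^ 2 := by push_cast; ring
  rw [hgoal]
  unfold mgf
  rcases le_total (2 * t ^ 2 * K) 1 with hs | hs
  · set θ := 2 * t ^ 2 * (K : ℝ) with hθ
    have hθ0 : 0 ≤ θ := by positivity
    have hY : Integrable (fun ω => t * (X ω - b)) Q := (hi1.sub (integrable_const _)).const_mul _
    have hA : Integrable (fun ω => 1 - θ + θ * Real.exp (X ω ^ 2 / K)) Q :=
      (integrable_const _).add (hi.const_mul _)
    calc ∫ ω, Real.exp (t * (X ω - b)) ∂Q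
        ≤ ∫ ω, (t * (X ω - b) +
            Real.exp (2 * t ^ 2 * b ^ 2) * (1 - θ + θ * Real.exp (X ω ^ 2 / K))) ∂Q := by
          refine integral_mono (hint t) (hY.add (hA.const_mul _)) fun ω => ?_
          refine (exp_le_add_exp_sq _).trans ?_
          gcongr
          calc Real.exp ((t * (X ω - b)) ^ 2)
              ≤ Real.exp (2 * t ^ 2 * b ^ 2 + θ * (X ω ^ 2 / K)) := by
                rw [Real.exp_le_exp]
                have : θ * (X ω ^ 2 / K) = 2 * t ^ 2 * X ω ^ 2 := by rw [hθ]; field_simp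
                rw [this]
                nlinarith [mul_nonneg (sq_nonneg t) (sq_nonneg (X ω + b))]
            _ ≤ _ := by
                rw [Real.exp_add]
                gcongr
                exact exp_mul_le_affine hθ0 hs _
      _ = Real.exp (2 * t ^ 2 * b ^ 2) * (1 - θ + θ * ∫ ω, Real.exp (X ω ^ 2 / K) ∂Q) := by
          rw [integral_add hY (hA.const_mul _), integral_const_mul, integral_const_mul,
            integral_sub hi1 (integrable_const _), integral_add (integrable_const _)
            (hi.const_mul _), integral_const_mul, ← hb]
          simp
      _ ≤ Real.exp (2 * t ^ 2 * K) * Real.exp (2 * t ^ 2 * K) := by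
          gcongr
          have := Real.add_one_le_exp θ
          nlinarith
      _ = _ := by rw [← Real.exp_add]; congr 1; ring
  · calc ∫ ω, Real.exp (t * (X ω - b)) ∂Q
        ≤ ∫ ω, Real.exp (K * t ^ 2 / 4 - t * b) * Real.exp (X ω ^ 2 / K) ∂Q :=
          integral_mono (hint t) (hi.const_mul _) (hpt t)
      _ ≤ Real.exp (K * t ^ 2 / 4 - t * b) * 2 := by
          rw [integral_const_mul]; gcongr
      _ ≤ Real.exp (K * t ^ 2 / 4 - t * b) * Real.exp 1 := by
          gcongr
          linarith [Real.add_one_le_exp 1]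
      _ ≤ _ := by
          rw [← Real.exp_add, Real.exp_le_exp]
          have h1 : 0 ≤ (t * K + b) ^ 2 / K := by positivity
          have e : (t * K + b) ^ 2 / K = t ^ 2 * K + 2 * (t * b) + b ^ 2 / K := by
            field_simp; ring
          have h2 : b ^ 2 / K ≤ 1 := (div_le_one hK').2 hbK
          linarith

end SubGaussian

/-! ### Statistics of disjoint blocks -/

section Blocks

variable {Ω ι : Type*} [MeasurableSpace Ω] {Q : Measure Ω} {ν : Measure ℝ} {Z : ι → Ω → ℝ}

/-- The index set is the disjoint union of the fibres of `g`, so the joint law is a product over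
pairs (fibre, index); currying turns it into a product of the laws of the fibres. -/
lemma iIndepFun_fibers [Fintype ι] {κ : Type*} (hZ : ∀ i, Measurable (Z i)) (h : iIndepFun Z Q)
    (g : ι → κ) : iIndepFun (fun j ω (i : {i // g i = j}) => Z i ω) Q := by
  have := h.isProbabilityMeasure
  have hs : iIndepFun (fun (p : (j : κ) × {i // g i = j}) ω => Z p.2 ω) Q :=
    h.precomp (g := fun p : (j : κ) × {i // g i = j} => (p.2 : ι))
      (Equiv.sigmaFiberEquiv g).injective
  have hp : ∀ i, IsProbabilityMeasure (Q.map (Z i)) := fun i =>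
    Measure.isProbabilityMeasure_map (hZ i).aemeasurable
  have hfib : ∀ j : κ, iIndepFun (fun (i : {i // g i = j}) ω => Z i ω) Q := fun j =>
    h.precomp (g := fun i : {i // g i = j} => (i : ι)) Subtype.val_injective
  rw [iIndepFun_iff_map_fun_eq_infinitePi_map (fun j => by fun_prop)]
  rw [iIndepFun_iff_map_fun_eq_infinitePi_map (fun j => hZ _)] at hs
  have e1 : ∀ j : κ, Q.map (fun ω (i : {i // g i = j}) => Z i ω) =
      Measure.infinitePi fun i : {i // g i = j} => Q.map (Z i) := fun j =>
    (iIndepFun_iff_map_fun_eq_infinitePi_map (fun i => hZ _)).1 (hfib j)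
  simp_rw [e1]
  rw [← Measure.infinitePi_map_piCurry (fun (j : κ) (i : {i // g i = j}) => Q.map (Z i)),
    ← hs, Measure.map_map (by fun_prop) (measurable_pi_lambda _ fun _ => hZ _)]
  rfl

/-- The second empirical moment of the observations with index in `B`. -/
noncomputable def secondMoment (x : ι → ℝ) (B : Finset ι) : ℝ := (∑ i ∈ B, x i ^ 2) / (B.card : ℝ)

lemma secondMoment_nonneg (x : ι → ℝ) (B : Finset ι) : 0 ≤ secondMoment x B :=
  div_nonneg (Finset.sum_nonneg fun _ _ => sq_nonneg _) (Nat.cast_nonneg _)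

lemma measurable_blockStat (hZ : ∀ i, Measurable (Z i)) (B : Finset ι) {f : ℝ → ℝ → ℝ}
    (hf : Measurable fun q : ℝ × ℝ => f q.1 q.2) :
    Measurable fun ω => f (secondMoment (fun i => Z i ω) B) (sampleMean (fun i => Z i ω) B) := by
  refine hf.comp (Measurable.prodMk ?_ ?_)
  · fun_prop
  · fun_prop

/-- The self-normalized mean `|m| / √(v + 1)` for the mean `m` and the second moment `v`. -/
noncomputable def selfNorm (v m : ℝ) : ℝ := |m| / √(v + 1)

lemma selfNorm_nonneg (v m : ℝ) : 0 ≤ selfNorm v m := by unfold selfNorm; positivity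

lemma measurable_selfNorm : Measurable fun q : ℝ × ℝ => selfNorm q.1 q.2 := by
  unfold selfNorm; fun_prop

lemma selfNorm_sq (x : ι → ℝ) {B : Finset ι} (hB : B.Nonempty) :
    (B.card : ℝ) * selfNorm (secondMoment x B) (sampleMean x B) ^ 2 =
      (∑ i ∈ B, x i) ^ 2 / (∑ i ∈ B, x i ^ 2 + B.card) := by
  have hc : (0 : ℝ) < B.card := by exact_mod_cast hB.card_pos
  have hs : 0 ≤ ∑ i ∈ B, x i ^ 2 := Finset.sum_nonneg fun _ _ => sq_nonneg _
  have hv := secondMoment_nonneg x B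
  rw [selfNorm, div_pow, sq_abs, Real.sq_sqrt (by linarith), secondMoment, sampleMean]
  field_simp

lemma lintegral_exp_selfNorm_le [IsProbabilityMeasure Q] (hν : IsStandardized ν)
    (h : IsIIDSample Q ν Z) {B : Finset ι} (hB : B.Nonempty) :
    ∫⁻ ω, ENNReal.ofReal (Real.exp ((B.card : ℝ) * selfNorm (secondMoment (fun i => Z i ω) B)
      (sampleMean (fun i => Z i ω) B) ^ 2 / 12)) ∂Q ≤ 2 := by
  refine le_trans (le_of_eq ?_) (lintegral_exp_selfNormalized_le hν h hB)
  refine lintegral_congr fun ω => ?_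
  rw [selfNorm_sq _ hB, div_div, mul_comm (12 : ℝ)]

/-- Any block statistic dominated by the self-normalized mean inherits its square-exponential
moment. This serves the studentized mean as well as `selfNorm` itself; the bound on the expectation
is needed for the latter, which is not centred. -/
lemma hasSubgaussianMGF_blockStat [IsProbabilityMeasure Q] (hν : IsStandardized ν)
    (h : IsIIDSample Q ν Z) {B : Finset ι} (hB : B.Nonempty) {f : ℝ → ℝ → ℝ}
    (hf : Measurable fun q : ℝ × ℝ => f q.1 q.2) {M : NNReal} (hM : 0 < M)
    (hle : ∀ x : ι → ℝ, |f (secondMoment x B) (sampleMean x B)| ≤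
      M * selfNorm (secondMoment x B) (sampleMean x B)) :
    HasSubgaussianMGF (fun ω => f (secondMoment (fun i => Z i ω) B) (sampleMean (fun i => Z i ω) B)
      - ∫ ω', f (secondMoment (fun i => Z i ω') B) (sampleMean (fun i => Z i ω') B) ∂Q)
      (8 * (12 * M ^ 2 / B.card)) Q ∧
    (∫ ω', f (secondMoment (fun i => Z i ω') B) (sampleMean (fun i => Z i ω') B) ∂Q) ^ 2 ≤
      12 * M ^ 2 / B.card := by
  have hc : (0 : NNReal) < B.card := by exact_mod_cast hB.card_pos
  have hc' : (0 : ℝ) < B.card := by exact_mod_cast hB.card_pos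
  have hM' : (0 : ℝ) < M := by exact_mod_cast hM
  have hmeas := measurable_blockStat h.meas B hf
  have hK : (0 : NNReal) < 12 * M ^ 2 / B.card := by positivity
  have hexp : ∫⁻ ω, ENNReal.ofReal (Real.exp (f (secondMoment (fun i => Z i ω) B)
      (sampleMean (fun i => Z i ω) B) ^ 2 / ((12 * M ^ 2 / B.card : NNReal) : ℝ))) ∂Q ≤ 2 := by
    refine le_trans (lintegral_mono fun ω => ?_) (lintegral_exp_selfNorm_le hν h hB)
    refine ENNReal.ofReal_le_ofReal (Real.exp_le_exp.2 ?_)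
    push_cast
    rw [div_le_iff₀ (by positivity)]
    have h1 := hle (fun i => Z i ω)
    have h2 := pow_le_pow_left₀ (abs_nonneg _) h1 2
    rw [sq_abs] at h2
    refine h2.trans (le_of_eq ?_)
    field_simp
  refine ⟨hasSubgaussianMGF_of_exp_sq hmeas hK hexp, ?_⟩
  obtain ⟨hi2, hle2⟩ := integral_sq_le_of_exp_sq hmeas (by exact_mod_cast hK) hexp
  refine (sq_integral_le_integral_sq (integrable_of_integrable_sq hmeas hi2) hi2).trans ?_
  exact_mod_cast hle2

lemma HasSubgaussianMGF.mono_param {X : Ω → ℝ} {c d : NNReal} (h : HasSubgaussianMGF X c Q)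
    (hcd : c ≤ d) : HasSubgaussianMGF X d Q := by
  refine ⟨h.integrable_exp_mul, fun t => (h.mgf_le t).trans ?_⟩
  have : (c : ℝ) ≤ d := by exact_mod_cast hcd
  gcongr

variable [Fintype ι]

lemma iIndepFun_blockStat {k : ℕ} (hZ : ∀ i, Measurable (Z i)) (h : iIndepFun Z Q) (g : ι → Fin k)
    {f : Fin k → ℝ → ℝ → ℝ} (hf : ∀ j, Measurable fun q : ℝ × ℝ => f j q.1 q.2) :
    iIndepFun (fun j ω => f j (secondMoment (fun i => Z i ω) (block g j))
      (sampleMean (fun i => Z i ω) (block g j))) Q := by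
  have key := (iIndepFun_fibers hZ h g).comp
    (fun j (z : {i // g i = j} → ℝ) => f j ((∑ i, z i ^ 2) / ((block g j).card : ℝ))
      ((∑ i, z i) / ((block g j).card : ℝ)))
    (fun j => (hf j).comp (Measurable.prodMk (by fun_prop) (by fun_prop)))
  have hmem : ∀ j i, i ∈ block g j ↔ g i = j := fun j i => by simp [block]
  convert key using 2 with j
  funext ω
  simp only [Function.comp, secondMoment, sampleMean]
  rw [Finset.sum_subtype _ (hmem j), Finset.sum_subtype _ (hmem j)]

/-- Deviation inequality for sums of self-normalized statistics over disjoint blocks. -/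
lemma measureReal_sum_blockStat_ge_le [IsProbabilityMeasure Q] (hν : IsStandardized ν)
    (h : IsIIDSample Q ν Z) {k n : ℕ} (hn : 0 < n) (hk : 0 < k) (g : ι → Fin k) (J : Finset (Fin k))
    (hcard : ∀ j ∈ J, n ≤ 2 * (block g j).card) {f : ℝ → ℝ → ℝ}
    (hf : Measurable fun q : ℝ × ℝ => f q.1 q.2) {M : NNReal} (hM : 0 < M)
    (hle : ∀ j ∈ J, ∀ x : ι → ℝ, |f (secondMoment x (block g j)) (sampleMean x (block g j))| ≤
      M * selfNorm (secondMoment x (block g j)) (sampleMean x (block g j)))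
    {s : ℝ} (hs : 0 ≤ s) :
    Q.real {ω | 20 * M * √(k * (s + 1) / n) ≤ ∑ j ∈ J,
      (f (secondMoment (fun i => Z i ω) (block g j)) (sampleMean (fun i => Z i ω) (block g j))
      - ∫ ω', f (secondMoment (fun i => Z i ω') (block g j))
          (sampleMean (fun i => Z i ω') (block g j)) ∂Q)} ≤ Real.exp (-(s + 1)) := by
  have hn' : (0 : ℝ) < n := by exact_mod_cast hn
  have hk' : (0 : ℝ) < k := by exact_mod_cast hk
  have hM' : (0 : ℝ) < M := by exact_mod_cast hM
  have hind := iIndepFun_blockStat (f := fun j v m => f v m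
      - ∫ ω', f (secondMoment (fun i => Z i ω') (block g j))
          (sampleMean (fun i => Z i ω') (block g j)) ∂Q) h.meas h.iIndep g
      (fun j => hf.sub_const _)
  -- 192 = 8 · 12 · 2, where the factor 2 allows for blocks with only n/2 inliers.
  have hsub : ∀ j ∈ J, HasSubgaussianMGF (fun ω =>
      f (secondMoment (fun i => Z i ω) (block g j)) (sampleMean (fun i => Z i ω) (block g j))
      - ∫ ω', f (secondMoment (fun i => Z i ω') (block g j))
          (sampleMean (fun i => Z i ω') (block g j)) ∂Q) (192 * M ^ 2 / n) Q := by
    intro j hj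
    have hc := hcard j hj
    have hB : (block g j).Nonempty := Finset.card_pos.1 (by omega)
    have hc0 : (0 : NNReal) < (block g j).card := by exact_mod_cast hB.card_pos
    refine HasSubgaussianMGF.mono_param
      (hasSubgaussianMGF_blockStat hν h hB hf hM (hle j hj)).1 ?_
    have hc2 : (n : NNReal) ≤ 2 * (block g j).card := by exact_mod_cast hc
    have hn0 : (0 : NNReal) < n := by exact_mod_cast hn
    rw [← mul_div_assoc, div_le_div_iff₀ hc0 hn0]
    calc 8 * (12 * M ^ 2) * (n : NNReal) ≤ 8 * (12 * M ^ 2) * (2 * (block g j).card) := by gcongr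
      _ = _ := by ring
  have hsum := HasSubgaussianMGF.mono_param (d := k * (192 * M ^ 2 / n))
    (HasSubgaussianMGF.sum_of_iIndepFun hind hsub) (by
      rw [Finset.sum_const, nsmul_eq_mul]
      gcongr
      simpa using Finset.card_le_univ J)
  refine (hsum.measure_ge_le (by positivity)).trans ?_
  rw [Real.exp_le_exp, neg_div, neg_le_neg_iff, mul_pow, Real.sq_sqrt (by positivity)]
  push_cast
  rw [le_div_iff₀ (by positivity)]
  have : 0 < (M : ℝ) ^ 2 * (k / n) * (s + 1) := by positivity
  -- 384 = 2 · 192, which is just below 20² = 400.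
  calc (s + 1) * (2 * (k * (192 * (M : ℝ) ^ 2 / n)))
      = 384 * ((M : ℝ) ^ 2 * (k / n) * (s + 1)) := by ring
    _ ≤ 400 * ((M : ℝ) ^ 2 * (k / n) * (s + 1)) := by linarith
    _ = _ := by ring

end Blocks

end RobustMean

namespace RobustMean

/-! ### Blocks with a degenerate empirical variance are unlikely -/

/-- The empirical variance `v - m ^ 2` is at least a tenth of `v + 1`. -/
def WellSpread (v m : ℝ) : Prop := (v + 1) / 10 ≤ v - m ^ 2

section Spread

variable {Ω ι : Type*} [MeasurableSpace Ω] {Q : Measure Ω} {ν : Measure ℝ} {Z : ι → Ω → ℝ}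

/-- Only the lower tail matters, so the squares may be truncated at `a`. They then lie in [0, a²]
with mean at least 1/2, and Hoeffding's inequality with gap 1/4 applies. -/
lemma measureReal_secondMoment_lt_le [IsProbabilityMeasure Q] (hν : IsStandardized ν)
    (h : IsIIDSample Q ν Z) {B : Finset ι} (hB : B.Nonempty) {a : ℝ} (ha : 0 < a)
    (hνa : 1 / 2 ≤ ∫ x in {x : ℝ | |x| ≤ a}, x ^ 2 ∂ν) :
    Q.real {ω | secondMoment (fun i => Z i ω) B < 1 / 4} ≤
      Real.exp (-(1 / (8 * a ^ 4) * B.card)) := by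
  have := hν.prob
  have hc : (0 : ℝ) < B.card := by exact_mod_cast hB.card_pos
  have hA : MeasurableSet {x : ℝ | |x| ≤ a} := measurableSet_le (by fun_prop) (by fun_prop)
  set y : ℝ → ℝ := fun x => - ({x : ℝ | |x| ≤ a}.indicator (fun x => x ^ 2) x) with hy
  have hym : Measurable y := ((by fun_prop : Measurable fun x : ℝ => x ^ 2).indicator hA).neg
  have hy0 : ∀ x, y x ∈ Set.Icc (-a ^ 2) 0 := fun x => by
    simp only [hy, Set.indicator_apply, Set.mem_ofPred_eq]
    split_ifs with hx
    · constructor <;> nlinarith [sq_abs x, abs_nonneg x]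
    · constructor <;> nlinarith
  have hyx : ∀ x, -y x ≤ x ^ 2 := fun x => by
    simp only [hy, Set.indicator_apply, Set.mem_ofPred_eq]
    split_ifs with hx <;> nlinarith
  have hint : ∀ i, ∫ ω, y (Z i ω) ∂Q ≤ -(1 / 2) := fun i => by
    rw [h.integral_comp i hym]
    simp only [hy]
    rw [integral_neg, integral_indicator hA]
    linarith
  have hind : iIndepFun (fun i ω => y (Z i ω) - ∫ ω', y (Z i ω') ∂Q) Q :=
    h.iIndep.comp (fun i x => y x - ∫ ω', y (Z i ω') ∂Q) (fun i => hym.sub_const _)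
  have hsub : ∀ i ∈ B, HasSubgaussianMGF (fun ω => y (Z i ω) - ∫ ω', y (Z i ω') ∂Q)
      ((‖0 - (-a ^ 2)‖₊ / 2) ^ 2) Q := fun i _ =>
    hasSubgaussianMGF_of_mem_Icc (hym.comp (h.meas i)).aemeasurable
      (Eventually.of_forall fun ω => hy0 _)
  have key := HasSubgaussianMGF.measure_sum_ge_le_of_iIndepFun hind hsub
    (ε := B.card / 4) (by positivity)
  refine (measureReal_mono ?_).trans (key.trans (Real.exp_le_exp.2 (le_of_eq ?_)))
  · intro ω hω
    simp only [Set.mem_ofPred_eq, secondMoment] at hω ⊢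
    rw [div_lt_iff₀ hc] at hω
    rw [Finset.sum_sub_distrib]
    have h1 : ∑ i ∈ B, -y (Z i ω) ≤ ∑ i ∈ B, Z i ω ^ 2 := Finset.sum_le_sum fun i _ => hyx _
    have h2 : ∑ i ∈ B, ∫ ω', y (Z i ω') ∂Q ≤ ∑ i ∈ B, (-(1 / 2) : ℝ) :=
      Finset.sum_le_sum fun i _ => hint i
    rw [Finset.sum_neg_distrib] at h1
    rw [Finset.sum_const, nsmul_eq_mul] at h2
    linarith
  · have e : ‖0 - (-a ^ 2)‖ = a ^ 2 := by
      rw [Real.norm_eq_abs, zero_sub, neg_neg, abs_of_nonneg (sq_nonneg _)]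
    push_cast
    rw [e, Finset.sum_const, nsmul_eq_mul]
    field_simp
    norm_num

lemma measureReal_selfNorm_ge_le [IsProbabilityMeasure Q] (hν : IsStandardized ν)
    (h : IsIIDSample Q ν Z) {B : Finset ι} (hB : B.Nonempty) :
    Q.real {ω | 1 / 10 ≤ selfNorm (secondMoment (fun i => Z i ω) B)
      (sampleMean (fun i => Z i ω) B) ^ 2} ≤ 2 * Real.exp (-(1 / 120 * B.card)) := by
  have hc : (0 : ℝ) < B.card := by exact_mod_cast hB.card_pos
  have hm := measurable_blockStat h.meas B measurable_selfNorm
  have key := mul_meas_ge_le_lintegral (μ := Q) (f := fun ω => ENNReal.ofReal (Real.exp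
    ((B.card : ℝ) * selfNorm (secondMoment (fun i => Z i ω) B)
      (sampleMean (fun i => Z i ω) B) ^ 2 / 12))) (by fun_prop)
      (ENNReal.ofReal (Real.exp (1 / 120 * B.card)))
  have key2 := key.trans (lintegral_exp_selfNorm_le hν h hB)
  have hsub : {ω | 1 / 10 ≤ selfNorm (secondMoment (fun i => Z i ω) B)
      (sampleMean (fun i => Z i ω) B) ^ 2} ⊆ {ω | ENNReal.ofReal (Real.exp (1 / 120 * B.card)) ≤
      ENNReal.ofReal (Real.exp ((B.card : ℝ) * selfNorm (secondMoment (fun i => Z i ω) B)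
      (sampleMean (fun i => Z i ω) B) ^ 2 / 12))} := by
    intro ω hω
    simp only [Set.mem_ofPred_eq] at hω ⊢
    refine ENNReal.ofReal_le_ofReal (Real.exp_le_exp.2 ?_)
    nlinarith
  refine (measureReal_mono hsub).trans ?_
  have key3 := ENNReal.toReal_mono (by simp) key2
  rw [ENNReal.toReal_mul, ENNReal.toReal_ofReal (Real.exp_pos _).le] at key3
  simp only [ENNReal.toReal_ofNat] at key3
  rw [Real.exp_neg, ← div_eq_mul_inv, le_div_iff₀ (Real.exp_pos _), mul_comm]
  exact key3

/-- The condition 1/4 ≤ v says that v ≥ (v + 1)/5, and the mean uses up at most half of this. -/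
lemma wellSpread_of_le {v m : ℝ} (hv : 1 / 4 ≤ v) (h : selfNorm v m ^ 2 < 1 / 10) :
    WellSpread v m := by
  rw [selfNorm, div_pow, sq_abs, Real.sq_sqrt (by linarith), div_lt_iff₀ (by linarith)] at h
  unfold WellSpread
  linarith

lemma measureReal_not_wellSpread_le [IsProbabilityMeasure Q] (hν : IsStandardized ν)
    (h : IsIIDSample Q ν Z) {B : Finset ι} (hB : B.Nonempty) {a : ℝ} (ha : 0 < a)
    (hνa : 1 / 2 ≤ ∫ x in {x : ℝ | |x| ≤ a}, x ^ 2 ∂ν) :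
    Q.real {ω | ¬ WellSpread (secondMoment (fun i => Z i ω) B) (sampleMean (fun i => Z i ω) B)} ≤
      3 * Real.exp (-(min (1 / 120) (1 / (8 * a ^ 4)) * B.card)) := by
  have hsub : {ω | ¬ WellSpread (secondMoment (fun i => Z i ω) B)
      (sampleMean (fun i => Z i ω) B)} ⊆ {ω | secondMoment (fun i => Z i ω) B < 1 / 4} ∪
      {ω | 1 / 10 ≤ selfNorm (secondMoment (fun i => Z i ω) B)
        (sampleMean (fun i => Z i ω) B) ^ 2} := by
    intro ω hω
    by_contra hcon
    simp only [Set.mem_union, Set.mem_ofPred_eq, not_or, not_lt, not_le] at hcon hω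
    exact hω (wellSpread_of_le hcon.1 hcon.2)
  refine (measureReal_mono hsub).trans ((measureReal_union_le _ _).trans ?_)
  have h1 := measureReal_secondMoment_lt_le hν h hB ha hνa
  have h2 := measureReal_selfNorm_ge_le hν h hB
  have e1 : Real.exp (-(1 / (8 * a ^ 4) * B.card)) ≤
      Real.exp (-(min (1 / 120) (1 / (8 * a ^ 4)) * B.card)) := by
    gcongr; exact min_le_right _ _
  have e2 : Real.exp (-(1 / 120 * B.card)) ≤
      Real.exp (-(min (1 / 120) (1 / (8 * a ^ 4)) * B.card)) := by
    gcongr; exact min_le_left _ _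
  linarith

end Spread

end RobustMean

namespace RobustMean

/-! ### The bias of a studentized block mean -/

/-- The empirical variance `v - m ^ 2`, bounded below by `(v + 1) / 10`. -/
noncomputable def truncVar (v m : ℝ) : ℝ := max (v - m ^ 2) ((v + 1) / 10)

/-- The block mean divided by the `p`-th power of the truncated standard deviation. -/
noncomputable def studentized (p v m : ℝ) : ℝ := m * truncVar v m ^ (-p / 2)

lemma truncVar_of_wellSpread {v m : ℝ} (h : WellSpread v m) : truncVar v m = v - m ^ 2 :=
  max_eq_left h

lemma measurable_truncVar : Measurable fun q : ℝ × ℝ => truncVar q.1 q.2 := by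
  unfold truncVar; fun_prop

lemma measurable_studentized (p : ℝ) : Measurable fun q : ℝ × ℝ => studentized p q.1 q.2 :=
  measurable_snd.mul (measurable_truncVar.pow_const _)

lemma tenth_le_truncVar {v : ℝ} (hv : 0 ≤ v) (m : ℝ) : 1 / 10 ≤ truncVar v m :=
  le_trans (by linarith) (le_max_right _ _)

lemma rpow_neg_half_le {p u w : ℝ} (hp : 0 ≤ p) (hw : 0 < w) (h : w ≤ u) :
    u ^ (-p / 2) ≤ w ^ (-p / 2) :=
  Real.rpow_le_rpow_of_nonpos hw h (by linarith)

lemma tenth_rpow (p : ℝ) : (1 / 10 : ℝ) ^ (-p / 2) = 10 ^ (p / 2) := by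
  rw [one_div, Real.inv_rpow (by norm_num), ← Real.rpow_neg (by norm_num)]
  congr 1; ring

/-- This is the purpose of the truncation: the variance factor is at most a constant times (v +
1)^(-p/2), and p ≥ 1 together with v + 1 ≥ 1 allows the exponent -p/2 to be replaced by -1/2. -/
lemma abs_studentized_le {p : ℝ} (hp : 1 ≤ p) {v : ℝ} (hv : 0 ≤ v) (m : ℝ) :
    |studentized p v m| ≤ 10 ^ (p / 2) * selfNorm v m := by
  have hu : 0 < truncVar v m := lt_of_lt_of_le (by norm_num) (tenth_le_truncVar hv m)
  rw [studentized, abs_mul, abs_of_pos (Real.rpow_pos_of_pos hu _), selfNorm]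
  have h1 : truncVar v m ^ (-p / 2) ≤ ((v + 1) / 10) ^ (-p / 2) :=
    rpow_neg_half_le (by linarith) (by linarith) (le_max_right _ _)
  have h2 : ((v + 1) / 10) ^ (-p / 2) = 10 ^ (p / 2) * (v + 1) ^ (-p / 2) := by
    rw [← tenth_rpow, ← Real.mul_rpow (by norm_num) (by linarith)]
    congr 1; ring
  have h3 : (v + 1) ^ (-p / 2) ≤ (√(v + 1))⁻¹ := by
    rw [Real.sqrt_eq_rpow, ← Real.rpow_neg (by linarith)]
    exact Real.rpow_le_rpow_of_exponent_le (by linarith) (by linarith)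
  calc |m| * truncVar v m ^ (-p / 2) ≤ |m| * (10 ^ (p / 2) * (√(v + 1))⁻¹) := by
        gcongr
        rw [h2] at h1
        exact h1.trans (by gcongr)
    _ = _ := by rw [div_eq_mul_inv]; ring

/-- Bernoulli's inequality for the quotient t = u/w ≤ 1. The exponent p/2 may be less than 1, so
t^(p/2) is first bounded below by t^p. -/
lemma rpow_neg_half_sub_le {p : ℝ} (hp : 1 ≤ p) {u w : ℝ} (hu : 1 / 10 ≤ u) (huw : u ≤ w) :
    u ^ (-p / 2) - w ^ (-p / 2) ≤ 10 * p * 10 ^ (p / 2) * (w - u) := by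
  have hu0 : 0 < u := by linarith
  have hw0 : 0 < w := by linarith
  set t := u / w with ht
  have ht0 : 0 < t := by positivity
  have ht1 : t ≤ 1 := (div_le_one hw0).2 huw
  have h1 : 1 - p * (1 - t) ≤ t ^ (p / 2) := by
    have h2 : t ^ p ≤ t ^ (p / 2) :=
      Real.rpow_le_rpow_of_exponent_ge ht0 ht1 (by linarith)
    have h3 := one_add_mul_self_le_rpow_one_add (s := t - 1) (by linarith) hp
    rw [add_sub_cancel] at h3
    linarith
  have h4 : w ^ (-p / 2) = u ^ (-p / 2) * t ^ (p / 2) := by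
    have e : -p / 2 = -(p / 2) := by ring
    rw [ht, Real.div_rpow hu0.le hw0.le, e, Real.rpow_neg hw0.le, Real.rpow_neg hu0.le]
    have := (Real.rpow_pos_of_pos hu0 (p / 2)).ne'
    field_simp
  have h5 : u ^ (-p / 2) ≤ 10 ^ (p / 2) := by
    rw [← tenth_rpow]; exact rpow_neg_half_le (by linarith) (by norm_num) hu
  have h6 : 1 - t ≤ 10 * (w - u) := by
    rw [ht, one_sub_div hw0.ne', div_le_iff₀ hw0]
    nlinarith
  have h7 : 0 < u ^ (-p / 2) := Real.rpow_pos_of_pos hu0 _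
  calc u ^ (-p / 2) - w ^ (-p / 2) = u ^ (-p / 2) * (1 - t ^ (p / 2)) := by rw [h4]; ring
    _ ≤ 10 ^ (p / 2) * (p * (10 * (w - u))) := by
        refine (mul_le_mul_of_nonneg_left (by linarith : _ ≤ p * (1 - t)) h7.le).trans ?_
        have : 0 ≤ 1 - t := by linarith
        gcongr
    _ = _ := by ring

lemma abs_rpow_neg_half_sub_le {p : ℝ} (hp : 1 ≤ p) {u w : ℝ} (hu : 1 / 10 ≤ u)
    (hw : 1 / 10 ≤ w) :
    |u ^ (-p / 2) - w ^ (-p / 2)| ≤ 10 * p * 10 ^ (p / 2) * min 1 |u - w| := by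
  have h10 : (0 : ℝ) < 10 ^ (p / 2) := by positivity
  rw [mul_min_of_nonneg _ _ (by positivity)]
  refine le_min ?_ ?_
  · have a1 : ∀ {x : ℝ}, 1 / 10 ≤ x → 0 < x ^ (-p / 2) ∧ x ^ (-p / 2) ≤ 10 ^ (p / 2) :=
      fun {x} hx => ⟨Real.rpow_pos_of_pos (by linarith) _, by
        rw [← tenth_rpow]; exact rpow_neg_half_le (by linarith) (by norm_num) hx⟩
    obtain ⟨b1, b2⟩ := a1 hu
    obtain ⟨c1, c2⟩ := a1 hw
    rw [abs_le]
    constructor <;> nlinarith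
  · rcases le_total u w with h | h
    · have h1 := rpow_neg_half_sub_le hp hu h
      have h2 := rpow_neg_half_le (p := p) (by linarith) (by linarith : 0 < u) h
      rwa [abs_of_nonneg (by linarith), abs_sub_comm, abs_of_nonneg (by linarith : 0 ≤ w - u)]
    · have h1 := rpow_neg_half_sub_le hp hw h
      have h2 := rpow_neg_half_le (p := p) (by linarith) (by linarith : 0 < w) h
      rwa [abs_sub_comm, abs_of_nonneg (by linarith), abs_of_nonneg (by linarith : 0 ≤ u - w)]

/-- Sensitivity of the weight of a block to one observation `z`. -/
lemma abs_truncVar_rpow_sub_le {p : ℝ} (hp : 1 ≤ p) {n v : ℝ} (hn : 1 ≤ n) (hv : 0 ≤ v)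
    (m z : ℝ) :
    |truncVar (v + z ^ 2 / n) (m + z / n) ^ (-p / 2) - truncVar v m ^ (-p / 2)| ≤
      20 * p * 10 ^ (p / 2) * (min 1 (z ^ 2 / n) + |z| * |m| / n) := by
  have hzn : 0 ≤ z ^ 2 / n := by positivity
  have hzm : 0 ≤ |z| * |m| / n := by positivity
  have h1 := abs_rpow_neg_half_sub_le hp
    (tenth_le_truncVar (by linarith : 0 ≤ v + z ^ 2 / n) (m + z / n)) (tenth_le_truncVar hv m)
  have h2 : |truncVar (v + z ^ 2 / n) (m + z / n) - truncVar v m| ≤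
      2 * (z ^ 2 / n + |z| * |m| / n) := by
    refine (abs_max_sub_max_le_max _ _ _ _).trans (max_le ?_ ?_)
    · have e : v + z ^ 2 / n - (m + z / n) ^ 2 - (v - m ^ 2) =
          z ^ 2 / n - z ^ 2 / n * (1 / n) - 2 * (z * m / n) := by field_simp; ring
      have h3 : |z * m / n| = |z| * |m| / n := by
        rw [abs_div, abs_mul, abs_of_pos (by linarith : 0 < n)]
      have h4 : 1 / n ≤ 1 := (div_le_one (by linarith)).2 hn
      have h5 : 0 ≤ 1 / n := by positivity
      have h6 := abs_le.1 h3.le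
      rw [e, abs_le]
      constructor <;> nlinarith
    · have e : (v + z ^ 2 / n + 1) / 10 - (v + 1) / 10 = z ^ 2 / n / 10 := by ring
      rw [e, abs_of_nonneg (by positivity)]
      linarith
  refine h1.trans ?_
  have h10 : (0 : ℝ) < 10 ^ (p / 2) := by positivity
  have h3 : min 1 |truncVar (v + z ^ 2 / n) (m + z / n) - truncVar v m| ≤
      2 * (min 1 (z ^ 2 / n) + |z| * |m| / n) := by
    rcases le_total 1 (z ^ 2 / n) with h | h
    · rw [min_eq_left h]
      exact (min_le_left _ _).trans (by linarith)
    · rw [min_eq_right h]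
      exact (min_le_right _ _).trans h2
  calc _ ≤ 10 * p * 10 ^ (p / 2) * (2 * (min 1 (z ^ 2 / n) + |z| * |m| / n)) := by gcongr
    _ = _ := by ring

section Bias

variable {Ω ι : Type*} [MeasurableSpace Ω] {Q : Measure Ω} {ν : Measure ℝ} {Z : ι → Ω → ℝ}

/-- The bias functional `E |X| min(1, X² / n)` of the law `ν` of `X`. -/
noncomputable def biasBound (ν : Measure ℝ) (n : ℝ) : ℝ := ∫ x, |x| * min 1 (x ^ 2 / n) ∂ν

lemma biasBound_nonneg (ν : Measure ℝ) {n : ℝ} (hn : 0 ≤ n) : 0 ≤ biasBound ν n :=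
  integral_nonneg fun x => mul_nonneg (abs_nonneg _) (le_min zero_le_one (by positivity))

lemma IsStandardized.integral_abs_le (hν : IsStandardized ν) : ∫ x, |x| ∂ν ≤ 1 := by
  have := hν.prob
  have hi : Integrable (fun x : ℝ => (1 + x ^ 2) / 2) ν :=
    ((integrable_const _).add hν.integrable_sq).div_const 2
  refine (integral_mono hν.integrable_id.abs hi fun x => ?_).trans ?_
  · nlinarith [sq_nonneg (|x| - 1), sq_abs x]
  · rw [integral_div, integral_add (integrable_const _) hν.integrable_sq, hν.var_one]
    simp

lemma indepFun_eval_leaveOneOut [DecidableEq ι] (hZ : ∀ i, Measurable (Z i)) (h : iIndepFun Z Q)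
    (B : Finset ι) (i : ι) (c : ℝ) :
    IndepFun (Z i) (fun ω => ((∑ l ∈ B.erase i, Z l ω ^ 2) / c, (∑ l ∈ B.erase i, Z l ω) / c))
      Q := by
  have hφ : Measurable fun z : ({i} : Finset ι) → ℝ => z ⟨i, by simp⟩ := measurable_pi_apply _
  have hψ : Measurable fun z : { l // l ∈ B.erase i } → ℝ =>
      ((∑ l, z l ^ 2) / c, (∑ l, z l) / c) := by fun_prop
  have h1 := (h.indepFun_finset {i} (B.erase i) (by simp) hZ).comp hφ hψ
  convert h1 using 1
  · rfl
  funext ω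
  simp only [Function.comp_apply]
  rw [Finset.sum_coe_sort (B.erase i) fun l => Z l ω ^ 2,
    Finset.sum_coe_sort (B.erase i) fun l => Z l ω]

/-- One summand of the bias. -/
lemma abs_integral_mul_truncVar_le [IsProbabilityMeasure Q] (hν : IsStandardized ν)
    (h : IsIIDSample Q ν Z) {B : Finset ι} {i : ι} (hi : i ∈ B) {p : ℝ} (hp : 1 ≤ p) :
    Integrable (fun ω => Z i ω * truncVar (secondMoment (fun i => Z i ω) B)
      (sampleMean (fun i => Z i ω) B) ^ (-p / 2)) Q ∧
    |∫ ω, Z i ω * truncVar (secondMoment (fun i => Z i ω) B)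
      (sampleMean (fun i => Z i ω) B) ^ (-p / 2) ∂Q| ≤
      20 * p * 10 ^ (p / 2) * (biasBound ν B.card + 1 / B.card) := by
  classical
  have := hν.prob
  have hm : ∀ i, Measurable (Z i) := h.meas
  have hn : (1 : ℝ) ≤ B.card := by exact_mod_cast Finset.card_pos.2 ⟨i, hi⟩
  set n : ℝ := (B.card : ℝ) with hndef
  have hn0 : 0 < n := by linarith
  -- The leave-one-out sums are still divided by the full block size, so that putting `Z i` back is
  -- purely additive.
  set v : Ω → ℝ := fun ω => (∑ l ∈ B.erase i, Z l ω ^ 2) / n with hv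
  set m : Ω → ℝ := fun ω => (∑ l ∈ B.erase i, Z l ω) / n with hmm
  have hv0 : ∀ ω, 0 ≤ v ω := fun ω =>
    div_nonneg (Finset.sum_nonneg fun _ _ => sq_nonneg _) hn0.le
  have hvm : Measurable v := by fun_prop
  have hmmeas : Measurable m := by fun_prop
  have hV : ∀ ω, secondMoment (fun i => Z i ω) B = v ω + Z i ω ^ 2 / n := fun ω => by
    rw [secondMoment, hv, ← add_div, Finset.sum_erase_add _ _ hi]
  have hM : ∀ ω, sampleMean (fun i => Z i ω) B = m ω + Z i ω / n := fun ω => by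
    rw [sampleMean, hmm, ← add_div, Finset.sum_erase_add _ _ hi]
  simp_rw [hV, hM]
  set L := 20 * p * (10 : ℝ) ^ (p / 2) with hL
  have hL0 : 0 < L := by positivity
  have hbd : ∀ v' m', 0 ≤ v' → |truncVar v' m' ^ (-p / 2)| ≤ 10 ^ (p / 2) := fun v' m' hv' => by
    rw [abs_of_pos (Real.rpow_pos_of_pos (by linarith [tenth_le_truncVar hv' m']) _), ← tenth_rpow]
    exact rpow_neg_half_le (by linarith) (by norm_num) (tenth_le_truncVar hv' m')
  have hZi : Integrable (Z i) Q := h.integrable_comp i (f := fun x => x) hν.integrable_id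
  have hZ2 : Integrable (fun ω => Z i ω ^ 2) Q :=
    h.integrable_comp i (f := fun x => x ^ 2) hν.integrable_sq
  have hT1m : Measurable fun ω => truncVar (v ω + Z i ω ^ 2 / n) (m ω + Z i ω / n) ^ (-p / 2) :=
    (measurable_truncVar.comp (Measurable.prodMk (by fun_prop : Measurable fun ω =>
      v ω + Z i ω ^ 2 / n) (by fun_prop : Measurable fun ω => m ω + Z i ω / n))).pow_const _
  have hT2m : Measurable fun ω => truncVar (v ω) (m ω) ^ (-p / 2) :=
    (measurable_truncVar.comp (Measurable.prodMk hvm hmmeas)).pow_const _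
  have hI1 : Integrable (fun ω => Z i ω *
      truncVar (v ω + Z i ω ^ 2 / n) (m ω + Z i ω / n) ^ (-p / 2)) Q :=
    hZi.mul_bdd (c := 10 ^ (p / 2)) hT1m.aestronglyMeasurable
      (Eventually.of_forall fun ω => hbd _ _ (by have := hv0 ω; positivity))
  have hI2 : Integrable (fun ω => Z i ω * truncVar (v ω) (m ω) ^ (-p / 2)) Q :=
    hZi.mul_bdd (c := 10 ^ (p / 2)) hT2m.aestronglyMeasurable
      (Eventually.of_forall fun ω => hbd _ _ (hv0 ω))
  refine ⟨hI1, ?_⟩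
  have hind := indepFun_eval_leaveOneOut hm h.iIndep B i n
  -- The leave-one-out weight is independent of the centred `Z i`; subtracting this term costs
  -- nothing and leaves only the sensitivity of the weight to `Z i`.
  have hzero : ∫ ω, Z i ω * truncVar (v ω) (m ω) ^ (-p / 2) ∂Q = 0 := by
    have h1 : IndepFun (Z i) (fun ω => truncVar (v ω) (m ω) ^ (-p / 2)) Q :=
      hind.comp (φ := fun x => x) (ψ := fun q : ℝ × ℝ => truncVar q.1 q.2 ^ (-p / 2))
        measurable_id (measurable_truncVar.pow_const _)
    rw [h1.integral_fun_mul_eq_mul_integral (hm i).aestronglyMeasurable hT2m.aestronglyMeasurable,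
      h.integral_comp i (f := fun x => x) measurable_id, hν.mean_zero, zero_mul]
  -- The cross term of the sensitivity bound also factorizes, with both factors at most 1; it
  -- accounts for the summand `1 / B.card`.
  have hcross : Integrable (fun ω => Z i ω ^ 2 * |m ω|) Q ∧ ∫ ω, Z i ω ^ 2 * |m ω| ∂Q ≤ 1 := by
    have h1 : IndepFun (fun ω => Z i ω ^ 2) (fun ω => |m ω|) Q :=
      hind.comp (φ := fun x => x ^ 2) (ψ := fun q : ℝ × ℝ => |q.2|) (by fun_prop) (by fun_prop)
    have hZl : ∀ l, Integrable (fun ω => |Z l ω|) Q := fun l =>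
      h.integrable_comp l (f := fun x => |x|) hν.integrable_id.abs
    have hbnd : Integrable (fun ω => (∑ l ∈ B.erase i, |Z l ω|) / n) Q :=
      (integrable_finsetSum _ fun l _ => hZl l).div_const _
    have hle : ∀ ω, |m ω| ≤ (∑ l ∈ B.erase i, |Z l ω|) / n := fun ω => by
      rw [hmm, abs_div, abs_of_pos hn0]
      gcongr
      exact Finset.abs_sum_le_sum_abs _ _
    have hmi : Integrable (fun ω => |m ω|) Q :=
      hbnd.mono' (by fun_prop) (Eventually.of_forall fun ω => by simpa using hle ω)
    refine ⟨h1.integrable_mul hZ2 hmi, ?_⟩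
    rw [h1.integral_fun_mul_eq_mul_integral hZ2.aestronglyMeasurable hmi.aestronglyMeasurable,
      h.integral_comp i (f := fun x => x ^ 2) (by fun_prop), hν.var_one, one_mul]
    refine (integral_mono hmi hbnd hle).trans ?_
    rw [integral_div, integral_finsetSum _ fun l _ => hZl l, div_le_one hn0]
    calc ∑ l ∈ B.erase i, ∫ ω, |Z l ω| ∂Q ≤ ∑ l ∈ B.erase i, (1 : ℝ) :=
          Finset.sum_le_sum fun l _ => by
            rw [h.integral_comp l (f := fun x => |x|) (by fun_prop)]
            exact hν.integral_abs_le
      _ ≤ n := by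
          rw [Finset.sum_const, nsmul_eq_mul, mul_one, hndef]
          exact_mod_cast Finset.card_le_card (Finset.erase_subset _ _)
  have hminν : Integrable (fun x : ℝ => |x| * min 1 (x ^ 2 / n)) ν :=
    hν.integrable_id.abs.mul_bdd (c := 1) (by fun_prop) (Eventually.of_forall fun x => by
      rw [Real.norm_eq_abs, abs_of_nonneg (le_min zero_le_one (by positivity))]
      exact min_le_left _ _)
  have hmin : Integrable (fun ω => |Z i ω| * min 1 (Z i ω ^ 2 / n)) Q :=
    h.integrable_comp i (f := fun x => |x| * min 1 (x ^ 2 / n)) hminν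
  have hmaj : Integrable (fun ω => L * (|Z i ω| * min 1 (Z i ω ^ 2 / n) +
      Z i ω ^ 2 * |m ω| / n)) Q := (hmin.add (hcross.1.div_const n)).const_mul L
  calc |∫ ω, Z i ω * truncVar (v ω + Z i ω ^ 2 / n) (m ω + Z i ω / n) ^ (-p / 2) ∂Q|
      = |∫ ω, (Z i ω * truncVar (v ω + Z i ω ^ 2 / n) (m ω + Z i ω / n) ^ (-p / 2) -
          Z i ω * truncVar (v ω) (m ω) ^ (-p / 2)) ∂Q| := by
        rw [integral_sub hI1 hI2, hzero, sub_zero]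
    _ ≤ ∫ ω, L * (|Z i ω| * min 1 (Z i ω ^ 2 / n) + Z i ω ^ 2 * |m ω| / n) ∂Q := by
        rw [← Real.norm_eq_abs]
        refine norm_integral_le_of_norm_le hmaj (Eventually.of_forall fun ω => ?_)
        rw [Real.norm_eq_abs, ← mul_sub, abs_mul]
        have h1 := abs_truncVar_rpow_sub_le hp hn (hv0 ω) (m ω) (Z i ω)
        calc _ ≤ |Z i ω| * (L * (min 1 (Z i ω ^ 2 / n) + |Z i ω| * |m ω| / n)) := by gcongr
          _ = _ := by rw [← sq_abs (Z i ω)]; ring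
    _ = L * (biasBound ν n + (∫ ω, Z i ω ^ 2 * |m ω| ∂Q) / n) := by
        rw [integral_const_mul, integral_add hmin (hcross.1.div_const n), integral_div,
          h.integral_comp i (f := fun x => |x| * min 1 (x ^ 2 / n)) (by fun_prop), biasBound]
    _ ≤ L * (biasBound ν n + 1 / n) := by
        gcongr
        exact hcross.2

lemma abs_integral_studentized_le [IsProbabilityMeasure Q] (hν : IsStandardized ν)
    (h : IsIIDSample Q ν Z) {B : Finset ι} (hB : B.Nonempty) {p : ℝ} (hp : 1 ≤ p) :
    |∫ ω, studentized p (secondMoment (fun i => Z i ω) B) (sampleMean (fun i => Z i ω) B) ∂Q| ≤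
      20 * p * 10 ^ (p / 2) * (biasBound ν B.card + 1 / B.card) := by
  have hc : (0 : ℝ) < B.card := by exact_mod_cast hB.card_pos
  have e : ∀ ω, studentized p (secondMoment (fun i => Z i ω) B) (sampleMean (fun i => Z i ω) B) =
      (∑ i ∈ B, Z i ω * truncVar (secondMoment (fun i => Z i ω) B)
        (sampleMean (fun i => Z i ω) B) ^ (-p / 2)) / B.card := fun ω => by
    rw [studentized, ← Finset.sum_mul]
    nth_rewrite 1 [sampleMean]
    ring
  simp_rw [e]
  rw [integral_div, integral_finsetSum _ fun i hi =>
    (abs_integral_mul_truncVar_le hν h hi hp).1, abs_div, abs_of_pos hc, div_le_iff₀ hc]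
  calc _ ≤ ∑ i ∈ B, |∫ ω, Z i ω * truncVar (secondMoment (fun i => Z i ω) B)
        (sampleMean (fun i => Z i ω) B) ^ (-p / 2) ∂Q| := Finset.abs_sum_le_sum_abs _ _
    _ ≤ ∑ i ∈ B, 20 * p * 10 ^ (p / 2) * (biasBound ν B.card + 1 / B.card) :=
        Finset.sum_le_sum fun i hi => (abs_integral_mul_truncVar_le hν h hi hp).2
    _ = _ := by rw [Finset.sum_const, nsmul_eq_mul]; ring

/-! ### Decay of the bias functional -/

/-- Here min(1, y) ≤ y^(δ/2) because δ/2 lies in [0, 1]. The bound is uniform in n and so serves as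
a majorant. -/
lemma rpow_mul_biasIntegrand_le {δ : ℝ} (h0 : 0 ≤ δ) (h2 : δ ≤ 2) {n : ℝ} (hn : 0 < n) (x : ℝ) :
    n ^ (δ / 2) * (|x| * min 1 (x ^ 2 / n)) ≤ |x| ^ (1 + δ) := by
  rcases eq_or_ne x 0 with rfl | hx
  · simp; positivity
  have hx0 : 0 < |x| := abs_pos.2 hx
  have h1 : min 1 (x ^ 2 / n) ≤ (x ^ 2 / n) ^ (δ / 2) := by
    have hpos : 0 < x ^ 2 / n := by positivity
    rcases le_total 1 (x ^ 2 / n) with h | h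
    · rw [min_eq_left h]; exact Real.one_le_rpow h (by linarith)
    · rw [min_eq_right h]
      calc x ^ 2 / n = (x ^ 2 / n) ^ (1 : ℝ) := (Real.rpow_one _).symm
        _ ≤ _ := Real.rpow_le_rpow_of_exponent_ge hpos h (by linarith)
  calc n ^ (δ / 2) * (|x| * min 1 (x ^ 2 / n))
      ≤ n ^ (δ / 2) * (|x| * (x ^ 2 / n) ^ (δ / 2)) := by gcongr
    _ = |x| * (x ^ 2) ^ (δ / 2) := by
        rw [Real.div_rpow (sq_nonneg _) hn.le]
        have : n ^ (δ / 2) ≠ 0 := by positivity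
        field_simp
    _ = |x| ^ (1 + δ) := by
        rw [← sq_abs x, ← Real.rpow_natCast, ← Real.rpow_mul (abs_nonneg _), Real.rpow_add hx0,
          Real.rpow_one]
        congr 2
        push_cast; ring

/-- Dominated convergence: the rescaled integrand is at most |x|^(1+δ), and pointwise at most |x|³
n^(δ/2 - 1), which tends to zero because δ < 2. -/
lemma biasBound_isLittleO {δ : ℝ} (h0 : 0 ≤ δ) (h2 : δ < 2)
    (hint : Integrable (fun x => |x| ^ (1 + δ)) ν) :
    (fun n : ℕ => biasBound ν n) =o[atTop] fun n : ℕ => (n : ℝ) ^ (-δ / 2) := by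
  rw [isLittleO_iff_tendsto' ((eventually_gt_atTop 0).mono fun n hn h => by
    have : (0 : ℝ) < (n : ℝ) ^ (-δ / 2) := by positivity
    exact absurd h this.ne')]
  have e : ∀ n : ℕ, biasBound ν n / (n : ℝ) ^ (-δ / 2) =
      ∫ x, (n : ℝ) ^ (δ / 2) * (|x| * min 1 (x ^ 2 / n)) ∂ν := fun n => by
    have e1 : -δ / 2 = -(δ / 2) := by ring
    rw [integral_const_mul, biasBound, e1, Real.rpow_neg (Nat.cast_nonneg _), div_inv_eq_mul,
      mul_comm]
  simp_rw [e]
  rw [← integral_zero ℝ ℝ (μ := ν)]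
  refine tendsto_integral_filter_of_dominated_convergence (fun x => |x| ^ (1 + δ))
    (Eventually.of_forall fun n => by fun_prop) ?_ hint (Eventually.of_forall fun x => ?_)
  · filter_upwards [eventually_gt_atTop 0] with n hn
    filter_upwards with x
    have hn' : (0 : ℝ) < n := by exact_mod_cast hn
    rw [Real.norm_eq_abs, abs_of_nonneg (by positivity)]
    exact rpow_mul_biasIntegrand_le h0 h2.le hn' x
  · have hlim : Tendsto (fun n : ℕ => |x| ^ 3 * (n : ℝ) ^ (-(1 - δ / 2))) atTop (nhds 0) := by
      rw [← mul_zero (|x| ^ 3)]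
      exact ((tendsto_rpow_neg_atTop (by linarith)).comp tendsto_natCast_atTop_atTop).const_mul _
    refine squeeze_zero' (Eventually.of_forall fun n => by positivity) ?_ hlim
    filter_upwards [eventually_gt_atTop 0] with n hn
    have hn' : (0 : ℝ) < n := by exact_mod_cast hn
    calc (n : ℝ) ^ (δ / 2) * (|x| * min 1 (x ^ 2 / n))
        ≤ (n : ℝ) ^ (δ / 2) * (|x| * (x ^ 2 / n)) := by gcongr; exact min_le_right _ _
      _ = |x| ^ 3 * ((n : ℝ) ^ (δ / 2) / (n : ℝ) ^ (1 : ℝ)) := by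
          rw [Real.rpow_one, ← sq_abs x]; ring
      _ = _ := by rw [← Real.rpow_sub hn']; congr 2; ring

lemma biasBound_isBigO (hint : Integrable (fun x => |x| ^ (1 + (2 : ℝ))) ν) :
    (fun n : ℕ => biasBound ν n) =O[atTop] fun n : ℕ => (n : ℝ)⁻¹ := by
  refine IsBigO.of_bound (∫ x, |x| ^ (1 + (2 : ℝ)) ∂ν) ?_
  filter_upwards [eventually_gt_atTop 0] with n hn
  have hn' : (0 : ℝ) < n := by exact_mod_cast hn
  rw [Real.norm_eq_abs, abs_of_nonneg (biasBound_nonneg ν hn'.le), norm_inv, Real.norm_eq_abs,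
    abs_of_pos hn', ← div_eq_mul_inv, le_div_iff₀ hn', mul_comm, biasBound, ← integral_const_mul]
  refine integral_mono_of_nonneg (Eventually.of_forall fun x => by positivity) hint
    (Eventually.of_forall fun x => ?_)
  simpa using rpow_mul_biasIntegrand_le (by norm_num) le_rfl hn' x

end Bias

end RobustMean

namespace RobustMean

/-! ### Uniformly random equipartitions -/

section Equipartition

variable {ι : Type*} [Fintype ι] {k n : ℕ}

lemma card_block_comp_perm (g : ι → Fin k) (σ : Equiv.Perm ι) (l : Fin k) :
    (block (g ∘ σ) l).card = (block g l).card :=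
  Finset.card_bijective σ σ.bijective (by simp [block])

variable [DecidableEq ι]

/-- The finite set of equipartitions that put all indices in `S` into block `j`. -/
def equipartitionsThrough (k n : ℕ) (j : Fin k) (S : Finset ι) : Finset (ι → Fin k) :=
  Finset.univ.filter fun g => (∀ l, (block g l).card = n) ∧ ∀ i ∈ S, g i = j

/-- Relabelling by the transposition of i and i' preserves block sizes and fixes `S`; by symmetry
the two cardinalities agree. -/
lemma card_equipartitionsThrough_insert_le (j : Fin k) {S : Finset ι} {i i' : ι} (hi : i ∉ S)
    (hi' : i' ∉ S) : (equipartitionsThrough k n j (insert i S)).card ≤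
      (equipartitionsThrough k n j (insert i' S)).card := by
  refine Finset.card_le_card_of_injOn (fun g => g ∘ Equiv.swap i i') ?_ ?_
  · intro g hg
    simp only [equipartitionsThrough, Finset.coe_filter, Finset.mem_univ, true_and,
      Set.mem_ofPred_eq, Finset.mem_insert, forall_eq_or_imp] at hg ⊢
    refine ⟨fun l => by rw [card_block_comp_perm]; exact hg.1 l, ?_, fun a ha => ?_⟩
    · simpa using hg.2.1
    · have h1 : a ≠ i := fun h => hi (h ▸ ha)
      have h2 : a ≠ i' := fun h => hi' (h ▸ ha)
      simpa [Equiv.swap_apply_of_ne_of_ne h1 h2] using hg.2.2 a ha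
  · intro g _ g' _ h
    exact (Equiv.swap i i').surjective.injective_comp_right h

/-- Double counting: a partition with `S` inside block `j` has exactly n - |S| further indices in
that block. The additive form avoids truncated subtraction. -/
lemma sum_card_equipartitionsThrough_insert (j : Fin k) (S : Finset ι) :
    ∑ i ∈ Sᶜ, (equipartitionsThrough k n j (insert i S)).card + S.card *
      (equipartitionsThrough k n j S).card = n * (equipartitionsThrough k n j S).card := by
  have h1 : ∀ i, equipartitionsThrough k n j (insert i S) =
      (equipartitionsThrough k n j S).filter fun g => g i = j := fun i => by
    ext g
    simp only [equipartitionsThrough, Finset.mem_filter, Finset.mem_univ, true_and,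
      Finset.mem_insert, forall_eq_or_imp]
    tauto
  simp_rw [h1, Finset.card_filter]
  rw [Finset.sum_comm, mul_comm S.card, mul_comm n, ← smul_eq_mul, ← smul_eq_mul,
    ← Finset.sum_const, ← Finset.sum_const, ← Finset.sum_add_distrib]
  refine Finset.sum_congr rfl fun g hg => ?_
  simp only [equipartitionsThrough, Finset.mem_filter, Finset.mem_univ, true_and] at hg
  rw [← Finset.card_filter, ← hg.1 j]
  have hS : S ⊆ block g j := fun i hi => by simpa [block] using hg.2 i hi
  rw [← Finset.card_sdiff_add_card_eq_card hS]
  congr 2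
  ext i
  simp [block, and_comm]

/-- All summands of the double count are equal, so the conditional probability that `i` joins `S` in
block `j` is (n - |S|)/(kn - |S|) ≤ 1/k. -/
lemma mul_card_equipartitionsThrough_insert_le (hcard : Fintype.card ι = k * n) (j : Fin k)
    {S : Finset ι} {i : ι} (hi : i ∉ S) :
    k * (equipartitionsThrough k n j (insert i S)).card ≤ (equipartitionsThrough k n j S).card := by
  have hsum := sum_card_equipartitionsThrough_insert (n := n) j S
  have hconst : ∑ i' ∈ Sᶜ, (equipartitionsThrough k n j (insert i' S)).card =
      Sᶜ.card * (equipartitionsThrough k n j (insert i S)).card := by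
    rw [Finset.sum_const_nat]
    intro i' hi'
    have hi'' : i' ∉ S := by simpa using hi'
    exact le_antisymm (card_equipartitionsThrough_insert_le j hi'' hi)
      (card_equipartitionsThrough_insert_le j hi hi'')
  rw [hconst] at hsum
  have hc : Sᶜ.card + S.card = k * n := by rw [Finset.card_compl_add_card, hcard]
  have hpos : 0 < Sᶜ.card := Finset.card_pos.2 ⟨i, by simpa using hi⟩
  have hk : 1 ≤ k := Nat.one_le_of_lt j.2
  refine Nat.le_of_mul_le_mul_left ?_ hpos
  set U := (equipartitionsThrough k n j (insert i S)).card
  set V := (equipartitionsThrough k n j S).card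
  have h1 : Sᶜ.card * (k * U) + S.card * V ≤ Sᶜ.card * V + S.card * V := by
    calc Sᶜ.card * (k * U) + S.card * V ≤ k * (Sᶜ.card * U + S.card * V) := by
          have := Nat.le_mul_of_pos_left (S.card * V) hk
          linarith
      _ = (k * n) * V := by rw [hsum]; ring
      _ = _ := by rw [← hc]; ring
  omega

lemma pow_mul_card_equipartitionsThrough_le (hcard : Fintype.card ι = k * n) (j : Fin k)
    (S : Finset ι) : k ^ S.card * (equipartitionsThrough k n j S).card ≤
      (equipartitionsThrough k n j (∅ : Finset ι)).card := by
  induction S using Finset.induction_on with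
  | empty => simp
  | insert i S hi ih =>
    rw [Finset.card_insert_of_notMem hi, pow_succ, mul_assoc]
    exact (Nat.mul_le_mul_left _ (mul_card_equipartitionsThrough_insert_le hcard j hi)).trans ih

/-- A set of at most `k` indices has at least `m` members in a common block with probability
at most `k / m!`. -/
lemma uniformOn_equipartitions_le (hcard : Fintype.card ι = k * n) {T : Finset ι}
    (hT : T.card ≤ k) (m : ℕ) :
    (uniformOn (equipartitions ι k n)).real {g | ∃ j, m ≤ (block g j ∩ T).card} ≤
      k / (m.factorial : ℝ) := by
  classical
  set E : Finset (ι → Fin k) := Finset.univ.filter fun g => ∀ l, (block g l).card = n with hE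
  set A : Finset (ι → Fin k) := Finset.univ.filter fun g => ∃ j, m ≤ (block g j ∩ T).card with hA
  have hEs : equipartitions ι k n = (E : Set (ι → Fin k)) := by ext; simp [equipartitions, hE]
  have hAs : {g : ι → Fin k | ∃ j, m ≤ (block g j ∩ T).card} = (A : Set (ι → Fin k)) := by
    ext; simp [hA]
  have hE0 : ∀ j, equipartitionsThrough k n j (∅ : Finset ι) = E := fun j => by
    simp [equipartitionsThrough, hE]
  rw [hEs, hAs, measureReal_def, uniformOn_apply_finset]
  simp only [ENNReal.toReal_div, ENNReal.toReal_natCast]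
  rcases Nat.eq_zero_or_pos k with rfl | hk
  · have : A = ∅ := by
      rw [hA, Finset.filter_eq_empty_iff]
      rintro g - ⟨j, -⟩
      exact j.elim0
    simp [this]
  have hk' : (0 : ℝ) < k := by exact_mod_cast hk
  -- Union bound over the block and over the m-subsets of `T` that it contains: at most k · (k^m /
  -- m!) · k^(-m).
  have hsub : E ∩ A ⊆ Finset.univ.biUnion fun j : Fin k =>
      (Finset.powersetCard m T).biUnion fun S => equipartitionsThrough k n j S := by
    intro g hg
    simp only [hE, hA, Finset.mem_inter, Finset.mem_filter, Finset.mem_univ, true_and] at hg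
    obtain ⟨hg1, j, hj⟩ := hg
    obtain ⟨S, hS, hSm⟩ := Finset.exists_subset_card_eq hj
    simp only [Finset.mem_biUnion, Finset.mem_univ, true_and, Finset.mem_powersetCard]
    refine ⟨j, S, ⟨hS.trans Finset.inter_subset_right, hSm⟩, ?_⟩
    simp only [equipartitionsThrough, Finset.mem_filter, Finset.mem_univ, true_and]
    refine ⟨hg1, fun i hi => ?_⟩
    have := Finset.mem_of_mem_inter_left (hS hi)
    simpa [block] using this
  have hone : ∀ j : Fin k, ∀ S ∈ Finset.powersetCard m T,
      ((equipartitionsThrough k n j S).card : ℝ) ≤ E.card / (k : ℝ) ^ m := by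
    intro j S hS
    rw [le_div_iff₀ (by positivity), mul_comm]
    have := pow_mul_card_equipartitionsThrough_le hcard j S
    rw [hE0, (Finset.mem_powersetCard.1 hS).2] at this
    exact_mod_cast this
  have hcount : ((E ∩ A).card : ℝ) ≤ k / (m.factorial : ℝ) * E.card := by
    calc ((E ∩ A).card : ℝ)
        ≤ ∑ j : Fin k, ∑ S ∈ Finset.powersetCard m T,
            ((equipartitionsThrough k n j S).card : ℝ) := by
          exact_mod_cast (Finset.card_le_card hsub).trans (Finset.card_biUnion_le.trans
            (Finset.sum_le_sum fun j _ => Finset.card_biUnion_le))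
      _ ≤ ∑ j : Fin k, ∑ S ∈ Finset.powersetCard m T, E.card / (k : ℝ) ^ m :=
          Finset.sum_le_sum fun j _ => Finset.sum_le_sum fun S hS => hone j S hS
      _ = k * ((T.card.choose m : ℝ) * (E.card / (k : ℝ) ^ m)) := by
          simp [Finset.card_powersetCard]
      _ ≤ k * (((k : ℝ) ^ m / m.factorial) * (E.card / (k : ℝ) ^ m)) := by
          gcongr
          refine (Nat.choose_le_pow_div (α := ℝ) m T.card).trans ?_
          gcongr
      _ = _ := by field_simp
  rcases Nat.eq_zero_or_pos E.card with h0 | h0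
  · rw [h0]; simp; positivity
  · have : (0 : ℝ) < E.card := by exact_mod_cast h0
    rwa [div_le_iff₀ this]

/-- Uses (m + 1)! ≥ 2^m and e^(1/2) ≤ 2; the leading factor 2 pays for rounding n/2 down. -/
lemma inv_factorial_half_le (n : ℕ) :
    1 / ((n / 2 + 1).factorial : ℝ) ≤ 2 * Real.exp (-(n / 4 : ℝ)) := by
  have hfac : ∀ m : ℕ, 2 ^ m ≤ (m + 1).factorial := fun m => by
    induction m with
    | zero => simp
    | succ m ih =>
      rw [Nat.factorial_succ, pow_succ, mul_comm]
      exact Nat.mul_le_mul (by omega) ih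
  have h1 : ((2 : ℝ) ^ (n / 2)) ≤ ((n / 2 + 1).factorial : ℝ) := by exact_mod_cast hfac (n / 2)
  have he : Real.exp (1 / 2) ≤ 2 := by
    have h2 : Real.exp (1 / 2) ^ 2 = Real.exp 1 := by
      rw [← Real.exp_nat_mul]; norm_num
    nlinarith [Real.exp_one_lt_d9, Real.exp_pos (1 / 2)]
  have h3 : Real.exp (n / 4 : ℝ) ≤ 2 * 2 ^ (n / 2) := by
    have hn : (n : ℝ) ≤ 2 * ((n / 2 : ℕ) : ℝ) + 1 := by
      have : n ≤ 2 * (n / 2) + 1 := by omega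
      exact_mod_cast this
    calc Real.exp (n / 4 : ℝ) ≤ Real.exp (1 / 2 + ((n / 2 : ℕ) : ℝ) * (1 / 2)) := by
          rw [Real.exp_le_exp]; linarith
      _ = Real.exp (1 / 2) * Real.exp (1 / 2) ^ (n / 2) := by
          rw [Real.exp_add, Real.exp_nat_mul]
      _ ≤ _ := by gcongr
  rw [Real.exp_neg, ← div_eq_mul_inv, div_le_div_iff₀ (by positivity) (Real.exp_pos _), one_mul]
  exact h3.trans (by gcongr)

end Equipartition

end RobustMean

namespace RobustMean

/-! ### Blocks made of inliers and outliers -/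

section Decomposition

variable {ι : Type*}

lemma card_mul_sampleMean (x : ι → ℝ) (B : Finset ι) :
    (B.card : ℝ) * sampleMean x B = ∑ i ∈ B, x i := by
  rcases B.eq_empty_or_nonempty with rfl | hB
  · simp
  · have : (B.card : ℝ) ≠ 0 := by exact_mod_cast hB.card_pos.ne'
    rw [sampleMean]; field_simp

lemma sum_sub_sampleMean_sq (x : ι → ℝ) (B : Finset ι) :
    ∑ i ∈ B, (x i - sampleMean x B) ^ 2 = ∑ i ∈ B, x i ^ 2 - B.card * sampleMean x B ^ 2 := by
  have h := card_mul_sampleMean x B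
  have e : ∀ i, (x i - sampleMean x B) ^ 2 =
      x i ^ 2 - 2 * sampleMean x B * x i + sampleMean x B ^ 2 := fun i => by ring
  simp_rw [e]
  rw [Finset.sum_add_distrib, Finset.sum_sub_distrib, ← Finset.mul_sum, ← h, Finset.sum_const,
    nsmul_eq_mul]
  ring

lemma sampleStd_sq (x : ι → ℝ) (B : Finset ι) :
    (B.card : ℝ) * sampleStd x B ^ 2 = ∑ i ∈ B, (x i - sampleMean x B) ^ 2 := by
  have h0 : 0 ≤ ∑ i ∈ B, (x i - sampleMean x B) ^ 2 := Finset.sum_nonneg fun _ _ => sq_nonneg _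
  rw [sampleStd, Real.sq_sqrt (div_nonneg h0 (Nat.cast_nonneg _))]
  rcases B.eq_empty_or_nonempty with rfl | hB
  · simp
  · have : (B.card : ℝ) ≠ 0 := by exact_mod_cast hB.card_pos.ne'
    field_simp

lemma sampleMean_union [DecidableEq ι] (x : ι → ℝ) {A B : Finset ι} (h : Disjoint A B) :
    ((A.card : ℝ) + B.card) * sampleMean x (A ∪ B) =
      A.card * sampleMean x A + B.card * sampleMean x B := by
  rw [card_mul_sampleMean, card_mul_sampleMean, ← Finset.sum_union h, ← card_mul_sampleMean,
    Finset.card_union_of_disjoint h]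
  push_cast; ring

/-- Within-group plus between-group decomposition of the variance, with the scatter inside `B`
dropped. For empty `B` the default mean 0 is multiplied by zero. -/
lemma sampleStd_sq_union_ge [DecidableEq ι] (x : ι → ℝ) {A B : Finset ι} (h : Disjoint A B)
    (hA : A.Nonempty) :
    ∑ i ∈ A, (x i - sampleMean x A) ^ 2 + (A.card : ℝ) * B.card / (A.card + B.card) *
      (sampleMean x A - sampleMean x B) ^ 2 ≤
      ((A.card : ℝ) + B.card) * sampleStd x (A ∪ B) ^ 2 := by
  have hc : (0 : ℝ) < A.card := by exact_mod_cast hA.card_pos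
  have hcB : (0 : ℝ) ≤ B.card := Nat.cast_nonneg _
  have h1 := sampleStd_sq x (A ∪ B)
  rw [Finset.card_union_of_disjoint h] at h1
  push_cast at h1
  rw [h1, sum_sub_sampleMean_sq, sum_sub_sampleMean_sq, Finset.sum_union h,
    Finset.card_union_of_disjoint h]
  have h2 : 0 ≤ ∑ i ∈ B, x i ^ 2 - B.card * sampleMean x B ^ 2 := by
    rw [← sum_sub_sampleMean_sq]; exact Finset.sum_nonneg fun _ _ => sq_nonneg _
  have h3 := sampleMean_union x h
  have h4 : sampleMean x (A ∪ B) =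
      (A.card * sampleMean x A + B.card * sampleMean x B) / (A.card + B.card) := by
    rw [← h3]; field_simp
  have h5 : (A.card : ℝ) * B.card / (A.card + B.card) * (sampleMean x A - sampleMean x B) ^ 2 =
      A.card * sampleMean x A ^ 2 + B.card * sampleMean x B ^ 2 -
        (A.card + B.card) * sampleMean x (A ∪ B) ^ 2 := by
    rw [h4]; field_simp; ring
  push_cast
  rw [h5]
  linarith

end Decomposition

/-! ### Deterministic error bounds for contaminated blocks and for the estimator -/

section Deterministic

variable {N' O k n : ℕ}

lemma inlierBlock_eq_map (g : Fin N' ⊕ Fin O → Fin k) (j : Fin k) :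
    inlierBlock g j = (block (g ∘ Sum.inl) j).map Function.Embedding.inl := by
  ext i
  rcases i with i | i <;> simp [inlierBlock, block]

lemma outlierBlock_eq_map (g : Fin N' ⊕ Fin O → Fin k) (j : Fin k) :
    outlierBlock g j = (block (g ∘ Sum.inr) j).map Function.Embedding.inr := by
  ext i
  rcases i with i | i <;> simp [outlierBlock, block]

lemma inlierBlock_union_outlierBlock (g : Fin N' ⊕ Fin O → Fin k) (j : Fin k) :
    inlierBlock g j ∪ outlierBlock g j = block g j := by
  ext i
  rcases i with i | i <;> simp [inlierBlock, outlierBlock]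

lemma disjoint_inlierBlock_outlierBlock (g : Fin N' ⊕ Fin O → Fin k) (j : Fin k) :
    Disjoint (inlierBlock g j) (outlierBlock g j) := by
  rw [Finset.disjoint_left]
  intro i
  rcases i with i | i <;> simp [inlierBlock, outlierBlock]

lemma card_inlierBlock (g : Fin N' ⊕ Fin O → Fin k) (j : Fin k) :
    (inlierBlock g j).card = (block (g ∘ Sum.inl) j).card := by
  rw [inlierBlock_eq_map, Finset.card_map]

lemma card_inliers_add_outlierCount (g : Fin N' ⊕ Fin O → Fin k) (j : Fin k) :
    (block (g ∘ Sum.inl) j).card + outlierCount g j = (block g j).card := by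
  rw [← card_inlierBlock, outlierCount, ← inlierBlock_union_outlierBlock,
    Finset.card_union_of_disjoint (disjoint_inlierBlock_outlierBlock g j)]

lemma sum_outlierCount (g : Fin N' ⊕ Fin O → Fin k) : ∑ j, outlierCount g j = O := by
  have h := Finset.card_eq_sum_card_fiberwise (s := (Finset.univ : Finset (Fin O)))
    (t := (Finset.univ : Finset (Fin k))) (f := g ∘ Sum.inr) (fun _ _ => Finset.mem_univ _)
  rw [Finset.card_univ, Fintype.card_fin] at h
  refine Eq.trans (Finset.sum_congr rfl fun j _ => ?_) h.symm
  rw [outlierCount, outlierBlock_eq_map, Finset.card_map, block]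

/-- The observations `x`, restricted to the inliers and standardized. -/
noncomputable def standardize (μ σ : ℝ) (x : Fin N' ⊕ Fin O → ℝ) (i : Fin N') : ℝ :=
  (x (Sum.inl i) - μ) / σ

lemma sampleMean_inlierBlock (x : Fin N' ⊕ Fin O → ℝ) (g : Fin N' ⊕ Fin O → Fin k) (j : Fin k)
    {μ σ : ℝ} (hσ : 0 < σ) (hpos : 0 < (block (g ∘ Sum.inl) j).card) :
    sampleMean x (inlierBlock g j) - μ =
      σ * sampleMean (standardize μ σ x) (block (g ∘ Sum.inl) j) := by
  have hc : (0 : ℝ) < (block (g ∘ Sum.inl) j).card := by exact_mod_cast hpos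
  have h : ∑ i ∈ block (g ∘ Sum.inl) j, standardize μ σ x i =
      (∑ i ∈ block (g ∘ Sum.inl) j, x (Sum.inl i) - (block (g ∘ Sum.inl) j).card * μ) / σ := by
    simp only [standardize]
    rw [← Finset.sum_div, Finset.sum_sub_distrib, Finset.sum_const, nsmul_eq_mul]
  rw [sampleMean, sampleMean, h, card_inlierBlock, inlierBlock_eq_map, Finset.sum_map]
  simp only [Function.Embedding.inl_apply]
  field_simp

lemma sum_inlierBlock_sub_sq (x : Fin N' ⊕ Fin O → ℝ) (g : Fin N' ⊕ Fin O → Fin k) (j : Fin k)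
    {μ σ : ℝ} (hσ : 0 < σ) (hpos : 0 < (block (g ∘ Sum.inl) j).card) :
    ∑ i ∈ inlierBlock g j, (x i - sampleMean x (inlierBlock g j)) ^ 2 =
      (block (g ∘ Sum.inl) j).card * (σ ^ 2 *
        (secondMoment (standardize μ σ x) (block (g ∘ Sum.inl) j) -
          sampleMean (standardize μ σ x) (block (g ∘ Sum.inl) j) ^ 2)) := by
  have hc : (0 : ℝ) < (block (g ∘ Sum.inl) j).card := by exact_mod_cast hpos
  have h1 := sampleMean_inlierBlock x g j (μ := μ) hσ hpos
  set m := sampleMean (standardize μ σ x) (block (g ∘ Sum.inl) j) with hm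
  have h2 := sum_sub_sampleMean_sq (standardize μ σ x) (block (g ∘ Sum.inl) j)
  rw [← hm] at h2
  have h3 : (block (g ∘ Sum.inl) j).card *
      secondMoment (standardize μ σ x) (block (g ∘ Sum.inl) j) =
      ∑ i ∈ block (g ∘ Sum.inl) j, standardize μ σ x i ^ 2 := by
    rw [secondMoment]; field_simp
  calc _ = ∑ i ∈ block (g ∘ Sum.inl) j, σ ^ 2 * (standardize μ σ x i - m) ^ 2 := by
        conv_lhs => rw [inlierBlock_eq_map, Finset.sum_map]
        refine Finset.sum_congr rfl fun i _ => ?_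
        rw [← inlierBlock_eq_map, Function.Embedding.inl_apply]
        have h4 : x (Sum.inl i) - sampleMean x (inlierBlock g j) =
            σ * (standardize μ σ x i - m) := by
          have : σ * standardize μ σ x i = x (Sum.inl i) - μ := by
            rw [standardize]; field_simp
          rw [mul_sub, this, ← h1]; ring
        rw [h4, mul_pow]
    _ = _ := by rw [← Finset.mul_sum, h2, ← h3]; ring

/-- The self-normalized error of a contaminated block. -/
lemma abs_div_rpow_le_of_contaminated {p : ℝ} (hp : 1 ≤ p) {v m w d t α : ℝ} (hv : 0 ≤ v)
    (hspread : WellSpread v m) (hw : 0 ≤ w) (ht : 0 < t)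
    (ht2 : (v - m ^ 2) / 2 + w * d ^ 2 / 2 ≤ t ^ 2) (hα1 : 1 ≤ α) (hα : α ≤ 1 + w * d ^ 2) :
    |m - w * d| / t ^ p ≤ 20 ^ (p / 2) * α ^ (-(p - 1) / 2) * (selfNorm v m + √w) := by
  unfold WellSpread at hspread
  have hwd : 0 ≤ w * d ^ 2 := by positivity
  -- Three lower bounds for t²: one against each part of the numerator, and one against α. One
  -- factor t cancels the numerator, the other p - 1 factors produce the power of α.
  have h1 : v + 1 ≤ 20 * t ^ 2 := by linarith
  have h2 : α / 20 ≤ t ^ 2 := by linarith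
  have h3 : w * d ^ 2 ≤ 20 * t ^ 2 := by nlinarith
  have hs20 : √(20 * t ^ 2) = √20 * t := by
    rw [Real.sqrt_mul (by norm_num), Real.sqrt_sq ht.le]
  have hm : |m| ≤ √20 * t * selfNorm v m := by
    have hpos : 0 < √(v + 1) := Real.sqrt_pos.2 (by linarith)
    have e : |m| = √(v + 1) * selfNorm v m := by rw [selfNorm]; field_simp
    rw [e, ← hs20]
    have := selfNorm_nonneg v m
    gcongr
  have hd : |w * d| ≤ √20 * t * √w := by
    have e : |w * d| = √(w * d ^ 2) * √w := by
      rw [Real.sqrt_mul hw, Real.sqrt_sq_eq_abs, abs_mul, abs_of_nonneg hw]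
      nth_rewrite 1 [← Real.mul_self_sqrt hw]
      ring
    rw [e, ← hs20]
    gcongr
  have h4 : |m - w * d| ≤ √20 * t * (selfNorm v m + √w) :=
    (abs_sub _ _).trans (by linarith)
  have htp : t ^ p = t * t ^ (p - 1) := by
    nth_rewrite 2 [← Real.rpow_one t]
    rw [← Real.rpow_add ht]; congr 1; ring
  have h5 : (t ^ (p - 1))⁻¹ ≤ 20 ^ ((p - 1) / 2) * α ^ (-(p - 1) / 2) := by
    have e : (t ^ (p - 1))⁻¹ = (t ^ 2) ^ (-(p - 1) / 2) := by
      rw [← Real.rpow_neg ht.le, ← Real.rpow_natCast, ← Real.rpow_mul ht.le]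
      congr 1; push_cast; ring
    rw [e]
    refine (Real.rpow_le_rpow_of_nonpos (by linarith) h2 (by linarith)).trans (le_of_eq ?_)
    rw [Real.div_rpow (by linarith) (by norm_num), neg_div,
      Real.rpow_neg (by norm_num : (0:ℝ) ≤ 20), div_inv_eq_mul, mul_comm]
  have hnn : 0 ≤ selfNorm v m + √w := add_nonneg (selfNorm_nonneg _ _) (Real.sqrt_nonneg _)
  calc |m - w * d| / t ^ p ≤ √20 * t * (selfNorm v m + √w) / t ^ p := by gcongr
    _ = √20 * (t ^ (p - 1))⁻¹ * (selfNorm v m + √w) := by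
        rw [htp]
        have : t ^ (p - 1) ≠ 0 := (Real.rpow_pos_of_pos ht _).ne'
        field_simp
    _ ≤ √20 * (20 ^ ((p - 1) / 2) * α ^ (-(p - 1) / 2)) * (selfNorm v m + √w) := by gcongr
    _ = _ := by
        have e : (20 : ℝ) ^ (p / 2) = √20 * 20 ^ ((p - 1) / 2) := by
          rw [Real.sqrt_eq_rpow, ← Real.rpow_add (by norm_num)]; congr 1; ring
        rw [e]; ring

lemma one_le_alpha (σ : ℝ) (x : Fin N' ⊕ Fin O → ℝ) (g : Fin N' ⊕ Fin O → Fin k) :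
    1 ≤ alpha n σ x g := by
  have : 0 ≤ ⨅ j : {j : Fin k // outlierCount g j ≠ 0}, (outlierCount g j.1 : ℝ) *
      (sampleMean x (inlierBlock g j.1) - sampleMean x (outlierBlock g j.1)) ^ 2 /
        ((n : ℝ) * σ ^ 2) := Real.iInf_nonneg fun j => by positivity
  unfold alpha
  linarith

lemma alpha_le (σ : ℝ) (x : Fin N' ⊕ Fin O → ℝ) (g : Fin N' ⊕ Fin O → Fin k) {j : Fin k}
    (hj : outlierCount g j ≠ 0) : alpha n σ x g ≤ 1 + (outlierCount g j : ℝ) *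
      (sampleMean x (inlierBlock g j) - sampleMean x (outlierBlock g j)) ^ 2 /
        ((n : ℝ) * σ ^ 2) := by
  unfold alpha
  gcongr
  exact ciInf_le (f := fun j : {j : Fin k // outlierCount g j ≠ 0} => (outlierCount g j.1 : ℝ) *
      (sampleMean x (inlierBlock g j.1) - sampleMean x (outlierBlock g j.1)) ^ 2 /
        ((n : ℝ) * σ ^ 2)) (Set.finite_range _).bddBelow ⟨j, hj⟩

/-- With w = W/n ≤ 1/2 and d the normalized gap between inlier and outlier means, the outliers shift
the block mean by wd. The inliers keep at least half of their variance, and the between-group weight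
(1 - w)w is at least w/2. -/
lemma block_decomposition {σ μ : ℝ} (hn : 0 < n) (hσ : 0 < σ) (x : Fin N' ⊕ Fin O → ℝ)
    (g : Fin N' ⊕ Fin O → Fin k) {j : Fin k} (hg : (block g j).card = n)
    (hW : 2 * outlierCount g j ≤ n) :
    sampleMean x (block g j) - μ = σ * (sampleMean (standardize μ σ x) (block (g ∘ Sum.inl) j) -
      outlierCount g j / n * ((sampleMean x (inlierBlock g j) -
        sampleMean x (outlierBlock g j)) / σ)) ∧
    σ ^ 2 * ((secondMoment (standardize μ σ x) (block (g ∘ Sum.inl) j) -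
        sampleMean (standardize μ σ x) (block (g ∘ Sum.inl) j) ^ 2) / 2 +
      outlierCount g j / n * ((sampleMean x (inlierBlock g j) -
        sampleMean x (outlierBlock g j)) / σ) ^ 2 / 2) ≤ sampleStd x (block g j) ^ 2 ∧
    (outlierCount g j = 0 → sampleStd x (block g j) ^ 2 =
      σ ^ 2 * (secondMoment (standardize μ σ x) (block (g ∘ Sum.inl) j) -
        sampleMean (standardize μ σ x) (block (g ∘ Sum.inl) j) ^ 2)) := by
  have hcount := card_inliers_add_outlierCount g j
  rw [hg] at hcount
  have hpos : 0 < (block (g ∘ Sum.inl) j).card := by omega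
  have hn' : (0 : ℝ) < n := by exact_mod_cast hn
  have hmean := sampleMean_inlierBlock x g j (μ := μ) hσ hpos
  have hvar := sum_inlierBlock_sub_sq x g j (μ := μ) hσ hpos
  have hdisj := disjoint_inlierBlock_outlierBlock g j
  have hunion := sampleMean_union x hdisj
  have hstd := sampleStd_sq_union_ge x hdisj
    (Finset.card_pos.1 (by rw [card_inlierBlock]; exact hpos))
  rw [inlierBlock_union_outlierBlock, card_inlierBlock] at hunion hstd
  have hO : (outlierBlock g j).card = outlierCount g j := rfl
  rw [hO] at hunion hstd
  have hempty : outlierCount g j = 0 → block g j = inlierBlock g j := fun h => by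
    rw [outlierCount, Finset.card_eq_zero] at h
    rw [← inlierBlock_union_outlierBlock, h, Finset.union_empty]
  have hcount' : ((block (g ∘ Sum.inl) j).card : ℝ) = n - outlierCount g j := by
    rw [← hcount]; push_cast; ring
  have hW' : 2 * (outlierCount g j : ℝ) ≤ n := by exact_mod_cast hW
  set m := sampleMean (standardize μ σ x) (block (g ∘ Sum.inl) j)
  set v := secondMoment (standardize μ σ x) (block (g ∘ Sum.inl) j)
  set D := sampleMean x (inlierBlock g j) - sampleMean x (outlierBlock g j) with hD
  set W : ℝ := (outlierCount g j : ℝ)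
  have hW0 : 0 ≤ W := Nat.cast_nonneg _
  rw [hcount'] at hunion hstd hvar
  rw [sub_add_cancel] at hunion hstd
  have hr0 : 0 ≤ v - m ^ 2 := by
    have h1 : 0 ≤ (n - W) * (σ ^ 2 * (v - m ^ 2)) := by
      rw [← hvar]; exact Finset.sum_nonneg fun _ _ => sq_nonneg _
    have h2 : 0 < (n - W) * σ ^ 2 := mul_pos (by linarith) (by positivity)
    rw [← mul_assoc] at h1
    exact nonneg_of_mul_nonneg_right h1 h2
  refine ⟨?_, ?_, fun h => ?_⟩
  · have h1 : sampleMean x (block g j) = sampleMean x (inlierBlock g j) - W / n * D := by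
      have h2 : (n : ℝ) * sampleMean x (block g j) =
          n * (sampleMean x (inlierBlock g j) - W / n * D) := by
        rw [hunion, hD]; field_simp; ring
      exact mul_left_cancel₀ hn'.ne' h2
    have h2 : σ * (m - W / n * (D / σ)) = σ * m - W / n * D := by field_simp
    rw [h2, h1, ← hmean]
    ring
  · rw [hvar] at hstd
    refine le_of_mul_le_mul_left ?_ hn'
    refine le_trans ?_ hstd
    have h1 : n / 2 * (σ ^ 2 * (v - m ^ 2)) ≤ (n - W) * (σ ^ 2 * (v - m ^ 2)) := by
      gcongr; linarith
    have h2 : W / 2 * D ^ 2 ≤ (n - W) * W / n * D ^ 2 := by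
      refine mul_le_mul_of_nonneg_right ?_ (sq_nonneg _)
      rw [le_div_iff₀ hn']
      nlinarith
    have h3 : (n : ℝ) * (σ ^ 2 * ((v - m ^ 2) / 2 + W / n * (D / σ) ^ 2 / 2)) =
        n / 2 * (σ ^ 2 * (v - m ^ 2)) + W / 2 * D ^ 2 := by field_simp
    linarith
  · have h1 := sampleStd_sq x (block g j)
    have hW1 : W = 0 := by simp [W, h]
    rw [hg] at h1
    nth_rewrite 3 [hempty h] at h1
    rw [show (∑ i ∈ block g j, (x i - sampleMean x (inlierBlock g j)) ^ 2) =
      ∑ i ∈ inlierBlock g j, (x i - sampleMean x (inlierBlock g j)) ^ 2 by rw [← hempty h],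
      hvar, hW1, sub_zero] at h1
    exact mul_left_cancel₀ hn'.ne' h1

/-- Standard deviation and contribution of a block with few outliers and well-spread inliers. -/
lemma block_contribution {p σ μ : ℝ} (hp : 1 ≤ p) (hn : 0 < n) (hσ : 0 < σ)
    (x : Fin N' ⊕ Fin O → ℝ) (g : Fin N' ⊕ Fin O → Fin k) {j : Fin k}
    (hg : (block g j).card = n) (hW : 2 * outlierCount g j ≤ n)
    (hspread : WellSpread (secondMoment (standardize μ σ x) (block (g ∘ Sum.inl) j))
      (sampleMean (standardize μ σ x) (block (g ∘ Sum.inl) j))) :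
    0 < sampleStd x (block g j) ∧
    (outlierCount g j = 0 → (sampleMean x (block g j) - μ) / sampleStd x (block g j) ^ p =
      σ ^ (1 - p) * studentized p (secondMoment (standardize μ σ x) (block (g ∘ Sum.inl) j))
        (sampleMean (standardize μ σ x) (block (g ∘ Sum.inl) j))) ∧
    (outlierCount g j ≠ 0 → |(sampleMean x (block g j) - μ) / sampleStd x (block g j) ^ p| ≤
      σ ^ (1 - p) * (20 ^ (p / 2) * alpha n σ x g ^ (-(p - 1) / 2) *
        (selfNorm (secondMoment (standardize μ σ x) (block (g ∘ Sum.inl) j))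
          (sampleMean (standardize μ σ x) (block (g ∘ Sum.inl) j)) +
          √(outlierCount g j / n)))) := by
  obtain ⟨h1, h2, h3⟩ := block_decomposition (μ := μ) hn hσ x g hg hW
  have hv : 0 ≤ secondMoment (standardize μ σ x) (block (g ∘ Sum.inl) j) :=
    secondMoment_nonneg _ _
  have hn' : (0 : ℝ) < n := by exact_mod_cast hn
  have hα : outlierCount g j ≠ 0 → alpha n σ x g ≤ 1 + outlierCount g j / n *
      ((sampleMean x (inlierBlock g j) - sampleMean x (outlierBlock g j)) / σ) ^ 2 := fun h => by
    refine (alpha_le σ x g h).trans (le_of_eq ?_)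
    field_simp
  have hS0 : 0 ≤ sampleStd x (block g j) := Real.sqrt_nonneg _
  have hw0 : (0 : ℝ) ≤ (outlierCount g j : ℝ) / n := by positivity
  set m := sampleMean (standardize μ σ x) (block (g ∘ Sum.inl) j)
  set v := secondMoment (standardize μ σ x) (block (g ∘ Sum.inl) j)
  set d := (sampleMean x (inlierBlock g j) - sampleMean x (outlierBlock g j)) / σ
  set w : ℝ := (outlierCount g j : ℝ) / n with hw
  set S := sampleStd x (block g j)
  have hspread' : (v + 1) / 10 ≤ v - m ^ 2 := hspread
  have hS : 0 < S := by
    rcases hS0.eq_or_lt with h | h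
    · exfalso
      rw [← h] at h2
      have : 0 < (v - m ^ 2) / 2 + w * d ^ 2 / 2 := by
        have : 0 ≤ w * d ^ 2 := by positivity
        linarith
      have := mul_pos (pow_pos hσ 2) this
      linarith
    · exact h
  set t := S / σ with ht
  have ht0 : 0 < t := div_pos hS hσ
  have hSt : S = σ * t := by rw [ht]; field_simp
  have hpow : ∀ y : ℝ, σ * y / S ^ p = σ ^ (1 - p) * (y / t ^ p) := fun y => by
    rw [hSt, Real.mul_rpow hσ.le ht0.le, Real.rpow_sub hσ, Real.rpow_one]
    field_simp
  rw [h1, hpow]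
  refine ⟨hS, fun h => ?_, fun h => ?_⟩
  · have hw1 : w = 0 := by simp [hw, h]
    have ht2 : t ^ 2 = v - m ^ 2 := by
      have := h3 h
      rw [hSt, mul_pow] at this
      exact mul_left_cancel₀ (pow_pos hσ 2).ne' this
    rw [hw1, zero_mul, sub_zero, studentized, truncVar_of_wellSpread hspread, ← ht2,
      div_eq_mul_inv, ← Real.rpow_natCast t 2, ← Real.rpow_mul ht0.le, ← Real.rpow_neg ht0.le]
    congr 3
    push_cast; ring
  · rw [abs_mul, abs_of_pos (Real.rpow_pos_of_pos hσ _), abs_div,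
      abs_of_pos (Real.rpow_pos_of_pos ht0 _)]
    refine mul_le_mul_of_nonneg_left ?_ (Real.rpow_pos_of_pos hσ _).le
    refine abs_div_rpow_le_of_contaminated hp hv hspread hw0 ht0 ?_ (one_le_alpha σ x g) (hα h)
    rw [hSt, mul_pow] at h2
    exact le_of_mul_le_mul_left h2 (pow_pos hσ 2)

/-- Clean blocks enter through their signed sum, so that later their fluctuations average out;
contaminated blocks enter in absolute value. The denominator is at least k((1 - C)/(4σ))^p by
`EventE`, whose first alternative is excluded because all block deviations are positive. -/
lemma abs_estimator_sub_le {p C σ μ : ℝ} (hp : 1 ≤ p) (hC : C < 1) (hn : 0 < n) (hk : 0 < k)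
    (hσ : 0 < σ) (x : Fin N' ⊕ Fin O → ℝ) (g : Fin N' ⊕ Fin O → Fin k)
    (hg : ∀ j, (block g j).card = n) (hW : ∀ j, 2 * outlierCount g j ≤ n)
    (hspread : ∀ j, WellSpread (secondMoment (standardize μ σ x) (block (g ∘ Sum.inl) j))
      (sampleMean (standardize μ σ x) (block (g ∘ Sum.inl) j))) {A₀ A₁ : ℝ}
    (h0 : |∑ j ∈ Finset.univ.filter (fun j => outlierCount g j = 0),
      studentized p (secondMoment (standardize μ σ x) (block (g ∘ Sum.inl) j))
        (sampleMean (standardize μ σ x) (block (g ∘ Sum.inl) j))| ≤ A₀)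
    (h1 : ∑ j ∈ Finset.univ.filter (fun j => outlierCount g j ≠ 0),
      selfNorm (secondMoment (standardize μ σ x) (block (g ∘ Sum.inl) j))
        (sampleMean (standardize μ σ x) (block (g ∘ Sum.inl) j)) ≤ A₁)
    (hE : EventE p C σ x g) :
    |estimator p x g - μ| ≤ 4 ^ p * σ / (1 - C) ^ p * ((A₀ + 20 ^ (p / 2) *
      alpha n σ x g ^ (-(p - 1) / 2) * (A₁ + O / √n)) / k) := by
  have hn' : (0 : ℝ) < n := by exact_mod_cast hn
  have hk' : (0 : ℝ) < k := by exact_mod_cast hk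
  have hblock := fun j => block_contribution hp hn hσ x g (hg j) (hW j) (hspread j)
  have hS : ∀ j, 0 < sampleStd x (block g j) := fun j => (hblock j).1
  have hSp : ∀ j, 0 < 1 / sampleStd x (block g j) ^ p := fun j =>
    one_div_pos.2 (Real.rpow_pos_of_pos (hS j) _)
  have hC' : 0 < 1 - C := by linarith
  set T := ∑ l, 1 / sampleStd x (block g l) ^ p with hT
  have hTpos : 0 < T := Finset.sum_pos (fun j _ => hSp j) ⟨⟨0, hk⟩, Finset.mem_univ _⟩
  have hTge : (k : ℝ) * ((1 - C) / (4 * σ)) ^ p ≤ T := by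
    rcases hE with ⟨j, hj⟩ | hE
    · exact absurd hj (hS j).ne'
    · have hq : (0 : ℝ) < (4 * σ / (1 - C)) ^ p := by positivity
      have h2 : ((4 * σ / (1 - C)) ^ p)⁻¹ ≤ 1 / (k : ℝ) * T := inv_le_of_inv_le₀ (by positivity) hE
      rw [← Real.inv_rpow (by positivity), inv_div] at h2
      rw [one_div, inv_mul_eq_div, le_div_iff₀ hk'] at h2
      linarith
  have hest : estimator p x g - μ =
      (∑ j, (sampleMean x (block g j) - μ) / sampleStd x (block g j) ^ p) / T := by
    have e1 : estimator p x g =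
        (∑ j, sampleMean x (block g j) / sampleStd x (block g j) ^ p) / T := by
      rw [estimator, Finset.sum_div]
      refine Finset.sum_congr rfl fun j _ => ?_
      rw [weight, ← hT]; ring
    have e2 : ∑ j, (sampleMean x (block g j) - μ) / sampleStd x (block g j) ^ p =
        ∑ j, sampleMean x (block g j) / sampleStd x (block g j) ^ p - μ * T := by
      rw [hT, Finset.mul_sum, ← Finset.sum_sub_distrib]
      exact Finset.sum_congr rfl fun j _ => by ring
    rw [e1, e2]; field_simp
  set α := alpha n σ x g ^ (-(p - 1) / 2) with hα
  have hα0 : 0 < α := Real.rpow_pos_of_pos (by linarith [one_le_alpha (n := n) σ x g]) _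
  have hnum : |∑ j, (sampleMean x (block g j) - μ) / sampleStd x (block g j) ^ p| ≤
      σ ^ (1 - p) * (A₀ + 20 ^ (p / 2) * α * (A₁ + O / √n)) := by
    have hσp : 0 < σ ^ (1 - p) := Real.rpow_pos_of_pos hσ _
    rw [← Finset.sum_filter_add_sum_filter_not Finset.univ (fun j => outlierCount g j = 0),
      mul_add]
    refine (abs_add_le _ _).trans (add_le_add ?_ ?_)
    · rw [Finset.sum_congr rfl fun j hj => (hblock j).2.1 (Finset.mem_filter.1 hj).2,
        ← Finset.mul_sum, abs_mul, abs_of_pos hσp]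
      gcongr
    · refine (Finset.abs_sum_le_sum_abs _ _).trans ((Finset.sum_le_sum fun j hj =>
        (hblock j).2.2 (Finset.mem_filter.1 hj).2).trans ?_)
      rw [← Finset.mul_sum, ← Finset.mul_sum, Finset.sum_add_distrib]
      -- Here √W ≤ W because W is a positive integer, and the counts add up to `O`.
      have hsq : ∑ j ∈ Finset.univ.filter (fun j => ¬ outlierCount g j = 0),
          √((outlierCount g j : ℝ) / n) ≤ O / √n := by
        calc _ ≤ ∑ j ∈ Finset.univ.filter (fun j => ¬ outlierCount g j = 0),
              (outlierCount g j : ℝ) / √n := by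
              refine Finset.sum_le_sum fun j hj => ?_
              rw [Real.sqrt_div (Nat.cast_nonneg _)]
              gcongr
              have : (1 : ℝ) ≤ outlierCount g j := by
                exact_mod_cast Nat.one_le_iff_ne_zero.2 (Finset.mem_filter.1 hj).2
              rw [Real.sqrt_le_left (by linarith)]
              nlinarith
          _ ≤ ∑ j, (outlierCount g j : ℝ) / √n :=
              Finset.sum_le_sum_of_subset_of_nonneg (Finset.filter_subset _ _)
                fun _ _ _ => by positivity
          _ = _ := by
              rw [← Finset.sum_div, ← Nat.cast_sum, sum_outlierCount]
      have h1' := add_le_add h1 hsq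
      gcongr
  have hA : 0 ≤ A₀ + 20 ^ (p / 2) * α * (A₁ + O / √n) := by
    have hA0 : 0 ≤ A₀ := (abs_nonneg _).trans h0
    have hA1 : 0 ≤ A₁ := (Finset.sum_nonneg fun j _ => selfNorm_nonneg _ _).trans h1
    positivity
  rw [hest, abs_div, abs_of_pos hTpos, div_le_iff₀ hTpos]
  refine hnum.trans ?_
  have hq : (0 : ℝ) < k * ((1 - C) / (4 * σ)) ^ p := by positivity
  calc σ ^ (1 - p) * (A₀ + 20 ^ (p / 2) * α * (A₁ + O / √n))
      = 4 ^ p * σ / (1 - C) ^ p * ((A₀ + 20 ^ (p / 2) * α * (A₁ + O / √n)) / k) *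
          (k * ((1 - C) / (4 * σ)) ^ p) := by
        rw [Real.div_rpow hC'.le (by positivity), Real.mul_rpow (by norm_num) hσ.le,
          Real.rpow_sub hσ, Real.rpow_one]
        have a1 : (1 - C) ^ p ≠ 0 := (Real.rpow_pos_of_pos hC' _).ne'
        have a2 : σ ^ p ≠ 0 := (Real.rpow_pos_of_pos hσ _).ne'
        have a3 : (4 : ℝ) ^ p ≠ 0 := by positivity
        field_simp
    _ ≤ _ := by
        have a1 : 0 < (1 - C) ^ p := Real.rpow_pos_of_pos hC' _
        gcongr

end Deterministic

end RobustMean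

namespace RobustMean

/-! ### Averaging over an independent finite-valued variable -/

/-- Conditioning on `G` by hand: split according to its finitely many values and factor each piece.
-/
lemma measureReal_mem_le_of_indepFun {Ω α β : Type*} [MeasurableSpace Ω] {Q : Measure Ω}
    [IsProbabilityMeasure Q] [MeasurableSpace α] [MeasurableSpace β] [Fintype β]
    [MeasurableSingletonClass β] {ξ : Ω → α} {G : Ω → β} (hG : Measurable G)
    (hind : IndepFun ξ G Q) {A : β → Set α} (hA : ∀ b, MeasurableSet (A b)) {T : Set β} {ε : ℝ}
    (hε0 : 0 ≤ ε) (hε : ∀ b ∈ T, Q.real {ω | ξ ω ∈ A b} ≤ ε) :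
    Q.real {ω | G ω ∈ T ∧ ξ ω ∈ A (G ω)} ≤ ε := by
  classical
  have hsub : {ω | G ω ∈ T ∧ ξ ω ∈ A (G ω)} ⊆
      ⋃ b ∈ Finset.univ.filter (· ∈ T), ξ ⁻¹' A b ∩ G ⁻¹' {b} := by
    intro ω hω
    simp only [Set.mem_iUnion, Finset.mem_filter, Finset.mem_univ, true_and]
    exact ⟨G ω, hω.1, hω.2, rfl⟩
  refine (measureReal_mono hsub (measure_ne_top _ _)).trans
    ((measureReal_biUnion_finset_le _ _).trans ?_)
  calc ∑ b ∈ Finset.univ.filter (· ∈ T), Q.real (ξ ⁻¹' A b ∩ G ⁻¹' {b})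
      ≤ ∑ b ∈ Finset.univ.filter (· ∈ T), ε * Q.real (G ⁻¹' {b}) := by
        refine Finset.sum_le_sum fun b hb => ?_
        rw [measureReal_def, hind.measure_inter_preimage_eq_mul _ _ (hA b)
          (measurableSet_singleton b), ENNReal.toReal_mul]
        exact mul_le_mul_of_nonneg_right (hε b (Finset.mem_filter.1 hb).2) ENNReal.toReal_nonneg
    _ ≤ ε * 1 := by
        rw [← Finset.mul_sum, sum_measureReal_preimage_singleton _
          fun b _ => hG (measurableSet_singleton b)]
        gcongr
        exact measureReal_le_one
    _ = ε := mul_one ε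

/-! ### Exceptional inlier samples -/

section Deviations

variable {Ω ι : Type*} [MeasurableSpace Ω] {Q : Measure Ω} [IsProbabilityMeasure Q] {ν : Measure ℝ}
  {Z : ι → Ω → ℝ} [Fintype ι] {k n : ℕ}

lemma measureReal_exists_not_wellSpread_le (hν : IsStandardized ν) (h : IsIIDSample Q ν Z) {a : ℝ}
    (ha : 0 < a) (hνa : 1 / 2 ≤ ∫ x in {x : ℝ | |x| ≤ a}, x ^ 2 ∂ν) (hn : 0 < n) (g : ι → Fin k)
    (hlarge : ∀ j, n ≤ 2 * (block g j).card) :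
    Q.real {ω | ∃ j, ¬ WellSpread (secondMoment (fun i => Z i ω) (block g j))
      (sampleMean (fun i => Z i ω) (block g j))} ≤
      k * (3 * Real.exp (-(min (1 / 120) (1 / (8 * a ^ 4)) / 2 * n))) := by
  have hsub : {ω | ∃ j, ¬ WellSpread (secondMoment (fun i => Z i ω) (block g j))
      (sampleMean (fun i => Z i ω) (block g j))} ⊆ ⋃ j ∈ (Finset.univ : Finset (Fin k)),
      {ω | ¬ WellSpread (secondMoment (fun i => Z i ω) (block g j))
        (sampleMean (fun i => Z i ω) (block g j))} := by
    rintro ω ⟨j, hj⟩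
    simp only [Set.mem_iUnion]
    exact ⟨j, Finset.mem_univ _, hj⟩
  refine (measureReal_mono hsub (measure_ne_top _ _)).trans
    ((measureReal_biUnion_finset_le _ _).trans ?_)
  set c₂ := min (1 / 120) (1 / (8 * a ^ 4)) with hc₂
  have hc₂0 : 0 < c₂ := lt_min (by norm_num) (by positivity)
  calc _ ≤ ∑ j : Fin k, 3 * Real.exp (-(c₂ / 2 * n)) := by
        refine Finset.sum_le_sum fun j _ => (measureReal_not_wellSpread_le hν h
          (Finset.card_pos.1 (by have := hlarge j; omega)) ha hνa).trans ?_
        have : (n : ℝ) ≤ 2 * (block g j).card := by exact_mod_cast hlarge j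
        rw [← hc₂]
        gcongr 3 * Real.exp (-?_)
        nlinarith
    _ = _ := by simp

lemma measureReal_abs_sum_studentized_ge_le (hν : IsStandardized ν) (h : IsIIDSample Q ν Z)
    (hn : 0 < n) (hk : 0 < k) {p : ℝ} (hp : 1 ≤ p) {s : ℝ} (hs : 0 ≤ s) (g : ι → Fin k)
    (J : Finset (Fin k)) (hcard : ∀ j ∈ J, (block g j).card = n) :
    Q.real {ω | 20 * 10 ^ (p / 2) * √(k * (s + 1) / n) +
      k * (20 * p * 10 ^ (p / 2) * (biasBound ν n + 1 / n)) ≤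
      |∑ j ∈ J, studentized p (secondMoment (fun i => Z i ω) (block g j))
          (sampleMean (fun i => Z i ω) (block g j))|} ≤ 2 * Real.exp (-(s + 1)) := by
  have hn' : (0 : ℝ) < n := by exact_mod_cast hn
  obtain ⟨M, hMval⟩ : ∃ M : NNReal, (M : ℝ) = 10 ^ (p / 2) := ⟨⟨_, by positivity⟩, rfl⟩
  have hM : 0 < M := by
    rw [← NNReal.coe_pos, hMval]; positivity
  have hle : ∀ j ∈ J, ∀ x : ι → ℝ,
      |studentized p (secondMoment x (block g j)) (sampleMean x (block g j))| ≤
        M * selfNorm (secondMoment x (block g j)) (sampleMean x (block g j)) := fun j _ x => by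
    rw [hMval]; exact abs_studentized_le hp (secondMoment_nonneg _ _) _
  have hlarge : ∀ j ∈ J, n ≤ 2 * (block g j).card := fun j hj => by rw [hcard j hj]; omega
  have hD1 := measureReal_sum_blockStat_ge_le hν h hn hk g J hlarge
    (measurable_studentized p) hM hle hs
  have hD2 := measureReal_sum_blockStat_ge_le (f := fun v m => -studentized p v m) hν h hn hk g J
    hlarge (measurable_studentized p).neg hM (by simpa only [abs_neg] using hle) hs
  have hEsum : |∑ j ∈ J, ∫ ω', studentized p (secondMoment (fun i => Z i ω') (block g j))
      (sampleMean (fun i => Z i ω') (block g j)) ∂Q| ≤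
      k * (20 * p * 10 ^ (p / 2) * (biasBound ν n + 1 / n)) := by
    have hE : ∀ j ∈ J, |∫ ω', studentized p (secondMoment (fun i => Z i ω') (block g j))
        (sampleMean (fun i => Z i ω') (block g j)) ∂Q| ≤
        20 * p * 10 ^ (p / 2) * (biasBound ν n + 1 / n) := fun j hj => by
      have h1 := abs_integral_studentized_le hν h
        (Finset.card_pos.1 (by rw [hcard j hj]; exact hn)) hp
      rwa [hcard j hj] at h1
    refine (Finset.abs_sum_le_sum_abs _ _).trans ((Finset.sum_le_sum hE).trans ?_)
    rw [Finset.sum_const, nsmul_eq_mul]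
    have hb := biasBound_nonneg ν hn'.le
    gcongr
    simpa using Finset.card_le_univ J
  refine (measureReal_mono ?_ (measure_ne_top _ _)).trans ((measureReal_union_le _ _).trans
    ((add_le_add hD1 hD2).trans (le_of_eq (two_mul _).symm)))
  intro ω hω
  by_contra hcon
  rw [Set.mem_ofPred_eq] at hω
  simp only [Set.mem_union, Set.mem_ofPred_eq, not_or, not_le] at hcon
  obtain ⟨d1, d2⟩ := hcon
  rw [Finset.sum_sub_distrib] at d1 d2
  simp_rw [integral_neg, Finset.sum_neg_distrib] at d2
  rw [hMval] at d1 d2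
  have hE1 := abs_le.1 hEsum
  refine absurd hω (not_le.2 ?_)
  rw [abs_lt]
  constructor <;> linarith

lemma measureReal_sum_selfNorm_ge_le (hν : IsStandardized ν) (h : IsIIDSample Q ν Z)
    (hn : 0 < n) (hk : 0 < k) {s : ℝ} (hs : 0 ≤ s) (g : ι → Fin k) (J : Finset (Fin k))
    (hlarge : ∀ j ∈ J, n ≤ 2 * (block g j).card) :
    Q.real {ω | 20 * √(k * (s + 1) / n) + J.card * (5 / √n) ≤
      ∑ j ∈ J, selfNorm (secondMoment (fun i => Z i ω) (block g j))
          (sampleMean (fun i => Z i ω) (block g j))} ≤ Real.exp (-(s + 1)) := by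
  have hn' : (0 : ℝ) < n := by exact_mod_cast hn
  have hone : ∀ j, ∀ x : ι → ℝ, |selfNorm (secondMoment x (block g j))
      (sampleMean x (block g j))| ≤ (1 : NNReal) * selfNorm (secondMoment x (block g j))
        (sampleMean x (block g j)) := fun j x => by
    rw [abs_of_nonneg (selfNorm_nonneg _ _), NNReal.coe_one, one_mul]
  have hD := measureReal_sum_blockStat_ge_le hν h hn hk g J hlarge
      measurable_selfNorm one_pos (fun j _ => hone j) hs
  refine (measureReal_mono ?_ (measure_ne_top _ _)).trans hD
  intro ω hω
  simp only [Set.mem_ofPred_eq] at hω ⊢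
  -- The squared expectation is at most 12 divided by a block size that is at least n/2, hence at
  -- most 24/n < 25/n.
  have hE : ∀ j ∈ J, ∫ ω', selfNorm (secondMoment (fun i => Z i ω') (block g j))
      (sampleMean (fun i => Z i ω') (block g j)) ∂Q ≤ 5 / √n := fun j hj => by
    have hpos := hlarge j hj
    have h1 := (hasSubgaussianMGF_blockStat hν h (Finset.card_pos.1 (by omega))
      measurable_selfNorm one_pos (hone j)).2
    have h2 : (n : ℝ) ≤ 2 * (block g j).card := by exact_mod_cast hpos
    refine le_of_sq_le_sq (h1.trans ?_) (by positivity)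
    rw [div_pow, Real.sq_sqrt hn'.le, NNReal.coe_one, div_le_div_iff₀ (by linarith) hn']
    linarith
  have hEsum := Finset.sum_le_sum hE
  rw [Finset.sum_const, nsmul_eq_mul] at hEsum
  rw [Finset.sum_sub_distrib, NNReal.coe_one]
  linarith

end Deviations

section Exceptional

variable {N' O k : ℕ}

/-- The inlier samples that are not well spread in every block, or for which the studentized means
of the clean blocks or the self-normalized means of the contaminated blocks have a large sum. -/
def exceptionalSet (ν : Measure ℝ) (n : ℕ) (p s : ℝ) (g : Fin N' ⊕ Fin O → Fin k) :
    Set (Fin N' → ℝ) :=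
  {z | (∃ j, ¬ WellSpread (secondMoment z (block (g ∘ Sum.inl) j))
      (sampleMean z (block (g ∘ Sum.inl) j))) ∨
    20 * 10 ^ (p / 2) * √(k * (s + 1) / n) +
      k * (20 * p * 10 ^ (p / 2) * (biasBound ν n + 1 / n)) ≤
      |∑ j ∈ Finset.univ.filter (fun j => outlierCount g j = 0),
        studentized p (secondMoment z (block (g ∘ Sum.inl) j))
          (sampleMean z (block (g ∘ Sum.inl) j))| ∨
    20 * √(k * (s + 1) / n) + 5 * (O / √n) ≤
      ∑ j ∈ Finset.univ.filter (fun j => outlierCount g j ≠ 0),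
        selfNorm (secondMoment z (block (g ∘ Sum.inl) j))
          (sampleMean z (block (g ∘ Sum.inl) j))}

lemma measurableSet_exceptionalSet (ν : Measure ℝ) (n : ℕ) (p s : ℝ)
    (g : Fin N' ⊕ Fin O → Fin k) : MeasurableSet (exceptionalSet ν n p s g) := by
  have hst : ∀ (B : Finset (Fin N')) {f : ℝ → ℝ → ℝ}, Measurable (fun q : ℝ × ℝ => f q.1 q.2) →
      Measurable fun z : Fin N' → ℝ => f (secondMoment z B) (sampleMean z B) := fun B f hf =>
    measurable_blockStat (Z := fun i (z : Fin N' → ℝ) => z i) (fun i => measurable_pi_apply i) B hf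
  have hsum : ∀ (J : Finset (Fin k)) {f : ℝ → ℝ → ℝ},
      Measurable (fun q : ℝ × ℝ => f q.1 q.2) → Measurable fun z : Fin N' → ℝ =>
        ∑ j ∈ J, f (secondMoment z (block (g ∘ Sum.inl) j))
          (sampleMean z (block (g ∘ Sum.inl) j)) := fun J f hf =>
    Finset.measurable_sum _ fun j _ => hst _ hf
  refine MeasurableSet.union ?_ (MeasurableSet.union ?_ ?_)
  · have : {z : Fin N' → ℝ | ∃ j, ¬ WellSpread (secondMoment z (block (g ∘ Sum.inl) j))
        (sampleMean z (block (g ∘ Sum.inl) j))} = ⋃ j, {z | (fun v m => v - m ^ 2 - (v + 1) / 10)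
          (secondMoment z (block (g ∘ Sum.inl) j)) (sampleMean z (block (g ∘ Sum.inl) j)) < 0} := by
      ext z
      simp [WellSpread]
    change MeasurableSet {z : Fin N' → ℝ | ∃ j, ¬ WellSpread
      (secondMoment z (block (g ∘ Sum.inl) j)) (sampleMean z (block (g ∘ Sum.inl) j))}
    rw [this]
    exact MeasurableSet.iUnion fun j =>
      measurableSet_lt (hst _ (f := fun v m => v - m ^ 2 - (v + 1) / 10) (by fun_prop))
        measurable_const
  · exact measurableSet_le measurable_const
      (hsum _ (f := studentized p) (measurable_studentized p)).abs
  · exact measurableSet_le measurable_const (hsum _ (f := selfNorm) measurable_selfNorm)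

/-- Three deviation events: two sides for the clean blocks, one side for the contaminated ones.
There are at most `O` contaminated blocks, which bounds the total of their expectations. -/
lemma measureReal_exceptionalSet_le {Ω : Type*} [MeasurableSpace Ω] {Q : Measure Ω}
    [IsProbabilityMeasure Q] {ν : Measure ℝ} {Z : Fin N' → Ω → ℝ} (hν : IsStandardized ν)
    (h : IsIIDSample Q ν Z) {a : ℝ} (ha : 0 < a)
    (hνa : 1 / 2 ≤ ∫ x in {x : ℝ | |x| ≤ a}, x ^ 2 ∂ν) {n : ℕ} (hn : 0 < n) (hk : 0 < k) {p : ℝ}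
    (hp : 1 ≤ p) {s : ℝ} (hs : 0 ≤ s) (g : Fin N' ⊕ Fin O → Fin k)
    (hg : ∀ j, (block g j).card = n) (hW : ∀ j, 2 * outlierCount g j ≤ n) :
    Q.real {ω | (fun i => Z i ω) ∈ exceptionalSet ν n p s g} ≤ 3 * Real.exp (-(s + 1)) +
      k * (3 * Real.exp (-(min (1 / 120) (1 / (8 * a ^ 4)) / 2 * n))) := by
  have hcard : ∀ j, (block (g ∘ Sum.inl) j).card + outlierCount g j = n := fun j => by
    rw [card_inliers_add_outlierCount, hg]
  have hn' : (0 : ℝ) < n := by exact_mod_cast hn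
  have hlarge : ∀ j, n ≤ 2 * (block (g ∘ Sum.inl) j).card := fun j => by
    have := hcard j; have := hW j; omega
  have hU := measureReal_exists_not_wellSpread_le hν h ha hνa hn (g ∘ Sum.inl) hlarge
  have hD1 := measureReal_abs_sum_studentized_ge_le hν h hn hk hp hs (g ∘ Sum.inl)
    (Finset.univ.filter (fun j => outlierCount g j = 0)) (fun j hj => by
      have := hcard j
      rw [(Finset.mem_filter.1 hj).2] at this
      simpa using this)
  have hD2 := measureReal_sum_selfNorm_ge_le hν h hn hk hs (g ∘ Sum.inl)
    (Finset.univ.filter (fun j => outlierCount g j ≠ 0)) (fun j _ => hlarge j)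
  have hJcard : ((Finset.univ.filter (fun j => outlierCount g j ≠ 0)).card : ℝ) ≤ O := by
    have h1 : (Finset.univ.filter (fun j => outlierCount g j ≠ 0)).card ≤
        ∑ j ∈ Finset.univ.filter (fun j => outlierCount g j ≠ 0), outlierCount g j := by
      rw [Finset.card_eq_sum_ones]
      exact Finset.sum_le_sum fun j hj => Nat.one_le_iff_ne_zero.2 (Finset.mem_filter.1 hj).2
    have h2 : ∑ j ∈ Finset.univ.filter (fun j => outlierCount g j ≠ 0), outlierCount g j ≤ O :=
      (Finset.sum_le_sum_of_subset (Finset.filter_subset _ _)).trans (sum_outlierCount g).le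
    exact_mod_cast h1.trans h2
  refine (measureReal_mono (s₂ := _ ∪ (_ ∪ _)) ?_ (measure_ne_top _ _)).trans
    ((measureReal_union_le _ _).trans ((add_le_add hU ((measureReal_union_le _ _).trans
      (add_le_add hD1 hD2))).trans (le_of_eq (by ring))))
  rintro ω (hω | hω | hω)
  · exact Or.inl hω
  · exact Or.inr (Or.inl hω)
  · refine Or.inr (Or.inr (le_trans ?_ hω))
    have : (0 : ℝ) ≤ 5 / √n := by positivity
    have e : 5 * ((O : ℝ) / √n) = O * (5 / √n) := by ring
    rw [e]
    gcongr

end Exceptional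

end RobustMean

namespace RobustMean

/-! ### Standardization of a law -/

section Law

variable {P : Measure ℝ}

lemma integrable_sub_mean_sq [IsProbabilityMeasure P] {δ : ℝ} (hδ : 1 ≤ δ)
    (hint : Integrable (fun x => |x - mean P| ^ (1 + δ)) P) :
    Integrable (fun x => (x - mean P) ^ 2) P := by
  refine ((integrable_const (1 : ℝ)).add hint).mono' (by fun_prop)
    (Eventually.of_forall fun x => ?_)
  rw [Real.norm_eq_abs, abs_of_nonneg (sq_nonneg _), ← sq_abs]
  simp only [Pi.add_apply]
  have h0 := abs_nonneg (x - mean P)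
  have h2 : 0 ≤ |x - mean P| ^ (1 + δ) := Real.rpow_nonneg h0 _
  rcases le_total |x - mean P| 1 with h | h
  · nlinarith
  · have h1 : |x - mean P| ^ (2 : ℝ) ≤ |x - mean P| ^ (1 + δ) :=
      Real.rpow_le_rpow_of_exponent_le h (by linarith)
    rw [Real.rpow_two] at h1
    linarith

lemma std_sq : std P ^ 2 = ∫ x, (x - mean P) ^ 2 ∂P := by
  rw [std, Real.sq_sqrt (variance_nonneg _ _), variance_eq_integral aemeasurable_id]
  rfl

/-- The law of `(X - μ) / σ` for `X` with law `P`. -/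
noncomputable def standardizedLaw (P : Measure ℝ) : Measure ℝ :=
  P.map fun x => (x - mean P) / std P

lemma isStandardized_standardizedLaw [IsProbabilityMeasure P]
    (hint : Integrable (fun x => (x - mean P) ^ 2) P) (hσ : 0 < std P) :
    IsStandardized (standardizedLaw P) := by
  have hm : Measurable fun x => (x - mean P) / std P := by fun_prop
  have hsub : Integrable (fun x => x - mean P) P := integrable_of_integrable_sq (by fun_prop) hint
  have hid : Integrable (fun x : ℝ => x) P := by
    refine (hsub.add (integrable_const (mean P))).congr (Eventually.of_forall fun x => ?_)
    simp
  refine ⟨Measure.isProbabilityMeasure_map hm.aemeasurable, ?_, ?_, ?_⟩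
  · rw [standardizedLaw, integrable_map_measure (by fun_prop) hm.aemeasurable]
    simp only [Function.comp_def, div_pow]
    exact hint.div_const _
  · rw [standardizedLaw, integral_map hm.aemeasurable (by fun_prop), integral_div,
      integral_sub hid (integrable_const _)]
    simp [mean]
  · rw [standardizedLaw, integral_map hm.aemeasurable (by fun_prop)]
    simp only [div_pow]
    rw [integral_div, ← std_sq, div_self (by positivity)]

lemma integrable_rpow_standardizedLaw {δ : ℝ}
    (hint : Integrable (fun x => |x - mean P| ^ (1 + δ)) P) (hσ : 0 < std P) :
    Integrable (fun x => |x| ^ (1 + δ)) (standardizedLaw P) := by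
  have hm : Measurable fun x => (x - mean P) / std P := by fun_prop
  rw [standardizedLaw, integrable_map_measure
    (by fun_prop : Measurable fun x : ℝ => |x| ^ (1 + δ)).aestronglyMeasurable hm.aemeasurable]
  have e : ((fun x : ℝ => |x| ^ (1 + δ)) ∘ fun x => (x - mean P) / std P) =
      fun x => |x - mean P| ^ (1 + δ) / std P ^ (1 + δ) := by
    funext x
    simp only [Function.comp_apply]
    rw [abs_div, abs_of_pos hσ, Real.div_rpow (abs_nonneg _) hσ.le]
  rw [e]
  exact hint.div_const _

/-- The admissible levels are nonempty by monotone exhaustion of the second moment, so some level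
lies below the infimum plus one, and enlarging the level only increases the integral. The absolute
value makes the level positive for every real argument. -/
lemma half_le_setIntegral_of_zeta [IsProbabilityMeasure P]
    (hint : Integrable (fun x => (x - mean P) ^ 2) P) (hσ : 0 < std P) :
    1 / 2 ≤ ∫ x in {x : ℝ | |x| ≤ |zeta P| + 1}, x ^ 2 ∂(standardizedLaw P) := by
  have hm : Measurable fun x => (x - mean P) / std P := by fun_prop
  set S : Set ℝ := {a : ℝ | 0 < a ∧
    std P ^ 2 / 2 ≤ ∫ x in {x : ℝ | |x - mean P| ≤ std P * a}, |x - mean P| ^ 2 ∂P} with hS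
  simp only [sq_abs] at hS
  have hmeas : ∀ a, MeasurableSet {x : ℝ | |x - mean P| ≤ std P * a} := fun a =>
    measurableSet_le (by fun_prop) (by fun_prop)
  have hne : S.Nonempty := by
    have hU : ⋃ n : ℕ, {x : ℝ | |x - mean P| ≤ std P * (n : ℝ)} = Set.univ := by
      refine Set.eq_univ_of_forall fun x => ?_
      obtain ⟨n, hn⟩ := exists_nat_ge (|x - mean P| / std P)
      rw [div_le_iff₀ hσ, mul_comm] at hn
      exact Set.mem_iUnion.2 ⟨n, hn⟩
    have hlim := tendsto_setIntegral_of_monotone (μ := P) (f := fun x => (x - mean P) ^ 2)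
      (s := fun n : ℕ => {x : ℝ | |x - mean P| ≤ std P * (n : ℝ)}) (fun n => hmeas _)
      (fun m n hmn x hx => le_trans (Set.mem_ofPred_eq ▸ hx) (by gcongr)) hint.integrableOn
    rw [hU, setIntegral_univ, ← std_sq] at hlim
    have hlt : std P ^ 2 / 2 < std P ^ 2 := by nlinarith [pow_pos hσ 2]
    obtain ⟨n, hn1, hn2⟩ :=
      ((hlim.eventually (lt_mem_nhds hlt)).and (eventually_gt_atTop 0)).exists
    rw [hS]
    exact ⟨n, by exact_mod_cast hn2, hn1.le⟩
  obtain ⟨b, hb, hlt⟩ := exists_lt_of_csInf_lt hne (lt_add_one (sInf S))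
  have hba : b ≤ |zeta P| + 1 := by
    have : sInf S = zeta P := rfl
    linarith [le_abs_self (zeta P)]
  have hb' := hb.2
  simp only [sq_abs] at hb'
  rw [standardizedLaw, setIntegral_map (measurableSet_le (by fun_prop) (by fun_prop))
    (by fun_prop) hm.aemeasurable]
  simp only [div_pow]
  rw [integral_div, le_div_iff₀ (by positivity)]
  refine le_trans (by linarith) (hb'.trans ?_)
  refine setIntegral_mono_set hint.integrableOn
    (Eventually.of_forall fun x => sq_nonneg _) (Eventually.of_forall fun x => ?_)
  intro hx
  change |x - mean P| ≤ std P * b at hx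
  change |(x - mean P) / std P| ≤ |zeta P| + 1
  rw [abs_div, abs_of_pos hσ, div_le_iff₀ hσ]
  nlinarith

end Law

/-! ### Atoms of a standardized law -/

section Atom

variable {ν : Measure ℝ}

/-- If almost all mass sat at z, mean zero would force |z| ≤ 1/3. The second moment up to level `a`
would then be at most 1/9 from z plus 1/4 from the remaining mass, which is less than 1/2. -/
lemma measureReal_singleton_le (hν : IsStandardized ν) {a : ℝ} (ha : 0 < a)
    (hνa : 1 / 2 ≤ ∫ x in {x : ℝ | |x| ≤ a}, x ^ 2 ∂ν) (z : ℝ) :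
    ν.real {z} ≤ 1 - min (1 / 16) (1 / (4 * a ^ 2)) := by
  have := hν.prob
  by_contra! hcon
  have hz : MeasurableSet ({z} : Set ℝ) := measurableSet_singleton z
  set q := ν.real {z} with hq
  have hr : ν.real ({z}ᶜ : Set ℝ) = 1 - q := by rw [probReal_compl_eq_one_sub hz]
  have hr1 : 1 - q < 1 / 16 := by linarith [min_le_left (1 / 16 : ℝ) (1 / (4 * a ^ 2))]
  have hr2 : 1 - q < 1 / (4 * a ^ 2) := by linarith [min_le_right (1 / 16 : ℝ) (1 / (4 * a ^ 2))]
  have hq1 : q ≤ 1 := measureReal_le_one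
  have hsing : ∀ f : ℝ → ℝ, ∫ x in {z}, f x ∂ν = q * f z := fun f => by
    rw [integral_singleton, smul_eq_mul]
  have h1 : q * z + ∫ x in ({z}ᶜ : Set ℝ), x ∂ν = 0 := by
    rw [← hsing fun x => x, integral_add_compl hz hν.integrable_id, hν.mean_zero]
  have hi : Integrable (fun x : ℝ => x ^ 2 / 8 + 2) ν :=
    (hν.integrable_sq.div_const 8).add (integrable_const _)
  have h2 : |∫ x in ({z}ᶜ : Set ℝ), x ∂ν| ≤ 1 / 8 + 2 * (1 - q) := by
    calc |∫ x in ({z}ᶜ : Set ℝ), x ∂ν| ≤ ∫ x in ({z}ᶜ : Set ℝ), (x ^ 2 / 8 + 2) ∂ν := by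
          rw [← Real.norm_eq_abs]
          refine norm_integral_le_of_norm_le hi.integrableOn (Eventually.of_forall fun x => ?_)
          rw [Real.norm_eq_abs]
          nlinarith [sq_nonneg (|x| - 4), sq_abs x]
      _ = (∫ x in ({z}ᶜ : Set ℝ), x ^ 2 ∂ν) / 8 + 2 * (1 - q) := by
          rw [integral_add (hν.integrable_sq.div_const 8).integrableOn
            (integrable_const _).integrableOn, integral_div, setIntegral_const, hr, smul_eq_mul]
          ring
      _ ≤ 1 / 8 + 2 * (1 - q) := by
          have : ∫ x in ({z}ᶜ : Set ℝ), x ^ 2 ∂ν ≤ ∫ x, x ^ 2 ∂ν :=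
            setIntegral_le_integral hν.integrable_sq (Eventually.of_forall fun x => sq_nonneg _)
          rw [hν.var_one] at this
          linarith
  have hqz : q * |z| ≤ 1 / 4 := by
    have : q * |z| = |∫ x in ({z}ᶜ : Set ℝ), x ∂ν| := by
      have e : ∫ x in ({z}ᶜ : Set ℝ), x ∂ν = -(q * z) := by linarith
      rw [e, abs_neg, abs_mul, abs_of_nonneg (measureReal_nonneg : 0 ≤ q)]
    linarith
  have hz2 : z ^ 2 ≤ 1 / 9 := by
    have h3 : |z| ≤ 1 / 3 := by nlinarith [abs_nonneg z]
    rw [← sq_abs]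
    nlinarith [abs_nonneg z]
  have hA : MeasurableSet {x : ℝ | |x| ≤ a} := measurableSet_le (by fun_prop) (by fun_prop)
  have h4 : ∫ x in {x : ℝ | |x| ≤ a}, x ^ 2 ∂ν ≤ q * z ^ 2 + a ^ 2 * (1 - q) := by
    rw [← integral_indicator hA]
    have hpt : ∀ x, {x : ℝ | |x| ≤ a}.indicator (fun x => x ^ 2) x ≤
        ({z} : Set ℝ).indicator (fun _ => z ^ 2) x +
          ({z}ᶜ : Set ℝ).indicator (fun _ => a ^ 2) x := by
      intro x
      by_cases hx : x = z
      · subst hx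
        simp only [Set.mem_singleton_iff, Set.indicator_of_mem, Set.mem_compl_iff,
          not_true_eq_false, not_false_eq_true, Set.indicator_of_notMem, add_zero]
        exact Set.indicator_le_self' (fun _ _ => sq_nonneg _) x
      · rw [Set.indicator_of_notMem (by simpa using hx) (fun _ => z ^ 2),
          Set.indicator_of_mem (show x ∈ ({z}ᶜ : Set ℝ) from hx), zero_add]
        by_cases hxa : |x| ≤ a
        · rw [Set.indicator_of_mem (show x ∈ {x : ℝ | |x| ≤ a} from hxa), ← sq_abs]
          gcongr
        · rw [Set.indicator_of_notMem (show x ∉ {x : ℝ | |x| ≤ a} from hxa)]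
          positivity
    have i1 : Integrable (({z} : Set ℝ).indicator fun _ => z ^ 2) ν :=
      (integrable_const _).indicator hz
    have i2 : Integrable (({z}ᶜ : Set ℝ).indicator fun _ => a ^ 2) ν :=
      (integrable_const _).indicator hz.compl
    refine (integral_mono (hν.integrable_sq.indicator hA) (i1.add i2) hpt).trans (le_of_eq ?_)
    rw [integral_add' i1 i2, integral_indicator hz, integral_indicator hz.compl, setIntegral_const,
      setIntegral_const, hr]
    simp only [smul_eq_mul]
    ring
  have h5 : a ^ 2 * (1 - q) ≤ 1 / 4 := by
    rw [lt_div_iff₀ (by positivity)] at hr2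
    linarith
  have h6 : q * z ^ 2 ≤ 1 / 9 := by nlinarith [sq_nonneg z]
  linarith

lemma measureReal_eq_le_of_indepFun {Ω : Type*} [MeasurableSpace Ω] {Q : Measure Ω}
    [IsProbabilityMeasure Q] [IsProbabilityMeasure ν] {U V : Ω → ℝ} (hU : Measurable U)
    (hV : Measurable V) (hind : IndepFun U V Q) (hUν : Q.map U = ν) (hVν : Q.map V = ν) {c : ℝ}
    (hc : ∀ z, ν.real {z} ≤ c) : Q.real {ω | U ω = V ω} ≤ c := by
  have hprod : Q.map (fun ω => (U ω, V ω)) = ν.prod ν := by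
    rw [(indepFun_iff_map_prod_eq_prod_map_map hU.aemeasurable hV.aemeasurable).1 hind, hUν, hVν]
  have hdiag : MeasurableSet {q : ℝ × ℝ | q.1 = q.2} :=
    measurableSet_eq_fun measurable_fst measurable_snd
  have hc0 : 0 ≤ c := measureReal_nonneg.trans (hc 0)
  have h1 : Q {ω | U ω = V ω} ≤ ENNReal.ofReal c := by
    calc Q {ω | U ω = V ω} = ν.prod ν {q : ℝ × ℝ | q.1 = q.2} := by
          rw [← hprod, Measure.map_apply (hU.prodMk hV) hdiag]; rfl
      _ = ∫⁻ x, ν (Prod.mk x ⁻¹' {q : ℝ × ℝ | q.1 = q.2}) ∂ν := Measure.prod_apply hdiag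
      _ ≤ ∫⁻ _, ENNReal.ofReal c ∂ν := by
          refine lintegral_mono fun x => ?_
          have e : Prod.mk x ⁻¹' {q : ℝ × ℝ | q.1 = q.2} = {x} := by
            ext y; simp [eq_comm]
          rw [e, ← ofReal_measureReal]
          exact ENNReal.ofReal_le_ofReal (hc x)
      _ = ENNReal.ofReal c := by simp
  rw [measureReal_def]
  exact ENNReal.toReal_le_of_le_ofReal hc0 h1

end Atom

/-- Chebyshev's inequality for the mean of a standardized sample. -/
lemma measureReal_abs_sampleMean_ge_le {Ω ι : Type*} [MeasurableSpace Ω] {Q : Measure Ω}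
    [IsProbabilityMeasure Q] {ν : Measure ℝ} {Z : ι → Ω → ℝ} (hν : IsStandardized ν)
    (h : IsIIDSample Q ν Z) {B : Finset ι} (hB : B.Nonempty) {t : ℝ} (ht : 0 < t) :
    Q.real {ω | t ≤ |sampleMean (fun i => Z i ω) B|} ≤ 1 / t ^ 2 := by
  have hm : ∀ i, Measurable (Z i) := h.meas
  have hc : (0 : ℝ) < B.card := by exact_mod_cast hB.card_pos
  have hi : ∀ i ∈ B, Integrable (fun ω => Z i ω ^ 2) Q := fun i _ =>
    h.integrable_comp i (f := fun x => x ^ 2) hν.integrable_sq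
  have hE : ∫ ω, secondMoment (fun i => Z i ω) B ∂Q = 1 := by
    simp only [secondMoment]
    rw [integral_div, integral_finsetSum _ hi,
      Finset.sum_congr rfl fun i _ => h.integral_comp i (f := fun x => x ^ 2) (by fun_prop),
      Finset.sum_const, hν.var_one, nsmul_eq_mul, mul_one, div_self hc.ne']
  have hint : Integrable (fun ω => secondMoment (fun i => Z i ω) B) Q :=
    (integrable_finsetSum _ hi).div_const _
  have hmk := mul_meas_ge_le_integral_of_nonneg (μ := Q)
    (Eventually.of_forall fun ω => secondMoment_nonneg (fun i => Z i ω) B) hint (t ^ 2)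
  rw [hE] at hmk
  rw [le_div_iff₀ (by positivity), mul_comm]
  refine le_trans (mul_le_mul_of_nonneg_left (measureReal_mono ?_ (measure_ne_top _ _))
    (sq_nonneg t)) hmk
  intro ω hω
  have h1 := sum_sub_sampleMean_sq (fun i => Z i ω) B
  have h2 : 0 ≤ ∑ i ∈ B, (Z i ω - sampleMean (fun i => Z i ω) B) ^ 2 :=
    Finset.sum_nonneg fun _ _ => sq_nonneg _
  have h3 : sampleMean (fun i => Z i ω) B ^ 2 ≤ secondMoment (fun i => Z i ω) B := by
    rw [secondMoment, le_div_iff₀ hc]; linarith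
  have h4 : t ≤ |sampleMean (fun i => Z i ω) B| := hω
  have h5 := pow_le_pow_left₀ ht.le h4 2
  rw [sq_abs] at h5
  exact h5.trans h3

end RobustMean

namespace RobustMean

/-! ### The error bound for contaminated samples -/

section Main

variable {N' O k n : ℕ}

/-- The conclusion of the error bound for the sample `x` and the partition `g`. -/
def ErrorBound (Cp φ μ σ p C s : ℝ) (n : ℕ) (x : Fin N' ⊕ Fin O → ℝ)
    (g : Fin N' ⊕ Fin O → Fin k) : Prop :=
  EventE p C σ x g →
    (∀ j, 0 < sampleStd x (block g j)) ∧ (∀ j, outlierCount g j < n) ∧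
    |estimator p x g - μ| ≤ Cp * σ / (1 - C) ^ p *
      (√((s + 1) / ((N' + O : ℕ) : ℝ)) + φ +
        alpha n σ x g ^ (-(p - 1) / 2) * ((O : ℝ) / ((k : ℝ) * √(n : ℝ))))

/-- The constant of the error bound. -/
noncomputable def errorConst (p : ℝ) : ℝ := 40 * (1 + |p|) * 4 ^ p * 20 ^ (p / 2)

lemma errorConst_pos (p : ℝ) : 0 < errorConst p := by
  unfold errorConst; positivity

lemma one_le_errorConst {p : ℝ} (hp : 1 ≤ p) : 1 ≤ errorConst p := by
  have h1 : (1 : ℝ) ≤ 4 ^ p := Real.one_le_rpow (by norm_num) (by linarith)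
  have h2 : (1 : ℝ) ≤ 20 ^ (p / 2) := Real.one_le_rpow (by norm_num) (by linarith)
  have h3 : (1 : ℝ) ≤ 40 * (1 + |p|) := by linarith [abs_nonneg p]
  unfold errorConst
  exact one_le_mul_of_one_le_of_one_le (one_le_mul_of_one_le_of_one_le h3 h1) h2

/-- Subadditivity suffices, so the event of the theorem need not be shown to be measurable. -/
lemma one_le_measureReal_add_compl {Ω : Type*} [MeasurableSpace Ω] (Q : Measure Ω)
    [IsProbabilityMeasure Q] (A : Set Ω) : 1 ≤ Q.real A + Q.real Aᶜ := by
  have := measureReal_union_le (μ := Q) A Aᶜ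
  rwa [Set.union_compl_self, probReal_univ] at this

/-- Only an inequality for φ is required, which leaves room to enlarge φ for small n. -/
lemma errorBound_of_notMem_exceptionalSet {ν : Measure ℝ} {μ σ p C s φ : ℝ} (hp : 1 ≤ p)
    (hC : C < 1) (hn : 0 < n) (hk : 0 < k) (hσ : 0 < σ) (hN : N' + O = k * n)
    (hs : 0 ≤ s) (hφ : biasBound ν n + 1 / n ≤ φ) (x : Fin N' ⊕ Fin O → ℝ)
    (g : Fin N' ⊕ Fin O → Fin k) (hg : ∀ j, (block g j).card = n)
    (hW : ∀ j, 2 * outlierCount g j ≤ n) (hx : standardize μ σ x ∉ exceptionalSet ν n p s g) :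
    ErrorBound (errorConst p) φ μ σ p C s n x g := by
  intro hE
  have hn' : (0 : ℝ) < n := by exact_mod_cast hn
  have hk' : (0 : ℝ) < k := by exact_mod_cast hk
  simp only [exceptionalSet, Set.mem_ofPred_eq, not_or, not_exists, not_not, not_le] at hx
  obtain ⟨hspread, h0, h1⟩ := hx
  refine ⟨fun j => (block_contribution hp hn hσ x g (hg j) (hW j) (hspread j)).1,
    fun j => by have := hW j; omega,
    (abs_estimator_sub_le hp hC hn hk hσ x g hg hW hspread h0.le h1.le hE).trans ?_⟩
  have hNr : ((N' + O : ℕ) : ℝ) = k * n := by rw [hN]; push_cast; ring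
  have hR : √((k : ℝ) * (s + 1) / n) = k * √((s + 1) / ((N' + O : ℕ) : ℝ)) := by
    have e : (k : ℝ) * (s + 1) / n = k ^ 2 * ((s + 1) / (k * n)) := by field_simp
    rw [hNr, e, Real.sqrt_mul (by positivity), Real.sqrt_sq hk'.le]
  rw [hR]
  set R := √((s + 1) / ((N' + O : ℕ) : ℝ)) with hRdef
  have hR0 : 0 ≤ R := Real.sqrt_nonneg _
  have hα1 := one_le_alpha (n := n) σ x g
  set α := alpha n σ x g ^ (-(p - 1) / 2) with hα
  have hα0 : 0 < α := Real.rpow_pos_of_pos (by linarith) _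
  -- The fluctuation of the contaminated blocks also carries this factor; bounding it by 1 merges
  -- that fluctuation with the one of the clean blocks.
  have hαle : α ≤ 1 := Real.rpow_le_one_of_one_le_of_nonpos hα1 (by linarith)
  have hb := biasBound_nonneg ν hn'.le
  set b := biasBound ν n + 1 / n with hbdef
  have hb0 : 0 ≤ b := by positivity
  have hC' : 0 < (1 - C) ^ p := Real.rpow_pos_of_pos (by linarith) _
  have h10 : (10 : ℝ) ^ (p / 2) ≤ 20 ^ (p / 2) :=
    Real.rpow_le_rpow (by norm_num) (by norm_num) (by linarith)
  set E := (O : ℝ) / (k * √n) with hEdef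
  have hE0 : 0 ≤ E := by positivity
  have hOE : (O : ℝ) / √n = k * E := by rw [hEdef]; field_simp
  rw [hOE, errorConst, abs_of_pos (by linarith : 0 < p)]
  have hdiv : (20 * 10 ^ (p / 2) * (k * R) + k * (20 * p * 10 ^ (p / 2) * b) +
      20 ^ (p / 2) * α * (20 * (k * R) + 5 * (k * E) + k * E)) / k =
      20 * 10 ^ (p / 2) * R + 20 * p * 10 ^ (p / 2) * b +
        20 ^ (p / 2) * α * (20 * R + 6 * E) := by field_simp; ring
  rw [hdiv]
  set t : ℝ := 20 ^ (p / 2) with ht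
  have ht0 : 0 < t := by positivity
  have hmain : 20 * 10 ^ (p / 2) * R + 20 * p * 10 ^ (p / 2) * b + t * α * (20 * R + 6 * E) ≤
      40 * (1 + p) * t * (R + φ + α * E) := by
    have e1 : 20 * 10 ^ (p / 2) * R ≤ 20 * t * R := by gcongr
    have e2 : 20 * p * 10 ^ (p / 2) * b ≤ 20 * p * t * φ := by gcongr
    have e3 : t * α * (20 * R) ≤ t * 1 * (20 * R) := by gcongr
    have e4 : 0 ≤ t * R := by positivity
    have e5 : 0 ≤ t * φ := mul_nonneg ht0.le (hb0.trans hφ)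
    have e6 : 0 ≤ t * (α * E) := by positivity
    have e7 : 0 ≤ p * (t * R) := by positivity
    have e8 : 0 ≤ p * (t * φ) := mul_nonneg (by linarith) e5
    have e9 : 0 ≤ p * (t * (α * E)) := by positivity
    nlinarith
  calc _ ≤ 4 ^ p * σ / (1 - C) ^ p * (40 * (1 + p) * t * (R + φ + α * E)) := by gcongr
    _ = _ := by ring

variable {Ω : Type*} [MeasurableSpace Ω] {Q : Measure Ω} {P : Measure ℝ}
  {X : Fin N' → Ω → ℝ} {Y : Fin O → Ω → ℝ} {G : Ω → (Fin N' ⊕ Fin O → Fin k)}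

lemma IsContaminatedSample.isIIDSample (h : IsContaminatedSample Q P n X Y G) :
    IsIIDSample Q (standardizedLaw P) fun i ω => (X i ω - mean P) / std P where
  meas i := by have := h.measurable_inlier i; fun_prop
  law i := by
    rw [standardizedLaw, ← h.law_inlier i, Measure.map_map (by fun_prop) (h.measurable_inlier i)]
    rfl
  iIndep := h.iIndep_inlier.comp (fun _ x => (x - mean P) / std P) (fun _ => by fun_prop)

lemma IsContaminatedSample.measureReal_not_equipartition (h : IsContaminatedSample Q P n X Y G) :
    Q.real {ω | ¬ ∀ j, (block (G ω) j).card = n} = 0 := by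
  have h1 : Q (G ⁻¹' (equipartitions (Fin N' ⊕ Fin O) k n)ᶜ) = 0 := by
    rw [← Measure.map_apply h.measurable_partition (Set.toFinite _).measurableSet, h.law_partition,
      ← uniformOn_inter_self (Set.toFinite _), Set.inter_compl_self, measure_empty]
  rw [measureReal_def]
  change (Q (G ⁻¹' (equipartitions (Fin N' ⊕ Fin O) k n)ᶜ)).toReal = 0
  rw [h1, ENNReal.toReal_zero]

lemma IsContaminatedSample.measureReal_outlierCount_gt_le (h : IsContaminatedSample Q P n X Y G)
    (hN : N' + O = k * n) (hO : O ≤ k) :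
    Q.real {ω | ∃ j, n < 2 * outlierCount (G ω) j} ≤ k * (2 * Real.exp (-(n / 4 : ℝ))) := by
  set T : Finset (Fin N' ⊕ Fin O) := Finset.univ.filter fun i => i.isRight = true with hT
  have hTcard : T.card ≤ k := by
    have e : T = (Finset.univ : Finset (Fin O)).map Function.Embedding.inr := by
      ext i; rcases i with i | i <;> simp [hT]
    rw [e, Finset.card_map, Finset.card_univ, Fintype.card_fin]
    exact hO
  have h1 := uniformOn_equipartitions_le (ι := Fin N' ⊕ Fin O) (k := k) (n := n)
    (by simp [hN]) hTcard (n / 2 + 1)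
  rw [← h.law_partition, map_measureReal_apply h.measurable_partition
    (Set.toFinite _).measurableSet] at h1
  have hsub : {ω | ∃ j, n < 2 * outlierCount (G ω) j} ⊆
      G ⁻¹' {g | ∃ j, n / 2 + 1 ≤ (block g j ∩ T).card} := by
    rintro ω ⟨j, hj⟩
    refine ⟨j, ?_⟩
    have e : block (G ω) j ∩ T = outlierBlock (G ω) j := by
      ext i; simp [hT, outlierBlock, block]
    rw [e]
    change n / 2 + 1 ≤ outlierCount (G ω) j
    omega
  have := h.measurable_partition
  by_cases hfin : Q (G ⁻¹' {g | ∃ j, n / 2 + 1 ≤ (block g j ∩ T).card}) = ⊤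
  · exfalso
    have h2 := measure_mono (μ := Q) (Set.subset_univ
      (G ⁻¹' {g | ∃ j, n / 2 + 1 ≤ (block g j ∩ T).card}))
    rw [hfin, top_le_iff, ← Set.preimage_univ (f := G), ← Measure.map_apply this MeasurableSet.univ,
      h.law_partition] at h2
    exact measure_ne_top _ _ h2
  refine (measureReal_mono hsub hfin).trans (h1.trans ?_)
  rw [div_eq_mul_one_div]
  have := inv_factorial_half_le n
  gcongr

lemma IsContaminatedSample.measureReal_not_errorBound_le [IsProbabilityMeasure Q]
    (h : IsContaminatedSample Q P n X Y G) (hν : IsStandardized (standardizedLaw P))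
    (hσ : 0 < std P) {a : ℝ} (ha : 0 < a)
    (hνa : 1 / 2 ≤ ∫ x in {x : ℝ | |x| ≤ a}, x ^ 2 ∂(standardizedLaw P)) {p C s φ : ℝ}
    (hp : 1 ≤ p) (hC : C < 1) (hn : 0 < n) (hk : 0 < k) (hN : N' + O = k * n)
    (hO : (O : ℝ) ≤ C * k) (hs : 0 ≤ s) (hφ : biasBound (standardizedLaw P) n + 1 / n ≤ φ) :
    Q.real {ω | ¬ ErrorBound (errorConst p) φ (mean P) (std P) p C s n (combined X Y ω) (G ω)} ≤
      3 * Real.exp (-(s + 1)) + k * (3 * Real.exp (-(min (1 / 120) (1 / (8 * a ^ 4)) / 2 * n)) +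
        2 * Real.exp (-(n / 4 : ℝ))) := by
  have hk' : (0 : ℝ) < k := by exact_mod_cast hk
  have hOk : O ≤ k := by
    have : (O : ℝ) ≤ k := by nlinarith
    exact_mod_cast this
  have hsample := h.isIIDSample
  set ν := standardizedLaw P
  set T : Set (Fin N' ⊕ Fin O → Fin k) :=
    {g | (∀ j, (block g j).card = n) ∧ ∀ j, 2 * outlierCount g j ≤ n} with hT
  -- Only the independence of inliers and partition is used from here on.
  have hind : IndepFun (fun ω (i : Fin N') => (X i ω - mean P) / std P) G Q :=
    h.indep.comp (φ := fun z i => (z i - mean P) / std P) (ψ := Prod.snd)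
      (by fun_prop) measurable_snd
  have h1 := measureReal_mem_le_of_indepFun h.measurable_partition hind
    (A := fun g => exceptionalSet ν n p s g) (T := T)
    (fun g => measurableSet_exceptionalSet ν n p s g) (by positivity)
    (fun g hg => measureReal_exceptionalSet_le hν hsample ha hνa hn hk hp hs g hg.1 hg.2)
  have h2 := h.measureReal_not_equipartition
  have h3 := h.measureReal_outlierCount_gt_le hN hOk
  refine (measureReal_mono (s₂ := _ ∪ (_ ∪ _)) ?_ (measure_ne_top _ _)).trans
    ((measureReal_union_le _ _).trans ((add_le_add h1 ((measureReal_union_le _ _).trans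
      (add_le_add h2.le h3))).trans (le_of_eq (by ring))))
  intro ω hω
  by_contra hcon
  simp only [Set.mem_union, Set.mem_ofPred_eq, not_or, not_not, not_exists, not_lt] at hcon hω
  obtain ⟨d1, d2, d3⟩ := hcon
  refine hω (errorBound_of_notMem_exceptionalSet hp hC hn hk hσ hN hs hφ _ _ d2 d3 fun hmem => ?_)
  exact d1 ⟨⟨d2, d3⟩, hmem⟩

/-- A single clean block with a small mean satisfies the error bound. -/
lemma IsContaminatedSample.measureReal_not_errorBound_le_of_single [IsProbabilityMeasure Q]
    {G : Ω → (Fin N' ⊕ Fin O → Fin 1)} (h : IsContaminatedSample Q P n X Y G)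
    (hν : IsStandardized (standardizedLaw P)) (hσ : 0 < std P) {a : ℝ} (ha : 0 < a)
    (hνa : 1 / 2 ≤ ∫ x in {x : ℝ | |x| ≤ a}, x ^ 2 ∂(standardizedLaw P)) {p C s φ t : ℝ}
    (hp : 1 ≤ p) (hC0 : 0 ≤ C) (hC : C < 1) (hn : 2 ≤ n) (hO : O = 0) (hN : N' + O = n)
    (ht : 0 < t) (hφ : t ≤ φ) :
    Q.real {ω | ¬ ErrorBound (errorConst p) φ (mean P) (std P) p C s n (combined X Y ω) (G ω)} ≤
      1 - min (1 / 16) (1 / (4 * a ^ 2)) + 1 / t ^ 2 := by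
  have hsample := h.isIIDSample
  have hνp := hν.prob
  have hN2 : 2 ≤ N' := by omega
  set i₀ : Fin N' := ⟨0, by omega⟩
  set i₁ : Fin N' := ⟨1, by omega⟩
  have hne : i₀ ≠ i₁ := by simp [i₀, i₁, Fin.ext_iff]
  have h1 := measureReal_eq_le_of_indepFun (hsample.meas i₀) (hsample.meas i₁)
    (hsample.iIndep.indepFun hne) (hsample.law i₀) (hsample.law i₁)
    (measureReal_singleton_le hν ha hνa)
  have h2 := measureReal_abs_sampleMean_ge_le hν hsample
    (B := (Finset.univ : Finset (Fin N'))) ⟨i₀, Finset.mem_univ _⟩ ht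
  refine (measureReal_mono ?_ (measure_ne_top _ _)).trans
    ((measureReal_union_le _ _).trans (add_le_add h1 h2))
  intro ω hω
  by_contra hcon
  simp only [Set.mem_union, Set.mem_ofPred_eq, not_or, not_le] at hcon
  obtain ⟨d1, d2⟩ := hcon
  refine hω fun _ => ?_
  set x := combined X Y ω with hx
  have hblock : ∀ {ι : Type} [Fintype ι] (g : ι → Fin 1) (j : Fin 1),
      block g j = Finset.univ := fun g j => by
    ext i; simp [block, Subsingleton.elim (g i) j]
  have hcard : ∀ j, (block (G ω) j).card = n := fun j => by
    rw [hblock, Finset.card_univ]; simp [hN]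
  have hcount : ∀ j, outlierCount (G ω) j = 0 := fun j => by
    have h3 := (sum_outlierCount (G ω)).trans hO
    exact (Finset.sum_eq_zero_iff.1 h3) j (Finset.mem_univ _)
  have hstd : ∀ j, 0 < sampleStd x (block (G ω) j) := fun j => by
    refine lt_of_le_of_ne (Real.sqrt_nonneg _) fun h0 => ?_
    have h3 := sampleStd_sq x (block (G ω) j)
    rw [← h0, zero_pow two_ne_zero, mul_zero, eq_comm,
      Finset.sum_eq_zero_iff_of_nonneg fun _ _ => sq_nonneg _] at h3
    have h4 : ∀ i : Fin N', X i ω = sampleMean x (block (G ω) j) := fun i => by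
      have h5 := h3 (Sum.inl i) (by rw [hblock]; exact Finset.mem_univ _)
      have h6 := pow_eq_zero_iff two_ne_zero |>.1 h5
      have h7 : x (Sum.inl i) = X i ω := rfl
      linarith
    exact d1 (by rw [h4 i₀, h4 i₁])
  refine ⟨hstd, fun j => by rw [hcount]; omega, ?_⟩
  have hest : estimator p x (G ω) = sampleMean x (block (G ω) 0) := by
    have h3 : 0 < sampleStd x (block (G ω) 0) ^ p := Real.rpow_pos_of_pos (hstd 0) _
    rw [estimator, Fin.sum_univ_one, weight, Fin.sum_univ_one, div_self (by positivity), one_mul]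
  have hmean := (block_decomposition (μ := mean P) (by omega : 0 < n) hσ x (G ω) (hcard 0)
    (by rw [hcount]; omega)).1
  rw [hest, hmean, hcount, Nat.cast_zero, zero_div, zero_mul, sub_zero, hblock, abs_mul,
    abs_of_pos hσ]
  have d2' : |sampleMean (standardize (mean P) (std P) x) Finset.univ| < t := d2
  have hα0 : 0 < alpha n (std P) x (G ω) ^ (-(p - 1) / 2) :=
    Real.rpow_pos_of_pos (by linarith [one_le_alpha (n := n) (std P) x (G ω)]) _
  -- Since `C` is nonnegative, the constant of the error bound is at least σ, so the bound on the
  -- standardized sample mean is enough.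
  have hC1 : (1 - C) ^ p ≤ 1 := Real.rpow_le_one (by linarith) (by linarith) (by linarith)
  have hC2 : 0 < (1 - C) ^ p := Real.rpow_pos_of_pos (by linarith) _
  have hconst : std P ≤ errorConst p * std P / (1 - C) ^ p := by
    rw [le_div_iff₀ hC2]
    have := one_le_errorConst hp
    nlinarith
  refine mul_le_mul hconst ?_ (abs_nonneg _) (hσ.le.trans hconst)
  have h8 : 0 ≤ √((s + 1) / ((N' + O : ℕ) : ℝ)) := Real.sqrt_nonneg _
  have h9 : 0 ≤ alpha n (std P) x (G ω) ^ (-(p - 1) / 2) *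
      ((O : ℝ) / (((1 : ℕ) : ℝ) * √(n : ℝ))) := by positivity
  linarith

/-- The rate `c` and the threshold `m` from which the exponential bounds take effect. -/
lemma exists_rate {a : ℝ} (ha : 0 < a) : ∃ c m : ℝ, 0 < c ∧ 0 < m ∧
    (∀ y, m ≤ y → 3 * Real.exp (-(min (1 / 120) (1 / (8 * a ^ 4)) / 2 * y)) +
      2 * Real.exp (-(y / 4)) ≤ Real.exp (-(c * y))) ∧
    c * m ≤ min (1 / 16) (1 / (4 * a ^ 2)) / 2 := by
  set r := min (1 / 120) (1 / (8 * a ^ 4)) / 2 with hr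
  set ε := min (1 / 16) (1 / (4 * a ^ 2)) with hε
  have hr0 : 0 < r := half_pos (lt_min (by norm_num) (by positivity))
  have hr1 : r ≤ 1 / 4 := by
    have := min_le_left (1 / 120 : ℝ) (1 / (8 * a ^ 4))
    rw [hr]; linarith
  have hε0 : 0 < ε := lt_min (by norm_num) (by positivity)
  have hm0 : 0 < 8 / r := by positivity
  -- For ry ≥ 8 one has exp(ry/2) ≥ 1 + 4, so halving the rate absorbs the constant 5 = 3 + 2. The
  -- second term of the minimum makes c · m at most ε/2.
  refine ⟨min (r / 2) (ε / 2 / (8 / r)), 8 / r, lt_min (by positivity) (by positivity), hm0,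
    fun y hy => ?_, ?_⟩
  · have hy0 : 0 < y := hm0.trans_le hy
    have hry : 8 ≤ r * y := by rwa [div_le_iff₀ hr0, mul_comm] at hy
    have h1 : Real.exp (-(y / 4)) ≤ Real.exp (-(r * y)) := by
      gcongr
      nlinarith
    have h2 : 5 * Real.exp (-(r * y)) ≤ Real.exp (-(r / 2 * y)) := by
      have h3 : 5 ≤ Real.exp (r / 2 * y) := by
        have := Real.add_one_le_exp (r / 2 * y); linarith
      have h4 : Real.exp (-(r * y)) * Real.exp (r / 2 * y) = Real.exp (-(r / 2 * y)) := by
        rw [← Real.exp_add]; congr 1; ring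
      rw [← h4, mul_comm]
      gcongr
    have h5 : Real.exp (-(r / 2 * y)) ≤ Real.exp (-(min (r / 2) (ε / 2 / (8 / r)) * y)) := by
      gcongr
      exact min_le_left _ _
    linarith
  · calc min (r / 2) (ε / 2 / (8 / r)) * (8 / r) ≤ ε / 2 / (8 / r) * (8 / r) := by
          gcongr; exact min_le_right _ _
      _ = ε / 2 := by field_simp

end Main

end RobustMean

/-! ### Assembly of the theorem: large blocks, and small blocks with one or several of them -/

open RobustMean in
theorem theorem2 :
    ∃ (Cp : ℝ → ℝ) (c : ℝ → ℝ), (∀ p, 0 < Cp p) ∧ (∀ z, 0 < c z) ∧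
      ∀ (P : Measure ℝ) (_ : IsProbabilityMeasure P) (δ : ℝ),
        1 ≤ δ → δ ≤ 2 →
        Integrable (fun x => |x - RobustMean.mean P| ^ (1 + δ)) P →
        0 < RobustMean.std P →
        ∃ φ : ℕ → ℝ,
          (δ < 2 → φ =o[atTop] (fun n : ℕ => (n : ℝ) ^ (-δ / 2))) ∧
          (δ = 2 → φ =O[atTop] (fun n : ℕ => ((n : ℝ))⁻¹)) ∧
          ∀ (p : ℝ), 1 ≤ p →
          ∀ (N' O k n : ℕ), 1 ≤ k → 2 ≤ n → N' + O = k * n →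
          ∀ (C : ℝ), C < 1 → (O : ℝ) ≤ C * (k : ℝ) →
          ∀ (Ω : Type*) (_ : MeasurableSpace Ω) (Q : Measure Ω) (_ : IsProbabilityMeasure Q)
            (X : Fin N' → Ω → ℝ) (Y : Fin O → Ω → ℝ) (G : Ω → (Fin N' ⊕ Fin O → Fin k)),
            RobustMean.IsContaminatedSample Q P n X Y G →
          ∀ (s : ℝ), 0 ≤ s →
            1 - 2 * Real.exp (-s) - (k : ℝ) * Real.exp (-(c (RobustMean.zeta P) * (n : ℝ))) ≤
              Q.real {ω |
                RobustMean.EventE p C (RobustMean.std P) (RobustMean.combined X Y ω) (G ω) →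
                  (∀ j, 0 < RobustMean.sampleStd (RobustMean.combined X Y ω)
                    (RobustMean.block (G ω) j)) ∧
                  (∀ j, RobustMean.outlierCount (G ω) j < n) ∧
                  |RobustMean.estimator p (RobustMean.combined X Y ω) (G ω)
                      - RobustMean.mean P| ≤
                    Cp p * RobustMean.std P / (1 - C) ^ p *
                      (√((s + 1) / ((N' + O : ℕ) : ℝ)) + φ n +
                        RobustMean.alpha n (RobustMean.std P) (RobustMean.combined X Y ω) (G ω)
                            ^ (-(p - 1) / 2) *
                          ((O : ℝ) / ((k : ℝ) * √(n : ℝ))))} := by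
  have ha : ∀ z : ℝ, 0 < |z| + 1 := fun z => by positivity
  choose c m hc hm hrate hcm using fun z : ℝ => exists_rate (ha z)
  refine ⟨errorConst, c, errorConst_pos, hc, fun P hP δ hδ1 hδ2 hint hσ => ?_⟩
  have hsq := integrable_sub_mean_sq hδ1 hint
  have hν := isStandardized_standardizedLaw hsq hσ
  have hνδ := integrable_rpow_standardizedLaw hint hσ
  have hνa := half_le_setIntegral_of_zeta hsq hσ
  set z := zeta P with hz
  set a := |z| + 1 with hadef
  set ν := standardizedLaw P with hνdef
  set ε := min (1 / 16) (1 / (4 * a ^ 2)) with hε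
  have hε0 : 0 < ε := lt_min (by norm_num) (by have := ha z; positivity)
  have hε1 : ε ≤ 1 / 16 := min_le_left _ _
  -- Chosen so that Chebyshev's inequality at level `t` costs ε/2, half of the gap left by the atom
  -- bound.
  set t := √(2 / ε) with ht
  have ht0 : 0 < t := Real.sqrt_pos.2 (by positivity)
  have ht2 : 1 / t ^ 2 = ε / 2 := by rw [ht, Real.sq_sqrt (by positivity), one_div_div]
  -- The extra `t` in φ is present only below the threshold and does not affect the asymptotics.
  have heq : (fun n : ℕ => biasBound ν n + 1 / n + if (n : ℝ) < m z then t else 0) =ᶠ[atTop]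
      fun n : ℕ => biasBound ν n + (n : ℝ)⁻¹ := by
    filter_upwards [tendsto_natCast_atTop_atTop.eventually_ge_atTop (m z)] with n hn
    rw [if_neg (not_lt.2 hn), add_zero, one_div]
  refine ⟨fun n => biasBound ν n + 1 / n + if (n : ℝ) < m z then t else 0, fun hδ => ?_,
    fun hδ => ?_, ?_⟩
  · refine heq.trans_isLittleO ((biasBound_isLittleO (by linarith) hδ hνδ).add ?_)
    have h1 : Tendsto (fun n : ℕ => (n : ℝ) ^ (-(1 - δ / 2))) atTop (nhds 0) :=
      (tendsto_rpow_neg_atTop (by linarith)).comp tendsto_natCast_atTop_atTop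
    have h2 := ((isLittleO_one_iff ℝ).2 h1).mul_isBigO
      (isBigO_refl (fun n : ℕ => (n : ℝ) ^ (-δ / 2)) atTop)
    refine h2.congr' ?_ (.of_forall fun n => one_mul _)
    filter_upwards [eventually_gt_atTop 0] with n hn
    rw [← Real.rpow_add (by exact_mod_cast hn), ← Real.rpow_neg_one]
    congr 1; ring
  · refine heq.trans_isBigO (IsBigO.add ?_ (isBigO_refl _ _))
    exact biasBound_isBigO (by rwa [hδ] at hνδ)
  intro p hp N' O k n hk hn hN C hC hO Ω _ Q _ X Y G hsample s hs
  have hk' : (1 : ℝ) ≤ k := by exact_mod_cast hk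
  have hn' : (0 : ℝ) < n := by exact_mod_cast (by omega : 0 < n)
  have hite : 0 ≤ if (n : ℝ) < m z then t else 0 := by split_ifs <;> linarith
  have hb := biasBound_nonneg ν hn'.le
  have hfail : Q.real {ω | ¬ ErrorBound (errorConst p)
      (biasBound ν n + 1 / n + if (n : ℝ) < m z then t else 0) (mean P) (std P) p C s n
      (combined X Y ω) (G ω)} ≤ 2 * Real.exp (-s) + k * Real.exp (-(c z * n)) := by
    rcases le_or_gt (m z) n with hlarge | hsmall
    -- Running the deviation bounds at level s + 1 turns the factor 3 into 3/e ≤ 2.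
    · refine (hsample.measureReal_not_errorBound_le hν hσ (ha z) hνa hp hC (by omega) hk hN hO hs
        (le_add_of_nonneg_right hite)).trans (add_le_add ?_ ?_)
      · have h1 : Real.exp (-(s + 1)) = Real.exp (-s) / Real.exp 1 := by
          rw [← Real.exp_sub]; congr 1; ring
        have h2 := Real.exp_one_gt_d9
        rw [h1, ← mul_div_assoc, div_le_iff₀ (by linarith)]
        nlinarith [Real.exp_pos (-s)]
      · gcongr
        exact hrate z n hlarge
    · have hcn : c z * n ≤ ε / 2 :=
        (mul_le_mul_of_nonneg_left hsmall.le (hc z).le).trans (hcm z)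
      have hexp : 1 - ε / 2 ≤ Real.exp (-(c z * n)) := by
        linarith [Real.add_one_le_exp (-(c z * n))]
      have hs0 := Real.exp_pos (-s)
      -- For k = 1 the hypothesis 𝒪 ≤ C < 1 leaves no outliers, and failure has probability at most
      -- 1 - ε + ε/2 ≤ e^(-cn). For k ≥ 2 the claim is vacuous, since k e^(-cn) ≥ 2(1 - ε/2) ≥ 1.
      rcases hk.eq_or_lt with rfl | hk2
      · have hO0 : O = 0 := by
          have : (O : ℝ) < 1 := by
            rw [Nat.cast_one, mul_one] at hO; linarith
          have : O < 1 := by exact_mod_cast this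
          omega
        have hC0 : 0 ≤ C := by
          rw [Nat.cast_one, mul_one] at hO
          exact (Nat.cast_nonneg O).trans hO
        have h1 := hsample.measureReal_not_errorBound_le_of_single (s := s) hν hσ (ha z) hνa hp
          hC0 hC hn hO0 (by simpa using hN) ht0
          (φ := biasBound ν n + 1 / n + if (n : ℝ) < m z then t else 0)
          (by rw [if_pos hsmall]; linarith [one_div_pos.2 hn'])
        rw [ht2] at h1
        push_cast
        linarith
      · have hk2' : (2 : ℝ) ≤ k := by exact_mod_cast hk2
        have h1 : (1 : ℝ) ≤ k * Real.exp (-(c z * n)) := by nlinarith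
        have h2 : Q.real {ω | ¬ ErrorBound (errorConst p)
          (biasBound ν n + 1 / n + if (n : ℝ) < m z then t else 0) (mean P) (std P) p C s n
          (combined X Y ω) (G ω)} ≤ 1 := measureReal_le_one
        linarith
  have htotal := one_le_measureReal_add_compl Q {ω | ErrorBound (errorConst p)
      (biasBound ν n + 1 / n + if (n : ℝ) < m z then t else 0) (mean P) (std P) p C s n
      (combined X Y ω) (G ω)}
  have hcompl : {ω | ErrorBound (errorConst p)
      (biasBound ν n + 1 / n + if (n : ℝ) < m z then t else 0) (mean P) (std P) p C s n
      (combined X Y ω) (G ω)}ᶜ = {ω | ¬ ErrorBound (errorConst p)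
      (biasBound ν n + 1 / n + if (n : ℝ) < m z then t else 0) (mean P) (std P) p C s n
      (combined X Y ω) (G ω)} := rfl
  rw [hcompl] at htotal
  have hgoal : 1 - 2 * Real.exp (-s) - k * Real.exp (-(c z * n)) ≤ Q.real {ω |
      ErrorBound (errorConst p) (biasBound ν n + 1 / n + if (n : ℝ) < m z then t else 0) (mean P)
        (std P) p C s n (combined X Y ω) (G ω)} := by linarith
  exact hgoal
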